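/- Let $k,l,q,\tau$ be natural-number parameters, each computable (in unary) in polynomial time from the security parameter $1^n$, and let $\Sigma$ be an alphabet of size $q$. Suppose the following are given. 1. A public-key encryption scheme $\mathsf{PKE}=(\mathsf{Gen},\mathsf{Enc},\mathsf{Dec})$ with probabilistic polynomial-time $\mathsf{Gen},\mathsf{Enc}$ and deterministic polynomial-time $\mathsf{Dec}$. 2. A randomized encoding function $\mathsf{E}$ from a plaintext space $\mathcal M$ to a space $\mathcal M_{\mathsf{Cor}}$ of $k$-tuples of plaintexts of $\mathsf{PKE}$, with a polynomial-time decoding function $\mathsf{D}$ satisfying $\mathsf{D}(\mathsf{E}(\mathsf m;s))=\mathsf m$. The space $\mathcal M_{\mathsf{Cor}}$ is $\tau$-correlated: some polynomial-time algorithm recovers each tuple in $\mathcal M_{\mathsf{Cor}}$ from any $\tau$ of its entries. 3. The correlated scheme $\mathsf{PKE_{Cor}}=(\mathsf{Gen_{Cor}},\mathsf{Enc_{Cor}},\mathsf{Dec_{Cor}})$. $\mathsf{Gen_{Cor}}$ draws $k$ independent key pairs $(\mathsf{pk}_i,\mathsf{sk}_i)$ of $\mathsf{PKE}$. $\mathsf{Enc_{Cor}}(\mathsf{pk},\mathsf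 m)$ computes $(\tilde{\mathsf m}_1,\dots,\tilde{\mathsf m}_k)=\mathsf{E}(\mathsf m;s)$ with fresh coins $s$ and outputs $(\mathsf{Enc}(\mathsf{pk}_1,\tilde{\mathsf m}_1),\dots,\mathsf{Enc}(\mathsf{pk}_k,\tilde{\mathsf m}_k))$. $\mathsf{Dec_{Cor}}(\mathsf{sk},\mathsf c)$ computes $\tilde{\mathsf m}=(\mathsf{Dec}(\mathsf{sk}_i,\mathsf c_i))_{i}$ and outputs $\mathsf{D}(\tilde{\mathsf m})$ if $\tilde{\mathsf m}\in\mathcal M_{\mathsf{Cor}}$, and $\perp$ otherwise. These three algorithms are assumed to run in polynomial time, and $\mathsf{PKE_{Cor}}$ is assumed to be IND-CPA secure and $\tau$-verifiable. The latter means that there is a deterministic polynomial-time algorithm $\mathsf{Verify}$ such that for all key tuples $(\mathsf{pk},\mathsf{sk})$ generated by $\mathsf{Gen_{Cor}}$, all $\mathsf c=(\mathsf c_1,\dots,\mathsf c_k)$ and all $T\subseteq\{1,\dots,k\}$ with $|T|=\tau$, one has $\mathsf{Verify}(\mathsf c,\mathsf{pk},T,\mathsf{sk}_T)=1$ if and only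 if $\mathsf{Dec_{Cor}}(\mathsf{sk},\mathsf c)\neq\perp$. 4. A polynomial-time computable error-correcting code $\mathsf{ECC}:\Sigma^l\to\Sigma^k$ with minimum distance at least $\tau$, that is, $\mathsf{ECC}(v)$ and $\mathsf{ECC}(w)$ differ in at least $\tau$ positions whenever $v\ne w$. 5. A one-time strongly unforgeable signature scheme $\mathsf{SS}=(\mathsf{Gen},\mathsf{Sign},\mathsf{Ver})$ with polynomial-time algorithms and verification keys in $\Sigma^l$, which can sign all ciphertexts of $\mathsf{PKE_{Cor}}$. Define the public-key encryption scheme $\mathsf{PKE}'_{cca2}$ as follows. Key generation draws independent key pairs $(\mathsf{pk}_i^a,\mathsf{sk}_i^a)$ of $\mathsf{PKE}$ for all $1\le i\le k$ and $a\in\Sigma$; the public key consists of all $\mathsf{pk}_i^a$ and the secret key of all $\mathsf{sk}_i^a$. For $\mathsf d\in\Sigma^k$ write $\mathsf{pk}^{\mathsf d}=(\mathsf{pk}_1^{\mathsf d_1},\dots,\mathsf{pk}_k^{\mathsf d_k})$, and similarly $\mathsf{sk}^{\mathsf d}$. To encrypt $\mathsf m\in\mathcal M$, draw a fresh signature key pair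 $(\mathsf{vk},\mathsf{dsk})$, put $\mathsf d=\mathsf{ECC}(\mathsf{vk})$, compute $\mathsf c'=\mathsf{Enc_{Cor}}(\mathsf{pk}^{\mathsf d},\mathsf m)$ and $\sigma=\mathsf{Sign}(\mathsf{dsk},\mathsf c')$, and output $(\mathsf c',\mathsf{vk},\sigma)$. To decrypt $(\mathsf c',\mathsf{vk},\sigma)$, output $\perp$ if $\mathsf{Ver}(\mathsf{vk},\mathsf c',\sigma)=0$; otherwise put $\mathsf d=\mathsf{ECC}(\mathsf{vk})$ and output $\mathsf{Dec_{Cor}}(\mathsf{sk}^{\mathsf d},\mathsf c')$. Then $\mathsf{PKE}'_{cca2}$ is IND-CCA2 secure: every probabilistic polynomial-time two-stage adversary with access to the decryption oracle in both stages (barred in the second stage from querying the challenge ciphertext) has negligible advantage in $n$ in the indistinguishability experiment. (Completeness of the schemes is not needed.) -/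

import Mathlib

namespace CorPKE

/-! ## Data and programs -/

/-- The objects that algorithms handle: finite binary trees with bits at the leaves
(S-expressions). A bit string is the list of its bits, a pair of objects is a node. -/
inductive Data : Type
  | atom (b : Bool) : Data
  | pair (x y : Data) : Data

namespace Data

/-- The length of an object: its number of inner nodes (a bit string of length `m` has
length `m`, and the code of `1^n` has length `n`). -/
def size : Data → ℕ
  | atom _ => 0
  | pair x y => x.size + y.size + 1

/-- First component (an atom is its own component). -/
def hd : Data → Data
  | atom b => atom b
  | pair x _ => x

/-- Second component (an atom is its own component). -/
def tl : Data → Data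
  | atom b => atom b
  | pair _ y => y

def isPair : Data → Bool
  | atom _ => false
  | pair _ _ => true

/-- Whether the object is the bit `1`. -/
def isOne : Data → Bool
  | atom b => b
  | pair _ _ => false

end Data

/-- Probabilistic oracle programs. Every program maps an object to an object:
* `id`, `atom b`, `hd`, `tl`, `isPair` are the basic operations;
* `pair P Q` maps `x` to the pair `(P x, Q x)`, `comp P Q` maps `x` to `Q (P x)`;
* `cond B P Q` maps `x` to `P x` if `B x` is the bit `1`, and to `Q x` otherwise;
* `loop B P` maps `x` to the result of applying `P` to it `|B x|` times in a row;
* `coin` returns a fresh fair random bit, `query` passes `x` to the oracle and returns the answer.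

All loops are clocked. As a polynomial clock can be computed by nested loops, the programs
of polynomial cost are, up to a polynomial in the running time, exactly the probabilistic
polynomial-time (oracle) Turing machines. -/
inductive Prog : Type
  | id : Prog
  | atom (b : Bool) : Prog
  | hd : Prog
  | tl : Prog
  | isPair : Prog
  | pair (P Q : Prog) : Prog
  | comp (P Q : Prog) : Prog
  | cond (B P Q : Prog) : Prog
  | loop (B P : Prog) : Prog
  | coin : Prog
  | query : Prog

/-- A fair random bit. -/
noncomputable def fairCoin : PMF Bool := PMF.uniformOfFintype Bool

/-- Run the costed computation `f` `m` times in a row, adding up the costs. -/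
noncomputable def iterate (f : Data → PMF (Data × ℕ)) : ℕ → Data → PMF (Data × ℕ)
  | 0, x => PMF.pure (x, 0)
  | m + 1, x => (f x).bind fun u => (iterate f m u.1).map fun v => (v.1, u.2 + v.2)

namespace Prog

/-- The joint distribution of output and running time of a program with oracle `O` on an input.
An operation that writes an object `y` takes `|y| + 1` steps, and
every composed instruction takes one more step than its parts. -/
noncomputable def run (O : Data → Data) : Prog → Data → PMF (Data × ℕ)
  | id, x => PMF.pure (x, x.size + 1)
  | atom b, _ => PMF.pure (Data.atom b, 1)
  | hd, x => PMF.pure (x.hd, x.hd.size + 1)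
  | tl, x => PMF.pure (x.tl, x.tl.size + 1)
  | isPair, x => PMF.pure (Data.atom x.isPair, 1)
  | pair P Q, x => (run O P x).bind fun u => (run O Q x).map fun v =>
      (Data.pair u.1 v.1, u.2 + v.2 + 1)
  | comp P Q, x => (run O P x).bind fun u => (run O Q u.1).map fun v => (v.1, u.2 + v.2 + 1)
  | cond B P Q, x => (run O B x).bind fun u =>
      (if u.1.isOne = true then run O P x else run O Q x).map fun v => (v.1, u.2 + v.2 + 1)
  | loop B P, x => (run O B x).bind fun u =>
      (iterate (run O P) u.1.size x).map fun v => (v.1, u.2 + (x.size + 1) + v.2)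
  | coin, _ => fairCoin.map fun b => (Data.atom b, 1)
  | query, x => PMF.pure (O x, (O x).size + 1)

/-- The distribution of the output. -/
noncomputable def exec (O : Data → Data) (P : Prog) (x : Data) : PMF Data :=
  (P.run O x).map Prod.fst

/-- With certainty, `P` with oracle `O` halts on `x` after at most `t` steps. -/
def HaltsWithin (O : Data → Data) (P : Prog) (x : Data) (t : ℕ) : Prop :=
  ∀ u ∈ (P.run O x).support, u.2 ≤ t

end Prog

/-- The trivial oracle, for algorithms without oracle access. -/
def noOracle : Data → Data := fun _ => Data.atom false

/-- Probabilistic polynomial-time programs without oracle access. -/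
def Prog.IsPPT (P : Prog) : Prop :=
  ∃ p : Polynomial ℕ, ∀ x, P.HaltsWithin noOracle x (p.eval x.size)

/-- Probabilistic polynomial-time oracle programs: whatever the oracle is, as long as its answers
have length polynomial in a parameter `N` and the length of the query, the running time
(and so the number of queries) is polynomial in `N` and the length of the input.
Every oracle algorithm that stops as soon as its running time exceeds a fixed polynomial in the
length of its input satisfies this. -/
def Prog.IsOraclePPT (P : Prog) : Prop :=
  ∀ r : Polynomial ℕ, ∃ p : Polynomial ℕ, ∀ (N : ℕ) (O : Data → Data),
    (∀ y, (O y).size ≤ r.eval (N + y.size)) →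
      ∀ x, P.HaltsWithin O x (p.eval (N + x.size))

/-! ## Coding of structured objects -/

/-- A type whose elements are written as objects that programs handle. -/
class Coded (α : Type) where
  code : α → Data
  code_injective : Function.Injective code


/-- The object that represents `a`. -/
def code {α : Type} [Coded α] (a : α) : Data := Coded.code a

open Classical in
/-- The element that an object represents, if there is one. -/
noncomputable def decode (α : Type) [Coded α] (x : Data) : Option α :=
  if h : ∃ a : α, code a = x then some h.choose else none

instance : Coded Data := ⟨fun x => x, fun _ _ h => h⟩

instance : Coded Unit := ⟨fun _ => Data.atom false, fun _ _ _ => rfl⟩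

instance : Coded Bool := ⟨Data.atom, fun _ _ h => by simpa using h⟩

/-- The unary code `1^n` of `n`. -/
def unary : ℕ → Data
  | 0 => Data.atom false
  | n + 1 => Data.pair (Data.atom true) (unary n)

theorem unary_injective : Function.Injective unary := by
  intro a
  induction a with
  | zero => intro b h; cases b <;> simp_all [unary]
  | succ a ih =>
    intro b h
    cases b with
    | zero => simp [unary] at h
    | succ b => rw [ih (by simpa [unary] using h)]

instance : Coded ℕ := ⟨unary, unary_injective⟩

instance {m : ℕ} : Coded (Fin m) :=
  ⟨fun i => unary i, fun _ _ h => Fin.ext (unary_injective h)⟩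

instance {α β : Type} [Coded α] [Coded β] : Coded (α × β) :=
  ⟨fun u => Data.pair (Coded.code u.1) (Coded.code u.2), fun u v h => by
    simp only [Data.pair.injEq] at h
    exact Prod.ext (Coded.code_injective h.1) (Coded.code_injective h.2)⟩

instance {α : Type} [Coded α] : Coded (Option α) :=
  ⟨fun u => match u with
    | none => Data.atom false
    | some a => Data.pair (Data.atom true) (Coded.code a), fun u v h => by
    cases u <;> cases v <;> simp_all [Coded.code_injective.eq_iff]⟩

/-- The list of the codes of the entries. -/
def codeList {α : Type} [Coded α] : List α → Data
  | [] => Data.atom false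
  | a :: s => Data.pair (Coded.code a) (codeList s)

theorem codeList_injective {α : Type} [Coded α] :
    Function.Injective (codeList : List α → Data) := by
  intro s
  induction s with
  | nil => intro t h; cases t <;> simp_all [codeList]
  | cons a s ih =>
    intro t h
    cases t with
    | nil => simp [codeList] at h
    | cons b t =>
      simp only [codeList, Data.pair.injEq] at h
      rw [Coded.code_injective h.1, ih h.2]

instance {m : ℕ} {α : Type} [Coded α] : Coded (Fin m → α) :=
  ⟨fun f => codeList (List.ofFn f), fun _ _ h => List.ofFn_injective (codeList_injective h)⟩

/-! ## Polynomial-time algorithms and negligible functions -/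

/-- The family `f` of randomized functions is computed by a probabilistic polynomial-time
algorithm, which gets the security parameter as `1^n` along with the argument. -/
def PolyTime {α β : ℕ → Type} [∀ n, Coded (α n)] [∀ n, Coded (β n)]
    (f : ∀ n, α n → PMF (β n)) : Prop :=
  ∃ P : Prog, P.IsPPT ∧ ∀ n a, P.exec noOracle (code (n, a)) = (f n a).map code

/-- The family `f` of functions is computed in polynomial time. -/
def DetPolyTime {α β : ℕ → Type} [∀ n, Coded (α n)] [∀ n, Coded (β n)]
    (f : ∀ n, α n → β n) : Prop :=
  PolyTime fun n a => PMF.pure (f n a)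

/-- A natural-number parameter, such as a length, with `1^(k n)` computable from `1^n` in
polynomial time. -/
def EfficientParam (k : ℕ → ℕ) : Prop :=
  DetPolyTime (α := fun _ => Unit) (β := fun _ => ℕ) fun n _ => k n

def Negligible (f : ℕ → ℝ) : Prop :=
  Asymptotics.SuperpolynomialDecay Filter.atTop (fun n : ℕ => (n : ℝ)) f

/-- Independent draws from `p 0, …, p (m - 1)`. -/
noncomputable def indep {α : Type} : ∀ {m : ℕ}, (Fin m → PMF α) → PMF (Fin m → α)
  | 0, _ => PMF.pure Fin.elim0
  | _ + 1, p => (p 0).bind fun a => (indep fun i => p i.succ).map fun f => Fin.cons a f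

/-! ## Public-key encryption -/

/-- The algorithms of a public-key encryption scheme, for every security parameter, with the
message space that a public key specifies; `none` is the error symbol. No completeness is
imposed: it plays no role in the security notions. -/
structure PKE (PK SK Ctx : ℕ → Type) where
  Msg : ∀ n, PK n → Set Data
  gen : ∀ n, PMF (PK n × SK n)
  enc : ∀ n, PK n → Data → PMF (Ctx n)
  dec : ∀ n, SK n → Ctx n → Option Data

namespace PKE

variable {PK SK Ctx : ℕ → Type} [∀ n, Coded (PK n)] [∀ n, Coded (SK n)] [∀ n, Coded (Ctx n)]

/-- Key generation and encryption are probabilistic polynomial-time, and decryption is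
deterministic polynomial-time. -/
def Efficient (S : PKE PK SK Ctx) : Prop :=
  PolyTime (α := fun _ => Unit) (fun n _ => S.gen n) ∧
  PolyTime (α := fun n => PK n × Data) (fun n u => S.enc n u.1 u.2) ∧
  DetPolyTime (α := fun n => SK n × Ctx n) (fun n u => S.dec n u.1 u.2)

/-- The decryption oracle; it answers with the error symbol outside the ciphertext space. -/
noncomputable def decOracle (S : PKE PK SK Ctx) (n : ℕ) (sk : SK n) (x : Data) : Data :=
  code ((decode (Ctx n) x).bind (S.dec n sk))

open Classical in
/-- The decryption oracle that refuses to decrypt `c`. -/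
noncomputable def decOracleExcept (S : PKE PK SK Ctx) (n : ℕ) (sk : SK n) (c : Ctx n)
    (x : Data) : Data :=
  if x = code c then code (none : Option Data) else S.decOracle n sk x

open Classical in
/-- The indistinguishability experiment with the two-stage adversary `(A₁, A₂)`, where
`O₁ sk` is the oracle of the first stage and `O₂ sk c` that of the second stage
with challenge ciphertext `c`. The first stage outputs `(m₀, (m₁, state))`; if `m₀, m₁` are not
messages of equal length, then the result is a fair coin, so that nothing is gained. -/
noncomputable def indExp (S : PKE PK SK Ctx) (A₁ A₂ : Prog) (n : ℕ)
    (O₁ : SK n → Data → Data) (O₂ : SK n → Ctx n → Data → Data) : PMF Bool :=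
  (S.gen n).bind fun key =>
  (A₁.exec (O₁ key.2) (code (n, key.1))).bind fun x =>
  if x.hd ∈ S.Msg n key.1 ∧ x.tl.hd ∈ S.Msg n key.1 ∧ x.hd.size = x.tl.hd.size then
    fairCoin.bind fun b =>
    (S.enc n key.1 (if b then x.tl.hd else x.hd)).bind fun c =>
    (A₂.exec (O₂ key.2 c) (code (n, (c, x.tl.tl)))).map fun y =>
      decide (b = y.isOne)
  else fairCoin

noncomputable def cpaExp (S : PKE PK SK Ctx) (A₁ A₂ : Prog) (n : ℕ) : PMF Bool :=
  S.indExp A₁ A₂ n (fun _ => noOracle) (fun _ _ => noOracle)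

noncomputable def cca2Exp (S : PKE PK SK Ctx) (A₁ A₂ : Prog) (n : ℕ) : PMF Bool :=
  S.indExp A₁ A₂ n (fun sk => S.decOracle n sk) (fun sk c => S.decOracleExcept n sk c)

/-- Indistinguishability against chosen-plaintext attacks. -/
def INDCPA (S : PKE PK SK Ctx) : Prop :=
  ∀ A₁ A₂ : Prog, A₁.IsPPT → A₂.IsPPT →
    Negligible fun n => |(S.cpaExp A₁ A₂ n true).toReal - 1 / 2|

/-- Indistinguishability against adaptive chosen-ciphertext attacks. -/
def INDCCA2 (S : PKE PK SK Ctx) : Prop :=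
  ∀ A₁ A₂ : Prog, A₁.IsOraclePPT → A₂.IsOraclePPT →
    Negligible fun n => |(S.cca2Exp A₁ A₂ n true).toReal - 1 / 2|

end PKE

/-! ## Signatures -/

/-- The algorithms of a signature scheme with verification keys in `VK n` and message
space `M n`. Again no completeness is imposed. -/
structure SigScheme (VK M : ℕ → Type) where
  gen : ∀ n, PMF (VK n × Data)
  sign : ∀ n, Data → M n → PMF Data
  ver : ∀ n, VK n → M n → Data → Bool

namespace SigScheme

variable {VK M : ℕ → Type} [∀ n, Coded (VK n)] [∀ n, Coded (M n)]

/-- Key generation and signing are probabilistic polynomial-time, and verification is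
deterministic polynomial-time. -/
def Efficient (S : SigScheme VK M) : Prop :=
  PolyTime (α := fun _ => Unit) (fun n _ => S.gen n) ∧
  PolyTime (α := fun n => Data × M n) (fun n u => S.sign n u.1 u.2) ∧
  DetPolyTime (α := fun n => VK n × (M n × Data)) (fun n u => S.ver n u.1 u.2.1 u.2.2)

open Classical in
/-- The one-time strong unforgeability experiment. The first stage outputs `(m, state)`, the second
one `(m', σ')`; an adversary that outputs something outside the message space loses. -/
noncomputable def otsuExp (S : SigScheme VK M) (A₁ A₂ : Prog) (n : ℕ) : PMF Bool :=
  (S.gen n).bind fun key =>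
  (A₁.exec noOracle (code (n, key.1))).bind fun x =>
  match decode (M n) x.hd with
  | none => PMF.pure false
  | some m =>
    (S.sign n key.2 m).bind fun σ =>
    (A₂.exec noOracle (code (n, (m, (σ, x.tl))))).map fun y =>
      match decode (M n) y.hd with
      | none => false
      | some m' => S.ver n key.1 m' y.tl && decide ((m', y.tl) ≠ (m, σ))

/-- One-time strong unforgeability. -/
def OTSU (S : SigScheme VK M) : Prop :=
  ∀ A₁ A₂ : Prog, A₁.IsPPT → A₂.IsPPT →
    Negligible fun n => (S.otsuExp A₁ A₂ n true).toReal

end SigScheme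

/-! ## Correlated public-key encryption -/

/-- A public-key encryption scheme all of whose keys and ciphertexts are plain objects. -/
abbrev BasePKE : Type := PKE (fun _ => Data) (fun _ => Data) (fun _ => Data)

/-- The entries of the tuple `f` at the positions in `T`, the others being erased. This also
records the set `T`. -/
def restrict {m : ℕ} {α : Type} (T : Finset (Fin m)) (f : Fin m → α) : Fin m → Option α :=
  fun i => if i ∈ T then some (f i) else none

/-- A plaintext space `Msg`, a correlated plaintext space `Cor` of `k`-tuples of plaintexts of
`P`, and a randomized encoding function `E` from `Msg` to `Cor` with its decoding function `D`. -/
structure CorrelatedEncoding (P : BasePKE) (k : ℕ → ℕ) where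
  Msg : ℕ → Set Data
  Cor : ∀ n, Set (Fin (k n) → Data)
  E : ∀ n, Data → PMF (Fin (k n) → Data)
  D : ∀ n, (Fin (k n) → Data) → Data
  cor_subset : ∀ n, ∀ t ∈ Cor n, ∀ key ∈ (P.gen n).support, ∀ i, t i ∈ P.Msg n key.1
  E_mem : ∀ n, ∀ m ∈ Msg n, ∀ t ∈ (E n m).support, t ∈ Cor n
  D_E : ∀ n, ∀ m ∈ Msg n, ∀ t ∈ (E n m).support, D n t = m

/-- The tuples in `Cor` are `τ`-correlated: there is an efficient algorithm that recovers such a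
tuple from any `τ` of its entries. -/
def CorrelatedEncoding.TauCorrelated {P : BasePKE} {k : ℕ → ℕ} (C : CorrelatedEncoding P k)
    (τ : ℕ → ℕ) : Prop :=
  ∃ recover : ∀ n, (Fin (k n) → Option Data) → (Fin (k n) → Data),
    DetPolyTime (α := fun n => Fin (k n) → Option Data) (β := fun n => Fin (k n) → Data) recover ∧
    ∀ n, ∀ t ∈ C.Cor n, ∀ T : Finset (Fin (k n)), T.card = τ n → recover n (restrict T t) = t

open Classical in
/-- The correlated public-key encryption scheme: `k` independent key pairs of `P`; encryption
encrypts the entries of `E(m)` separately; decryption decrypts the entries and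
applies `D` if the result is a tuple of the correlated plaintext space. -/
noncomputable def corPKE (P : BasePKE) {k : ℕ → ℕ} (C : CorrelatedEncoding P k) :
    PKE (fun n => Fin (k n) → Data) (fun n => Fin (k n) → Data) (fun n => Fin (k n) → Data) where
  Msg n _ := C.Msg n
  gen n := (indep fun _ : Fin (k n) => P.gen n).map fun key =>
    (fun i => (key i).1, fun i => (key i).2)
  enc n pk m := (C.E n m).bind fun t => indep fun i => P.enc n (pk i) (t i)
  dec n sk c :=
    if ∃ t ∈ C.Cor n, ∀ i, P.dec n (sk i) (c i) = some (t i) then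
      some (C.D n fun i => (P.dec n (sk i) (c i)).getD (Data.atom false))
    else none

/-- `τ`-verifiability: there is an efficient deterministic algorithm that decides from a
ciphertext, the public key and any `τ` of the `k` secret keys whether the ciphertext
decrypts to a valid plaintext. -/
def TauVerifiable (P : BasePKE) {k : ℕ → ℕ} (C : CorrelatedEncoding P k) (τ : ℕ → ℕ) : Prop :=
  ∃ verify : ∀ n, (Fin (k n) → Data) → (Fin (k n) → Data) → (Fin (k n) → Option Data) → Bool,
    DetPolyTime (α := fun n => (Fin (k n) → Data) × ((Fin (k n) → Data) × (Fin (k n) → Option Data)))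
      (β := fun _ => Bool) (fun n u => verify n u.1 u.2.1 u.2.2) ∧
    ∀ n, ∀ key ∈ ((corPKE P C).gen n).support, ∀ c : Fin (k n) → Data,
      ∀ T : Finset (Fin (k n)), T.card = τ n →
        (verify n c key.1 (restrict T key.2) = true ↔ ((corPKE P C).dec n key.2 c).isSome)

/-! ## The chosen-ciphertext secure scheme -/

/-- The entries selected by the codeword `d` from a table of keys. -/
def select {k q : ℕ} (key : Fin k → Fin q → Data) (d : Fin k → Fin q) : Fin k → Data :=
  fun i => key i (d i)

/-- The scheme built from a correlated encryption scheme, a code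
`ecc : Σ^l → Σ^k` with `Σ` of size `q`, and a signature scheme with verification keys in `Σ^l`:
`q * k` independent key pairs of `P`; encryption draws fresh signature keys `(vk, dsk)`, uses the
correlated scheme under the public keys selected by `ecc vk`, and signs the resulting ciphertext;
decryption checks the signature and then decrypts with the selected secret keys. -/
noncomputable def ccaPKE (P : BasePKE) {k l q : ℕ → ℕ} (C : CorrelatedEncoding P k)
    (ecc : ∀ n, (Fin (l n) → Fin (q n)) → (Fin (k n) → Fin (q n)))
    (SS : SigScheme (fun n => Fin (l n) → Fin (q n)) (fun n => Fin (k n) → Data)) :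
    PKE (fun n => Fin (k n) → Fin (q n) → Data) (fun n => Fin (k n) → Fin (q n) → Data)
      (fun n => (Fin (k n) → Data) × ((Fin (l n) → Fin (q n)) × Data)) where
  Msg n _ := C.Msg n
  gen n := (indep fun _ : Fin (k n) => indep fun _ : Fin (q n) => P.gen n).map fun key =>
    (fun i j => (key i j).1, fun i j => (key i j).2)
  enc n pk m :=
    (SS.gen n).bind fun s =>
    ((corPKE P C).enc n (select pk (ecc n s.1)) m).bind fun c =>
    (SS.sign n s.2 c).map fun σ => (c, (s.1, σ))
  dec n sk c :=
    if SS.ver n c.2.1 c.1 c.2.2 = true then (corPKE P C).dec n (select sk (ecc n c.2.1)) c.1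
    else none

end CorPKE

open CorPKE

namespace CorPKE

/-! ## Polynomial bounds -/

/-! The proof is one game hop. Draw the challenge verification key `v` before the attack starts, and
answer decryption queries by an oracle that rejects every ciphertext carrying `v` (`rejectOracle`).
This oracle needs no secret key at the positions of the codeword of `v`. A query with another key
`w` has a codeword that differs from that of `v` in at least `τ` positions. At `τ` of these the
selected secret keys are available: they suffice to run `verify`, and when it accepts, the `τ`
decrypted entries determine the whole tuple through `recover`. This is `answer_environment`.

Two consequences follow. First, the modified attack is a chosen-plaintext attack on the correlated
scheme: the received public keys are planted at the codeword positions of a self-generated key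
table, which leaves the distribution of public keys unchanged (`keyTable_replace`,
`map_snd_hybrid`). Second, the modified and the real oracle disagree only on a correctly signed
ciphertext under `v` other than the challenge, which is a forgery. Such queries are flagged in a
log. The part of the modified attack with empty log is dominated by the real experiment
(`unflaggedLE_hybrid`), and a nonempty log is at most as likely as success of a one-time forger
(`flagged_hybrid_le`). Hence the advantage is at most a CPA advantage plus a forging probability.

A flagged query can occur before there is a challenge. The forger then asks for a signature on an
altered ciphertext, so that the logged pair is new; this requires `0 < k n`. For `k n = 0` there is
at most one message, and the experiment is a fair coin.

The remaining work is computational. Deterministic algorithms are given by probabilistic programs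
and are first derandomized (`DetPolyTime.exists_fp`). The classes `FP` and `RP` have closure
properties from which the reductions are assembled. An oracle adversary becomes an oracle-free
program by replacing its queries with code, at polynomial overhead (`exec_simulate`,
`cost_simulate`). -/

theorem Polynomial.eval_nat_mono (p : Polynomial ℕ) : Monotone fun n : ℕ => p.eval n := by
  intro a b h
  simp only [Polynomial.eval_eq_sum, Polynomial.sum]
  exact Finset.sum_le_sum fun i _ => Nat.mul_le_mul_left _ (Nat.pow_le_pow_left h i)

/-- `g x` is bounded by a polynomial in the length of `x`. -/
def PolyBounded (g : Data → ℕ) : Prop :=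
  ∃ p : Polynomial ℕ, ∀ x, g x ≤ p.eval x.size

namespace PolyBounded

variable {f g : Data → ℕ}

theorem mono (hg : PolyBounded g) (h : ∀ x, f x ≤ g x) : PolyBounded f :=
  hg.imp fun _ hp x => (h x).trans (hp x)

theorem const (c : ℕ) : PolyBounded fun _ => c := ⟨Polynomial.C c, fun x => by simp⟩

theorem size : PolyBounded Data.size := ⟨Polynomial.X, fun x => by simp⟩

theorem add (hf : PolyBounded f) (hg : PolyBounded g) : PolyBounded fun x => f x + g x := by
  obtain ⟨p, hp⟩ := hf
  obtain ⟨r, hr⟩ := hg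
  exact ⟨p + r, fun x => by simpa using Nat.add_le_add (hp x) (hr x)⟩

theorem mul (hf : PolyBounded f) (hg : PolyBounded g) : PolyBounded fun x => f x * g x := by
  obtain ⟨p, hp⟩ := hf
  obtain ⟨r, hr⟩ := hg
  exact ⟨p * r, fun x => by simpa using Nat.mul_le_mul (hp x) (hr x)⟩

theorem eval (hf : PolyBounded f) (p : Polynomial ℕ) : PolyBounded fun x => p.eval (f x) := by
  obtain ⟨r, hr⟩ := hf
  exact ⟨p.comp r, fun x => by
    simpa using Polynomial.eval_nat_mono p (hr x)⟩

theorem comp (hg : PolyBounded g) {h : Data → Data} (hh : PolyBounded fun x => (h x).size) :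
    PolyBounded fun x => g (h x) := by
  obtain ⟨p, hp⟩ := hg
  exact (hh.eval p).mono fun x => hp (h x)

end PolyBounded

/-! ## Basic facts on costed runs -/

theorem Data.size_hd_le (x : Data) : x.hd.size ≤ x.size := by
  cases x <;> simp [Data.hd, Data.size]; omega

theorem Data.size_tl_le (x : Data) : x.tl.size ≤ x.size := by
  cases x <;> simp [Data.tl, Data.size]; omega

@[simp] theorem Data.hd_pair (x y : Data) : (Data.pair x y).hd = x := rfl
@[simp] theorem Data.tl_pair (x y : Data) : (Data.pair x y).tl = y := rfl
@[simp] theorem Data.isPair_pair (x y : Data) : (Data.pair x y).isPair = true := rfl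
@[simp] theorem Data.isPair_atom (b : Bool) : (Data.atom b).isPair = false := rfl
@[simp] theorem Data.isOne_atom (b : Bool) : (Data.atom b).isOne = b := rfl

/-- With no rounds the output is the input itself and nothing is charged, hence the extra `x.size +
1`. It is the amount by which `run` charges a loop on top of its rounds. -/
theorem iterate_size_lt {f : Data → PMF (Data × ℕ)}
    (hf : ∀ x, ∀ u ∈ (f x).support, u.1.size + 1 ≤ u.2) :
    ∀ m x, ∀ u ∈ (iterate f m x).support, u.1.size + 1 ≤ x.size + 1 + u.2 := by
  intro m
  induction m with
  | zero => intro x u hu; simp only [iterate, PMF.mem_support_pure_iff] at hu; subst hu; simp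
  | succ m ih =>
    intro x u hu
    simp only [iterate, PMF.mem_support_bind_iff, PMF.mem_support_map_iff] at hu
    obtain ⟨v, hv, w, hw, rfl⟩ := hu
    have h₁ := hf x v hv
    have h₂ := ih v.1 w hw
    simp only
    omega

/-- Writing the output is part of the running time. -/
theorem Prog.size_lt_of_mem_support_run (O : Data → Data) (P : Prog) :
    ∀ x, ∀ u ∈ (P.run O x).support, u.1.size + 1 ≤ u.2 := by
  induction P with
  | id | atom | hd | tl | isPair | query =>
    intro x u hu; simp only [run, PMF.mem_support_pure_iff] at hu; subst hu; simp [Data.size]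
  | coin =>
    intro x u hu
    simp only [run, PMF.mem_support_map_iff] at hu
    obtain ⟨b, -, rfl⟩ := hu
    simp [Data.size]
  | pair P Q hP hQ =>
    intro x u hu
    simp only [run, PMF.mem_support_bind_iff, PMF.mem_support_map_iff] at hu
    obtain ⟨v, hv, w, hw, rfl⟩ := hu
    have := hP _ _ hv; have := hQ _ _ hw
    simp only [Data.size]; omega
  | comp P Q hP hQ =>
    intro x u hu
    simp only [run, PMF.mem_support_bind_iff, PMF.mem_support_map_iff] at hu
    obtain ⟨v, hv, w, hw, rfl⟩ := hu
    have := hQ _ _ hw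
    simp only; omega
  | cond B P Q hB hP hQ =>
    intro x u hu
    simp only [run, PMF.mem_support_bind_iff, PMF.mem_support_map_iff] at hu
    obtain ⟨v, hv, w, hw, rfl⟩ := hu
    have : w.1.size + 1 ≤ w.2 := by
      split_ifs at hw
      exacts [hP _ _ hw, hQ _ _ hw]
    simp only; omega
  | loop B P hB hP =>
    intro x u hu
    simp only [run, PMF.mem_support_bind_iff, PMF.mem_support_map_iff] at hu
    obtain ⟨v, hv, w, hw, rfl⟩ := hu
    have := iterate_size_lt hP _ _ _ hw
    simp only; omega

theorem iterate_pure {f : Data → PMF (Data × ℕ)} {g : Data → Data} {c : Data → ℕ}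
    (hf : ∀ x, f x = PMF.pure (g x, c x)) (m : ℕ) (x : Data) :
    iterate f m x = PMF.pure (g^[m] x, ∑ i ∈ Finset.range m, c (g^[i] x)) := by
  induction m generalizing x with
  | zero => simp [iterate]
  | succ m ih =>
    simp [iterate, hf, ih, PMF.pure_bind, PMF.pure_map, Finset.sum_range_succ', Nat.add_comm]

/-! ## Functions computed in polynomial time on all objects -/

/-- `f` is computed by a deterministic program whose running time is polynomial on all inputs. -/
def FP (f : Data → Data) : Prop :=
  ∃ (P : Prog) (c : Data → ℕ), PolyBounded c ∧ ∀ O x, P.run O x = PMF.pure (f x, c x)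

/-- `b` is decided by a deterministic program whose running time is polynomial on all inputs. -/
def FPB (b : Data → Bool) : Prop := FP fun x => Data.atom (b x)

namespace FP

variable {f g h : Data → Data}

theorem polyBounded (hf : FP f) : PolyBounded fun x => (f x).size := by
  obtain ⟨P, c, hc, hP⟩ := hf
  refine hc.mono fun x => ?_
  have := P.size_lt_of_mem_support_run noOracle x (f x, c x) (by simp [hP])
  simp only at this
  omega

theorem id : FP fun x => x :=
  ⟨.id, fun x => x.size + 1, PolyBounded.size.add (.const 1), fun _ _ => rfl⟩

theorem comp (hg : FP g) (hf : FP f) : FP fun x => g (f x) := by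
  have hfs := hf.polyBounded
  obtain ⟨P, c, hc, hP⟩ := hf
  obtain ⟨Q, d, hd, hQ⟩ := hg
  refine ⟨.comp P Q, fun x => c x + d (f x) + 1, (hc.add (hd.comp hfs)).add (.const 1),
    fun O x => ?_⟩
  simp [Prog.run, hP, hQ, PMF.pure_bind, PMF.pure_map]

theorem pair (hf : FP f) (hg : FP g) : FP fun x => Data.pair (f x) (g x) := by
  obtain ⟨P, c, hc, hP⟩ := hf
  obtain ⟨Q, d, hd, hQ⟩ := hg
  refine ⟨.pair P Q, fun x => c x + d x + 1, (hc.add hd).add (.const 1), fun O x => ?_⟩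
  simp [Prog.run, hP, hQ, PMF.pure_bind, PMF.pure_map]

theorem hd (hf : FP f) : FP fun x => (f x).hd :=
  comp (g := Data.hd) ⟨.hd, fun x => x.hd.size + 1,
    (PolyBounded.size.mono Data.size_hd_le).add (.const 1), fun _ _ => rfl⟩ hf

theorem tl (hf : FP f) : FP fun x => (f x).tl :=
  comp (g := Data.tl) ⟨.tl, fun x => x.tl.size + 1,
    (PolyBounded.size.mono Data.size_tl_le).add (.const 1), fun _ _ => rfl⟩ hf

theorem const (c : Data) : FP fun _ => c := by
  induction c with
  | atom b => exact ⟨.atom b, fun _ => 1, .const 1, fun _ _ => rfl⟩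
  | pair x y hx hy => exact hx.pair hy

theorem ite {b : Data → Bool} (hb : FPB b) (hf : FP f) (hg : FP g) :
    FP fun x => if b x = true then f x else g x := by
  obtain ⟨B, e, he, hB⟩ := hb
  obtain ⟨P, c, hc, hP⟩ := hf
  obtain ⟨Q, d, hd, hQ⟩ := hg
  refine ⟨.cond B P Q, fun x => e x + (if b x = true then c x else d x) + 1,
    ((he.add (hc.add hd)).add (.const 1)).mono fun x => ?_, fun O x => ?_⟩
  · split_ifs <;> omega
  · simp only [Prog.run, hB, PMF.pure_bind, Data.isOne_atom]
    split_ifs with h <;> simp [h, hP, hQ, PMF.pure_map]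

theorem cond {b : Data → Bool} (hb : FPB b) (hf : FP f) (hg : FP g) :
    FP fun x => bif b x then f x else g x := by
  convert FP.ite hb hf hg using 2 with x
  cases h : b x <;> simp

/-- A polynomial body iterated polynomially often can still produce exponentially long objects, for
instance by repeated doubling. The bound on all intermediate states excludes this, and the total
cost is then at most the number of rounds times the cost of the body at length `b x`. -/
theorem loop {m : Data → Data} (hh : FP h) (hm : FP m) (hg : FP g) {b : Data → ℕ}
    (hb : PolyBounded b) (hgb : ∀ x, ∀ i ≤ (m (h x)).size, (g^[i] (h x)).size ≤ b x) :
    FP fun x => g^[(m (h x)).size] (h x) := by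
  have hhs := hh.polyBounded
  have hms := (hm.comp hh).polyBounded
  obtain ⟨H, e, he, hH⟩ := hh
  obtain ⟨B, c, hc, hB⟩ := hm
  obtain ⟨P, d, hd, hP⟩ := hg
  obtain ⟨p, hp⟩ := hd
  refine ⟨.comp H (.loop B P), fun x => e x + (c (h x) + ((h x).size + 1) +
    ∑ i ∈ Finset.range (m (h x)).size, d (g^[i] (h x))) + 1,
    ((he.add (((hc.comp hhs).add (hhs.add (.const 1))).add
      (hms.mul (hb.eval p)))).add (.const 1)).mono fun x => ?_, fun O x => ?_⟩
  · have : ∑ i ∈ Finset.range (m (h x)).size, d (g^[i] (h x)) ≤ (m (h x)).size * p.eval (b x) := by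
      refine (Finset.sum_le_card_nsmul _ _ (p.eval (b x)) fun i hi => ?_).trans (by simp)
      exact (hp _).trans (Polynomial.eval_nat_mono p (hgb x i (Finset.mem_range.1 hi).le))
    omega
  · simp [Prog.run, hH, hB, PMF.pure_bind, PMF.pure_map, iterate_pure (hP O)]

end FP

namespace FPB

variable {b c : Data → Bool} {f g : Data → Data}

theorem const (a : Bool) : FPB fun _ => a := FP.const _

theorem isPair (hf : FP f) : FPB fun x => (f x).isPair :=
  FP.comp (g := fun x => Data.atom x.isPair) ⟨.isPair, fun _ => 1, .const 1, fun _ _ => rfl⟩ hf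

theorem ite {a : Data → Bool} (ha : FPB a) (hb : FPB b) (hc : FPB c) :
    FPB fun x => if a x = true then b x else c x := by
  unfold FPB
  convert FP.ite ha hb hc using 2 with x
  cases h : a x <;> simp [h]

theorem not (hb : FPB b) : FPB fun x => !b x := by
  convert ite hb (const false) (const true) using 2 with x
  cases b x <;> rfl

theorem and (hb : FPB b) (hc : FPB c) : FPB fun x => b x && c x := by
  convert ite hb hc (const false) using 2 with x
  cases b x <;> rfl

theorem or (hb : FPB b) (hc : FPB c) : FPB fun x => b x || c x := by
  convert ite hb (const true) hc using 2 with x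
  cases b x <;> rfl

theorem isOne (hf : FP f) : FPB fun x => (f x).isOne := by
  refine FP.comp (g := fun x => Data.atom x.isOne) ?_ hf
  refine ⟨.cond .id (.atom true) (.atom false), fun x => x.size + 1 + 1 + 1,
    ((PolyBounded.size.add (.const 1)).add (.const 1)).add (.const 1), fun O x => ?_⟩
  simp only [Prog.run, PMF.pure_bind]
  cases h : x.isOne <;> simp [PMF.pure_map]

theorem comp (hb : FPB b) (hf : FP f) : FPB fun x => b (f x) := FP.comp hb hf

end FPB

/-! ## Equality test -/

/-- Equality of objects. -/
def Data.eqb : Data → Data → Bool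
  | atom a, atom b => a == b
  | pair x y, pair z w => x.eqb z && y.eqb w
  | _, _ => false

theorem Data.eqb_iff : ∀ x y : Data, x.eqb y = true ↔ x = y := by
  intro x
  induction x with
  | atom a => intro y; cases y <;> simp [Data.eqb]
  | pair x y hx hy => intro z; cases z <;> simp [Data.eqb, hx, hy]

/-- One step of the comparison of the entries `(x, y)` of a stack; the first component
of the state records whether all comparisons succeeded so far. -/
def eqStep (s : Data) : Data :=
  if s.tl.isPair = true then
    if (s.tl.hd.hd.isPair && s.tl.hd.tl.isPair) = true then
      .pair s.hd (.pair (.pair s.tl.hd.hd.hd s.tl.hd.tl.hd)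
        (.pair (.pair s.tl.hd.hd.tl s.tl.hd.tl.tl) s.tl.tl))
    else if (!s.tl.hd.hd.isPair && (!s.tl.hd.tl.isPair &&
        if s.tl.hd.hd.isOne = true then s.tl.hd.tl.isOne else !s.tl.hd.tl.isOne)) = true then
      .pair s.hd s.tl.tl
    else .pair (.atom false) s.tl.tl
  else s

/-- Splitting a pair of pairs rearranges five inner nodes without creating any; the other cases pop
an entry. So the comparison never needs more space than its initial state. -/
theorem size_eqStep_le (s : Data) : (eqStep s).size ≤ s.size := by
  unfold eqStep
  rcases s with b | ⟨f, b | ⟨p, r⟩⟩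
  · simp [Data.tl]
  · simp
  rcases p with (_ | _) | ⟨(_ | _) | ⟨x₁, x₂⟩, (_ | _) | ⟨y₁, y₂⟩⟩ <;>
    simp [Data.size, Data.hd, Data.tl, Data.isPair, Data.isOne] <;> omega

/-- The number of steps is at most the number of nodes of `x`, leaves included, and is smaller when
a mismatch pops an entry unexplored. It does not depend on the flag and the rest of the stack, so
the comparisons of the two halves can be chained. -/
theorem iterate_eqStep (x : Data) : ∀ y : Data, ∃ m ≤ 2 * x.size + 1, ∀ (a : Bool) (r : Data),
    eqStep^[m] (.pair (.atom a) (.pair (.pair x y) r)) = .pair (.atom (a && x.eqb y)) r := by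
  induction x with
  | atom b =>
    intro y
    refine ⟨1, by omega, fun a r => ?_⟩
    cases y with
    | atom c => cases b <;> cases c <;> simp [eqStep, Data.eqb]
    | pair z w => simp [eqStep, Data.eqb]
  | pair x₁ x₂ h₁ h₂ =>
    intro y
    cases y with
    | atom c => exact ⟨1, by omega, fun a r => by simp [eqStep, Data.eqb]⟩
    | pair y₁ y₂ =>
      obtain ⟨m₁, hm₁, h₁⟩ := h₁ y₁
      obtain ⟨m₂, hm₂, h₂⟩ := h₂ y₂
      refine ⟨m₂ + m₁ + 1, by simp only [Data.size]; omega, fun a r => ?_⟩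
      rw [Function.iterate_succ_apply, Function.iterate_add_apply]
      simp [eqStep, h₁, h₂, Data.eqb, Bool.and_assoc]

theorem FP.eqStep : FP CorPKE.eqStep := by
  have hs := FP.id
  have h := hs.tl.hd.hd
  have k := hs.tl.hd.tl
  exact .ite (.isPair hs.tl) (.ite (.and (.isPair h) (.isPair k))
    (hs.hd.pair ((h.hd.pair k.hd).pair ((h.tl.pair k.tl).pair hs.tl.tl)))
    (.ite (.and (.not (.isPair h)) (.and (.not (.isPair k))
      (.ite (.isOne h) (.isOne k) (.not (.isOne k))))) (hs.hd.pair hs.tl.tl)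
      ((FP.const _).pair hs.tl.tl))) hs

theorem FPB.eqb {f g : Data → Data} (hf : FP f) (hg : FP g) : FPB fun x => (f x).eqb (g x) := by
  have hinit : FP fun x => Data.pair (.atom true) (.pair (.pair (f x) (g x)) (.atom false)) :=
    (FP.const _).pair ((hf.pair hg).pair (FP.const _))
  have hsize : ∀ i s, (CorPKE.eqStep^[i] s).size ≤ s.size := by
    intro i
    induction i with
    | zero => intro s; simp
    | succ i ih =>
      intro s
      rw [Function.iterate_succ_apply]
      exact (ih _).trans (size_eqStep_le s)
  -- The clock is the initial state paired with itself: its length exceeds `2 * (f x).size + 1`.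
  -- Surplus steps are idle, because an empty stack is a fixed point.
  have := (FP.loop hinit (FP.id.pair FP.id) FP.eqStep hinit.polyBounded
    fun x i _ => hsize i _).hd
  unfold FPB
  convert this using 2 with x
  obtain ⟨m, hm, h⟩ := iterate_eqStep (f x) (g x)
  obtain ⟨t, ht⟩ := Nat.exists_eq_add_of_le (show m ≤ (Data.pair
    (Data.pair (.atom true) (.pair (.pair (f x) (g x)) (.atom false)))
    (Data.pair (.atom true) (.pair (.pair (f x) (g x)) (.atom false)))).size by
      simp only [Data.size]; omega)
  have hfix : ∀ (t : ℕ) (a : Bool), CorPKE.eqStep^[t] (.pair (.atom a) (.atom false)) =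
      .pair (.atom a) (.atom false) := by
    intro t a
    exact Function.iterate_fixed (by simp [CorPKE.eqStep]) t
  rw [ht, Nat.add_comm, Function.iterate_add_apply, h, hfix]
  simp

/-! ## Recursion, tables and bounded search -/

theorem size_unary (n : ℕ) : (unary n).size = n := by
  induction n with
  | zero => rfl
  | succ n ih => simp [unary, Data.size, ih]

/-- Primitive recursion with parameter `x`. -/
def natRec (b : Data → Data) (s : Data → Data → Data → Data) (x : Data) : ℕ → Data
  | 0 => b x
  | i + 1 => s x (unary i) (natRec b s x i)

/-- The loop state is `(x, (unary i, value))`: parameter and counter travel along with the value. As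
in `FP.loop`, all intermediate values must be bounded. -/
theorem FP.natRec {b m : Data → Data} {s : Data → Data → Data → Data} (hb : FP b)
    (hs : FP fun v => s v.hd v.tl.hd v.tl.tl) (hm : FP m) {B : Data → ℕ} (hB : PolyBounded B)
    (hbound : ∀ x, ∀ i ≤ (m x).size, (CorPKE.natRec b s x i).size ≤ B x) :
    FP fun x => CorPKE.natRec b s x (m x).size := by
  have hit : ∀ x i, (fun v : Data => Data.pair v.hd (.pair (.pair (.atom true) v.tl.hd)
      (s v.hd v.tl.hd v.tl.tl)))^[i] (.pair x (.pair (.atom false) (b x))) =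
      .pair x (.pair (unary i) (CorPKE.natRec b s x i)) := by
    intro x i
    induction i with
    | zero => rfl
    | succ i ih => rw [Function.iterate_succ_apply', ih]; rfl
  have hx := FP.id
  have := FP.loop (h := fun x => .pair x (.pair (.atom false) (b x)))
    (hx.pair ((FP.const _).pair hb)) (hm.comp hx.hd)
    (g := fun v : Data => Data.pair v.hd (.pair (.pair (.atom true) v.tl.hd)
      (s v.hd v.tl.hd v.tl.tl)))
    (hx.hd.pair (((FP.const _).pair hx.tl.hd).pair hs))
    (PolyBounded.size.add ((hm.polyBounded.add hB).add (.const 2)))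
    (fun x i hi => by
      rw [hit]
      have := hbound x i hi
      simp only [Data.hd_pair] at hi
      simp only [Data.size, size_unary]
      omega)
  convert this.tl.tl using 2 with x
  simp only [hit, Data.hd_pair, Data.tl_pair]

/-- Entry of a list. The position is given by the length of an object. -/
def nth (x u : Data) : Data := (Data.tl^[u.size] x).hd

theorem size_iterate_tl_le (x : Data) (i : ℕ) : (Data.tl^[i] x).size ≤ x.size := by
  induction i with
  | zero => simp
  | succ i ih => rw [Function.iterate_succ_apply']; exact (Data.size_tl_le _).trans ih

theorem FP.drop {f g : Data → Data} (hf : FP f) (hg : FP g) :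
    FP fun x => Data.tl^[(g x).size] (f x) := by
  have hx := FP.id
  have := FP.loop (h := fun x => .pair (g x) (f x)) (hg.pair hf) hx.hd
    (g := fun v => .pair v.hd v.tl.tl) (hx.hd.pair hx.tl.tl)
    (((hg.polyBounded).add hf.polyBounded).add (.const 1)) (b := fun x => (g x).size + (f x).size + 1)
    (fun x i _ => by
      have : (fun v : Data => Data.pair v.hd v.tl.tl)^[i] (.pair (g x) (f x)) =
          .pair (g x) (Data.tl^[i] (f x)) := by
        induction i with
        | zero => rfl
        | succ i ih => rw [Function.iterate_succ_apply', ih (by omega), Function.iterate_succ_apply']; rfl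
      rw [this]
      have := size_iterate_tl_le (f x) i
      simp only [Data.size]
      omega)
  convert this.tl using 2 with x
  simp only [Data.hd_pair]
  generalize (g x).size = i
  generalize g x = y
  suffices h : (fun v : Data => Data.pair v.hd v.tl.tl)^[i] (.pair y (f x)) =
      .pair y (Data.tl^[i] (f x)) by rw [h]; rfl
  induction i with
  | zero => rfl
  | succ i ih => rw [Function.iterate_succ_apply', ih, Function.iterate_succ_apply']; rfl

theorem FP.nth {f g : Data → Data} (hf : FP f) (hg : FP g) : FP fun x => CorPKE.nth (f x) (g x) :=
  (hf.drop hg).hd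

theorem PolyBounded.comp_pair {g : Data → ℕ} (hg : PolyBounded g) {f : Data → ℕ}
    (hf : PolyBounded f) : ∃ b, PolyBounded b ∧ ∀ x y : Data, y.size ≤ f x → g (.pair x y) ≤ b x := by
  obtain ⟨p, hp⟩ := hg
  refine ⟨fun x => p.eval (x.size + f x + 1), ((PolyBounded.size.add hf).add (.const 1)).eval p,
    fun x y hy => (hp _).trans (Polynomial.eval_nat_mono p ?_)⟩
  simp only [Data.size]
  omega

/-- The list of the values of `g` at the proper tails of `M`, from the last `i` ones. -/
def tabFrom (g : Data → Data) (M : Data) : ℕ → Data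
  | 0 => .atom false
  | i + 1 => .pair (g (Data.tl^[i] M).tl) (tabFrom g M i)

/-- The list of the values `g 0, …, g (m - 1)` where `M` is the unary code of `m`. -/
def tabulate (g : Data → Data) (M : Data) : Data := tabFrom g M M.size

theorem iterate_tl_unary (m i : ℕ) : Data.tl^[i] (unary m) = unary (m - i) := by
  induction i with
  | zero => rfl
  | succ i ih =>
    rw [Function.iterate_succ_apply', ih]
    rcases h : m - i with _ | j
    · rw [show m - (i + 1) = 0 by omega]; rfl
    · rw [show m - (i + 1) = j by omega]; rfl

theorem codeList_ofFn_eq_map_range {m : ℕ} (g : ℕ → Data) :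
    codeList (List.ofFn fun i : Fin m => g i) = codeList ((List.range m).map g) := by
  rw [List.ofFn_eq_map, ← List.map_coe_finRange_eq_range, List.map_map]
  rfl

/-- The proper tails of `unary m` are the numerals `m - 1, …, 0`. Visiting them in this order while
prepending yields the list in increasing order, without reversal. -/
theorem tabulate_unary (g : Data → Data) (m : ℕ) :
    tabulate g (unary m) = codeList (List.ofFn fun i : Fin m => g (unary i)) := by
  rw [codeList_ofFn_eq_map_range fun i => g (unary i), tabulate, size_unary]
  suffices h : ∀ i ≤ m, tabFrom g (unary m) i =
      codeList ((List.range' (m - i) i).map fun i => g (unary i)) by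
    rw [h m le_rfl, List.range_eq_range']; simp
  intro i
  induction i with
  | zero => intro; rfl
  | succ i ih =>
    intro hi
    rw [tabFrom, ih (by omega), iterate_tl_unary, List.range'_succ,
      show m - (i + 1) + 1 = m - i by omega]
    rcases h : m - i with _ | j
    · omega
    · rw [show m - (i + 1) = j by omega]; rfl

theorem FP.tabulate {g : Data → Data → Data} {m : Data → Data} (hg : FP fun w => g w.hd w.tl)
    (hm : FP m) : FP fun x => CorPKE.tabulate (g x) (m x) := by
  have hx := FP.id
  obtain ⟨b, hb, hgb⟩ := hg.polyBounded.comp_pair hm.polyBounded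
  have hrec : ∀ x i, CorPKE.natRec (fun _ => .atom false)
      (fun x u acc => .pair (g x (Data.tl^[u.size] (m x)).tl) acc) x i = tabFrom (g x) (m x) i := by
    intro x i
    induction i with
    | zero => rfl
    | succ i ih => rw [CorPKE.natRec, ih, tabFrom, size_unary]
  have hdrop : FP fun v => (Data.tl^[v.tl.hd.size] (m v.hd)).tl :=
    ((hm.comp hx.hd).drop hx.tl.hd).tl
  have := FP.natRec (b := fun _ => .atom false)
    (s := fun x u acc => .pair (g x (Data.tl^[u.size] (m x)).tl) acc) (FP.const _)
    ((hg.comp (hx.hd.pair hdrop)).pair hx.tl.tl) hm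
    (hm.polyBounded.mul (hb.add (.const 1))) (fun x i hi => by
      rw [hrec]
      refine le_trans ?_ (Nat.mul_le_mul_right _ hi)
      clear hi
      induction i with
      | zero => simp [tabFrom, Data.size]
      | succ i ih =>
        have := hgb x (Data.tl^[i] (m x)).tl
          ((Data.size_tl_le _).trans (size_iterate_tl_le _ _))
        simp only [Data.hd_pair, Data.tl_pair] at this
        rw [tabFrom, Data.size, Nat.succ_mul]
        omega)
  simp only [hrec] at this
  exact this

/-- Whether some number below a bound has the property `p`. -/
def anyBelow (p : Data → Bool) : ℕ → Bool
  | 0 => false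
  | i + 1 => p (unary i) || anyBelow p i

theorem anyBelow_iff (p : Data → Bool) (m : ℕ) :
    anyBelow p m = true ↔ ∃ i < m, p (unary i) = true := by
  induction m with
  | zero => simp [anyBelow]
  | succ m ih =>
    simp only [anyBelow, Bool.or_eq_true, ih, Nat.lt_succ_iff_lt_or_eq]
    grind

theorem FPB.anyBelow {p : Data → Data → Bool} {m : Data → Data} (hp : FPB fun w => p w.hd w.tl)
    (hm : FP m) : FPB fun x => CorPKE.anyBelow (p x) (m x).size := by
  have hx := FP.id
  have hrec : ∀ x i, CorPKE.natRec (fun _ => .atom false)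
      (fun x u acc => .atom (p x u || acc.isOne)) x i = .atom (CorPKE.anyBelow (p x) i) := by
    intro x i
    induction i with
    | zero => rfl
    | succ i ih => rw [CorPKE.natRec, ih]; rfl
  have := FP.natRec (b := fun _ => .atom false)
    (s := fun x u acc => .atom (p x u || acc.isOne)) (FP.const _)
    (FPB.or (hp.comp (hx.hd.pair hx.tl.hd)) (.isOne hx.tl.tl)) hm
    (.const 0) (fun x i _ => by rw [hrec]; rfl)
  simp only [hrec] at this
  exact this

/-- Counting serves to single out the first `τ` positions at which two codewords differ. -/
theorem FP.count {p : Data → Data → Bool} {m : Data → Data} (hp : FPB fun w => p w.hd w.tl)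
    (hm : FP m) : FP fun x => unary (Nat.count (fun i => p x (unary i) = true) (m x).size) := by
  have hx := FP.id
  have hrec : ∀ x i, CorPKE.natRec (fun _ => .atom false)
      (fun x u acc => if p x u = true then .pair (.atom true) acc else acc) x i =
        unary (Nat.count (fun i => p x (unary i) = true) i) := by
    intro x i
    induction i with
    | zero => rfl
    | succ i ih =>
      rw [CorPKE.natRec, ih, Nat.count_succ]
      split_ifs <;> rfl
  have := FP.natRec (b := fun _ => .atom false)
    (s := fun x u acc => if p x u = true then .pair (.atom true) acc else acc) (FP.const _)
    (.ite (hp.comp (hx.hd.pair hx.tl.hd)) ((FP.const _).pair hx.tl.tl) hx.tl.tl) hm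
    hm.polyBounded (fun x i hi => by
      rw [hrec, size_unary]
      exact (Nat.count_le (p := fun i => p x (unary i) = true)).trans hi)
  simpa only [hrec] using this

/-! ## Derandomization -/

/-- Replace all coins and oracle answers by `0`. -/
def Prog.derand : Prog → Prog
  | pair P Q => pair P.derand Q.derand
  | comp P Q => comp P.derand Q.derand
  | cond B P Q => cond B.derand P.derand Q.derand
  | loop B P => loop B.derand P.derand
  | coin => atom false
  | query => atom false
  | id => id
  | atom b => atom b
  | hd => hd
  | tl => tl
  | isPair => isPair

/-- The all-zero coin sequence has positive probability, so its run inherits everything that holds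
with certainty, including the time bound. The costs agree exactly, since a coin and a query to
`noOracle` both cost as much as writing one atom. -/
theorem Prog.exists_run_derand (P : Prog) : ∀ x, ∃ u ∈ (P.run noOracle x).support,
    ∀ O, P.derand.run O x = PMF.pure u := by
  induction P with
  | id | atom | hd | tl | isPair =>
    intro x; simp only [run, derand, PMF.mem_support_pure_iff]; exact ⟨_, rfl, fun _ => rfl⟩
  | query =>
    intro x
    simp only [run, derand, PMF.mem_support_pure_iff]; exact ⟨_, rfl, fun _ => rfl⟩
  | coin =>
    intro x
    refine ⟨(.atom false, 1), ?_, fun _ => rfl⟩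
    simp [run, fairCoin]
  | pair P Q hP hQ =>
    intro x
    obtain ⟨u, hu, hu'⟩ := hP x
    obtain ⟨v, hv, hv'⟩ := hQ x
    refine ⟨(.pair u.1 v.1, u.2 + v.2 + 1), ?_, fun O => by
      simp [derand, run, hu', hv', PMF.pure_bind, PMF.pure_map]⟩
    simp only [run, PMF.mem_support_bind_iff, PMF.mem_support_map_iff]
    exact ⟨u, hu, v, hv, rfl⟩
  | comp P Q hP hQ =>
    intro x
    obtain ⟨u, hu, hu'⟩ := hP x
    obtain ⟨v, hv, hv'⟩ := hQ u.1
    refine ⟨(v.1, u.2 + v.2 + 1), ?_, fun O => by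
      simp [derand, run, hu', hv', PMF.pure_bind, PMF.pure_map]⟩
    simp only [run, PMF.mem_support_bind_iff, PMF.mem_support_map_iff]
    exact ⟨u, hu, v, hv, rfl⟩
  | cond B P Q hB hP hQ =>
    intro x
    obtain ⟨u, hu, hu'⟩ := hB x
    obtain ⟨v, hv, hv'⟩ : ∃ v ∈ (if u.1.isOne = true then P.run noOracle x
        else Q.run noOracle x).support, ∀ O, (if u.1.isOne = true then P.derand.run O x
        else Q.derand.run O x) = PMF.pure v := by
      split_ifs
      exacts [hP x, hQ x]
    refine ⟨(v.1, u.2 + v.2 + 1), ?_, fun O => by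
      simp [derand, run, hu', hv', PMF.pure_bind, PMF.pure_map]⟩
    simp only [run, PMF.mem_support_bind_iff, PMF.mem_support_map_iff]
    exact ⟨u, hu, v, hv, rfl⟩
  | loop B P hB hP =>
    intro x
    obtain ⟨u, hu, hu'⟩ := hB x
    obtain ⟨v, hv, hv'⟩ : ∃ v ∈ (iterate (P.run noOracle) u.1.size x).support,
        ∀ O, iterate (P.derand.run O) u.1.size x = PMF.pure v := by
      generalize u.1.size = m
      clear hu hu'
      induction m generalizing x with
      | zero => exact ⟨(x, 0), by simp [iterate], fun _ => rfl⟩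
      | succ m ih =>
        obtain ⟨a, ha, ha'⟩ := hP x
        obtain ⟨b, hb, hb'⟩ := ih a.1
        refine ⟨(b.1, a.2 + b.2), ?_, fun O => by
          simp [iterate, ha', hb', PMF.pure_bind, PMF.pure_map]⟩
        simp only [iterate, PMF.mem_support_bind_iff, PMF.mem_support_map_iff]
        exact ⟨a, ha, b, hb, rfl⟩
    refine ⟨(v.1, u.2 + (x.size + 1) + v.2), ?_, fun O => by
      simp [derand, run, hu', hv', PMF.pure_bind, PMF.pure_map]⟩
    simp only [run, PMF.mem_support_bind_iff, PMF.mem_support_map_iff]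
    exact ⟨u, hu, v, hv, rfl⟩

/-- When the output distribution is a point mass, any single run yields the right output. On objects
that code nothing `F` is unspecified but still polynomial, as the time bound of the given program
covers all inputs. -/
theorem DetPolyTime.exists_fp {α β : ℕ → Type} [∀ n, Coded (α n)] [∀ n, Coded (β n)]
    {f : ∀ n, α n → β n} (hf : DetPolyTime f) :
    ∃ F, FP F ∧ ∀ n a, F (code (n, a)) = code (f n a) := by
  obtain ⟨P, ⟨p, hp⟩, hP⟩ := hf
  choose u hu hu' using P.exists_run_derand
  refine ⟨fun x => (u x).1, ⟨P.derand, fun x => (u x).2, ⟨p, fun x => hp x _ (hu x)⟩,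
    fun O x => hu' x O⟩, fun n a => ?_⟩
  have h : (u (code (n, a))).1 ∈ (P.exec noOracle (code (n, a))).support := by
    rw [Prog.exec, PMF.mem_support_map_iff]
    exact ⟨_, hu _, rfl⟩
  rw [hP, PMF.pure_map, PMF.mem_support_pure_iff] at h
  exact h

/-! ## Randomized polynomial-time functions -/

/-- Iteration of a randomized function. -/
noncomputable def kleisliIter {α : Type} (f : α → PMF α) : ℕ → α → PMF α
  | 0, x => PMF.pure x
  | m + 1, x => (f x).bind (kleisliIter f m)

namespace Prog

variable (O : Data → Data) (P Q B : Prog) (x : Data)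

theorem exec_comp : (comp P Q).exec O x = (P.exec O x).bind (Q.exec O) := by
  simp only [exec, run, PMF.map_bind, PMF.map_comp, PMF.bind_map]
  rfl

theorem exec_pair : (pair P Q).exec O x =
    (P.exec O x).bind fun a => (Q.exec O x).map fun b => .pair a b := by
  simp only [exec, run, PMF.map_bind, PMF.map_comp, PMF.bind_map]
  rfl

theorem exec_cond : (cond B P Q).exec O x =
    (B.exec O x).bind fun b => if b.isOne = true then P.exec O x else Q.exec O x := by
  simp only [exec, run, PMF.map_bind, PMF.map_comp, PMF.bind_map]
  congr 1
  funext u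
  simp only [Function.comp_apply]
  split_ifs <;> rfl

theorem map_iterate_fst : ∀ m x, (iterate (P.run O) m x).map Prod.fst = kleisliIter (P.exec O) m x := by
  intro m
  induction m with
  | zero => intro x; simp [iterate, kleisliIter, PMF.pure_map]
  | succ m ih =>
    intro x
    simp only [iterate, kleisliIter, PMF.map_bind, PMF.map_comp, exec, PMF.bind_map]
    congr 1
    funext u
    exact ih u.1

theorem exec_loop : (loop B P).exec O x =
    (B.exec O x).bind fun b => kleisliIter (P.exec O) b.size x := by
  simp only [← map_iterate_fst]
  simp only [exec, run, PMF.map_bind, PMF.map_comp, PMF.bind_map]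
  rfl

theorem exec_id : id.exec O x = PMF.pure x := PMF.pure_map _ _
theorem exec_atom (b : Bool) : (atom b).exec O x = PMF.pure (.atom b) := PMF.pure_map _ _
theorem exec_hd : hd.exec O x = PMF.pure x.hd := PMF.pure_map _ _
theorem exec_tl : tl.exec O x = PMF.pure x.tl := PMF.pure_map _ _
theorem exec_isPair : isPair.exec O x = PMF.pure (.atom x.isPair) := PMF.pure_map _ _
theorem exec_query : query.exec O x = PMF.pure (O x) := PMF.pure_map _ _
theorem exec_coin : coin.exec O x = fairCoin.map Data.atom := PMF.map_comp _ _ _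

end Prog

/-- `f` is computed by a probabilistic polynomial-time program. -/
def RP (f : Data → PMF Data) : Prop :=
  ∃ P : Prog, P.IsPPT ∧ ∀ x, P.exec noOracle x = f x

theorem Prog.isPPT_iff {P : Prog} : P.IsPPT ↔
    ∃ c, PolyBounded c ∧ ∀ x, P.HaltsWithin noOracle x (c x) := by
  constructor
  · rintro ⟨p, hp⟩
    exact ⟨_, PolyBounded.size.eval p, hp⟩
  · rintro ⟨c, ⟨p, hp⟩, hc⟩
    exact ⟨p, fun x u hu => (hc x u hu).trans (hp x)⟩

theorem PolyTime.exists_rp {α β : ℕ → Type} [∀ n, Coded (α n)] [∀ n, Coded (β n)]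
    {f : ∀ n, α n → PMF (β n)} (hf : PolyTime f) :
    ∃ F, RP F ∧ ∀ n a, F (code (n, a)) = (f n a).map code := by
  obtain ⟨P, hP, h⟩ := hf
  exact ⟨P.exec noOracle, ⟨P, hP, fun _ => rfl⟩, h⟩

namespace RP

theorem pure {f : Data → Data} (hf : FP f) : RP fun x => PMF.pure (f x) := by
  obtain ⟨P, c, hc, hP⟩ := hf
  refine ⟨P, Prog.isPPT_iff.2 ⟨c, hc, fun x u hu => ?_⟩, fun x => ?_⟩
  · rw [hP, PMF.mem_support_pure_iff] at hu
    rw [hu]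
  · rw [Prog.exec, hP, PMF.pure_map]

theorem coin : RP fun _ => fairCoin.map Data.atom := by
  refine ⟨.coin, Prog.isPPT_iff.2 ⟨fun _ => 1, .const 1, fun x u hu => ?_⟩,
    fun x => Prog.exec_coin _ _⟩
  simp only [Prog.run, PMF.mem_support_map_iff] at hu
  obtain ⟨b, -, rfl⟩ := hu
  rfl

/-- The length of a sample is bounded by the time needed to write it, so the second stage runs on an
input of polynomial length. -/
theorem bind {f : Data → PMF Data} {g : Data → Data → PMF Data} (hf : RP f)
    (hg : RP fun v => g v.hd v.tl) : RP fun x => (f x).bind (g x) := by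
  obtain ⟨P, hP, hPf⟩ := hf
  obtain ⟨Q, hQ, hQg⟩ := hg
  obtain ⟨c, hc, hPc⟩ := Prog.isPPT_iff.1 hP
  obtain ⟨d, hd, hQd⟩ := Prog.isPPT_iff.1 hQ
  obtain ⟨b, hb, hdb⟩ := hd.comp_pair hc
  refine ⟨.comp (.pair .id P) Q, Prog.isPPT_iff.2 ⟨fun x => (x.size + 1) + c x + 1 + b x + 1,
    (((((PolyBounded.size).add (.const 1)).add hc).add (.const 1)).add hb).add (.const 1),
    fun x u hu => ?_⟩, fun x => ?_⟩
  · simp only [Prog.run, PMF.pure_bind, PMF.mem_support_bind_iff, PMF.mem_support_map_iff] at hu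
    obtain ⟨_, ⟨v, hv, rfl⟩, w, hw, rfl⟩ := hu
    have h₁ := hPc x v hv
    have h₂ := P.size_lt_of_mem_support_run _ _ _ hv
    have h₃ := (hQd _ _ hw).trans (hdb _ _ (by omega))
    simp only
    omega
  · simp only [Prog.exec_comp, Prog.exec_pair, Prog.exec_id, PMF.pure_bind, hPf, PMF.bind_map]
    congr 1
    funext y
    simp [hQg]

theorem comp {g : Data → PMF Data} {f : Data → Data} (hg : RP g) (hf : FP f) :
    RP fun x => g (f x) := by
  have hx := FP.id
  obtain ⟨P, c, hc, hP⟩ := hf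
  obtain ⟨Q, hQ, hQg⟩ := hg
  obtain ⟨d, hd, hQd⟩ := Prog.isPPT_iff.1 hQ
  have hfs := FP.polyBounded ⟨P, c, hc, hP⟩
  refine ⟨.comp P Q, Prog.isPPT_iff.2 ⟨fun x => c x + d (f x) + 1,
    (hc.add (hd.comp hfs)).add (.const 1), fun x u hu => ?_⟩, fun x => ?_⟩
  · simp only [Prog.run, hP, PMF.pure_bind, PMF.mem_support_map_iff] at hu
    obtain ⟨w, hw, rfl⟩ := hu
    have := hQd _ _ hw
    simp only
    omega
  · have : P.exec noOracle x = PMF.pure (f x) := by rw [Prog.exec, hP, PMF.pure_map]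
    rw [Prog.exec_comp, this, PMF.pure_bind, hQg]

theorem map {f : Data → PMF Data} {g : Data → Data → Data} (hf : RP f)
    (hg : FP fun v => g v.hd v.tl) : RP fun x => (f x).map (g x) :=
  hf.bind (pure hg)

theorem ite {b : Data → Bool} {f g : Data → PMF Data} (hb : FPB b) (hf : RP f) (hg : RP g) :
    RP fun x => if b x = true then f x else g x := by
  obtain ⟨B, e, he, hB⟩ := hb
  obtain ⟨P, hP, hPf⟩ := hf
  obtain ⟨Q, hQ, hQg⟩ := hg
  obtain ⟨c, hc, hPc⟩ := Prog.isPPT_iff.1 hP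
  obtain ⟨d, hd, hQd⟩ := Prog.isPPT_iff.1 hQ
  refine ⟨.cond B P Q, Prog.isPPT_iff.2 ⟨fun x => e x + (c x + d x) + 1,
    (he.add (hc.add hd)).add (.const 1), fun x u hu => ?_⟩, fun x => ?_⟩
  · simp only [Prog.run, hB, PMF.pure_bind, PMF.mem_support_map_iff] at hu
    obtain ⟨w, hw, rfl⟩ := hu
    have : w.2 ≤ c x + d x := by
      split_ifs at hw
      · exact (hPc _ _ hw).trans (by omega)
      · exact (hQd _ _ hw).trans (by omega)
    simp only
    omega
  · have : B.exec noOracle x = PMF.pure (.atom (b x)) := by rw [Prog.exec, hB, PMF.pure_map]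
    rw [Prog.exec_cond, this, PMF.pure_bind, hPf, hQg]
    rfl

end RP

/-- Prepend `m` independent samples from `D` to a list. -/
noncomputable def sampleList (D : PMF Data) : ℕ → Data → PMF Data
  | 0, s => PMF.pure s
  | m + 1, s => D.bind fun a => sampleList D m (.pair a s)

/-- The invariant depends on the round, so that a state growing by a bounded amount per round still
admits one bound `c` for the cost of each of the `M` rounds. -/
theorem mem_support_iterate_le {f : Data → PMF (Data × ℕ)} {I : ℕ → Data → Prop} {c M : ℕ}
    (hf : ∀ i < M, ∀ x, I i x → ∀ u ∈ (f x).support, I (i + 1) u.1 ∧ u.2 ≤ c) :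
    ∀ m i x, i + m ≤ M → I i x → ∀ u ∈ (iterate f m x).support, u.2 ≤ m * c := by
  intro m
  induction m with
  | zero =>
    intro i x _ _ u hu
    simp only [iterate, PMF.mem_support_pure_iff] at hu
    simp [hu]
  | succ m ih =>
    intro i x hi hx u hu
    simp only [iterate, PMF.mem_support_bind_iff, PMF.mem_support_map_iff] at hu
    obtain ⟨v, hv, w, hw, rfl⟩ := hu
    obtain ⟨h₁, h₂⟩ := hf i (by omega) x hx v hv
    have := ih (i + 1) v.1 (by omega) h₁ w hw
    simp only
    rw [Nat.succ_mul]
    omega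

theorem RP.sampleList {D : Data → PMF Data} {m : Data → Data} (hD : RP D) (hm : FP m) :
    RP fun x => CorPKE.sampleList (D x) (m x).size (.atom false) := by
  have hms := hm.polyBounded
  obtain ⟨P, hP, hPD⟩ := hD
  obtain ⟨B, e, he, hB⟩ := hm
  obtain ⟨c, hc, hPc⟩ := Prog.isPPT_iff.1 hP
  -- One round turns `(x, s)` into `(x, (a, s))` with a fresh sample `a`.
  set body : Prog := .pair .hd (.pair (.comp .hd P) .tl) with hbody
  have hexec : ∀ k x s, kleisliIter (body.exec noOracle) k (.pair x s) =
      (CorPKE.sampleList (D x) k s).map fun t => .pair x t := by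
    intro k x
    induction k with
    | zero => intro s; simp [kleisliIter, CorPKE.sampleList, PMF.pure_map]
    | succ k ih =>
      intro s
      have : body.exec noOracle (.pair x s) = (D x).map fun a => .pair x (.pair a s) := by
        simp [hbody, Prog.exec_pair, Prog.exec_comp, Prog.exec_hd, Prog.exec_tl, PMF.pure_bind,
          hPD, ← PMF.bind_pure_comp]
        rfl
      rw [kleisliIter, this, PMF.bind_map, CorPKE.sampleList, PMF.map_bind]
      congr 1
      funext a
      exact ih _
  refine ⟨.comp (.comp (.pair .id (.atom false)) (.loop (.comp .hd B) body)) .tl,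
    Prog.isPPT_iff.2 ⟨fun x => 2 * (4 * x.size + e x + 20 +
      (m x).size * (2 * x.size + c x + (m x).size * (c x + 1) + 10)), ?_, fun x u hu => ?_⟩,
    fun x => ?_⟩
  · exact (PolyBounded.const 2).mul (((((PolyBounded.const 4).mul .size).add he).add
      (.const 20)).add (hms.mul (((((PolyBounded.const 2).mul .size).add hc).add
        (hms.mul (hc.add (.const 1)))).add (.const 10))))
  · simp only [Prog.run, hB, PMF.pure_bind, PMF.pure_map, Data.hd_pair, PMF.mem_support_bind_iff,
      PMF.mem_support_map_iff, PMF.mem_support_pure_iff] at hu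
    obtain ⟨_, ⟨_, ⟨v, hv, rfl⟩, rfl⟩, _, rfl, rfl⟩ := hu
    have h₁ := iterate_size_lt (body.size_lt_of_mem_support_run noOracle) _ _ _ hv
    -- After `i` rounds the list consists of `i` samples, each of length at most `c x`, with one
    -- node per entry.
    have h₂ := mem_support_iterate_le (M := (m x).size)
      (I := fun i y => y.hd = x ∧ y.tl.size ≤ i * (c x + 1))
      (c := 2 * x.size + c x + (m x).size * (c x + 1) + 10) ?_ _ 0 _ (Nat.zero_add _).le
      (by simp [Data.size]) v hv
    · have h₃ := Data.size_tl_le v.1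
      simp only [Data.size] at h₁ ⊢
      omega
    · rintro i hi y ⟨rfl, hy⟩ u hu
      simp only [hbody, Prog.run, PMF.pure_bind, PMF.mem_support_bind_iff, PMF.pure_map,
        PMF.mem_support_map_iff, PMF.mem_support_pure_iff] at hu
      obtain ⟨_, ⟨_, ⟨w, hw, rfl⟩, _, rfl, rfl⟩, rfl⟩ := hu
      have h₁ := P.size_lt_of_mem_support_run _ _ _ hw
      have h₂ := hPc _ _ hw
      have h₃ : i * (c y.hd + 1) ≤ (m y.hd).size * (c y.hd + 1) := Nat.mul_le_mul_right _ hi.le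
      simp only [Data.hd_pair, Data.tl_pair, Data.size, Nat.succ_mul, true_and]
      omega
  · have : B.exec noOracle x = PMF.pure (m x) := by rw [Prog.exec, hB, PMF.pure_map]
    simp only [Prog.exec_comp, Prog.exec_pair, Prog.exec_id, Prog.exec_atom, PMF.pure_bind,
      PMF.pure_map, Prog.exec_loop, Prog.exec_hd, Data.hd_pair, this, hexec, PMF.bind_map]
    convert PMF.bind_pure _ using 2
    funext t
    simp [Prog.exec_tl]

/-! ## Runs with a log of flagged oracle queries -/

/-- Execution with oracle `O` from a log and an input to a log and an output. A query `y` with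
`F y` is recorded as `(1, y)`, overwriting the log. -/
noncomputable def lexec (O : Data → Data) (F : Data → Bool) : Prog → Data × Data → PMF (Data × Data)
  | .id, u => PMF.pure u
  | .atom b, u => PMF.pure (u.1, .atom b)
  | .hd, u => PMF.pure (u.1, u.2.hd)
  | .tl, u => PMF.pure (u.1, u.2.tl)
  | .isPair, u => PMF.pure (u.1, .atom u.2.isPair)
  | .pair P Q, u => (lexec O F P u).bind fun v => (lexec O F Q (v.1, u.2)).map fun w =>
      (w.1, .pair v.2 w.2)
  | .comp P Q, u => (lexec O F P u).bind fun v => lexec O F Q v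
  | .cond B P Q, u => (lexec O F B u).bind fun v =>
      if v.2.isOne = true then lexec O F P (v.1, u.2) else lexec O F Q (v.1, u.2)
  | .loop B P, u => (lexec O F B u).bind fun v => kleisliIter (lexec O F P) v.2.size (v.1, u.2)
  | .coin, u => fairCoin.map fun b => (u.1, .atom b)
  | .query, u => PMF.pure (if F u.2 = true then .pair (.atom true) u.2 else u.1, O u.2)

namespace Prog

/-- The body of the loop that simulates a loop whose body is simulated by `P`. -/
def simulateBody (P : Prog) : Prog :=
  comp (pair (comp (pair (comp hd hd) tl) P) (comp hd tl))
    (pair (pair (comp hd hd) tl) (comp hd tl))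

/-- Replace the oracle queries of a program by the program `R`, which works on inputs of the form
`((environment, log), query)` and outputs of the form `((environment, log), answer)`, threading
environment and log through the whole computation. -/
def simulate (R : Prog) : Prog → Prog
  | id => id
  | atom b => pair hd (atom b)
  | hd => pair hd (comp tl hd)
  | tl => pair hd (comp tl tl)
  | isPair => pair hd (comp tl isPair)
  | pair P Q => comp (comp (pair (simulate R P) tl)
      (pair (comp hd tl) (comp (pair (comp hd hd) tl) (simulate R Q))))
      (pair (comp tl hd) (pair hd (comp tl tl)))
  | comp P Q => comp (simulate R P) (simulate R Q)
  | cond B P Q => comp (pair (simulate R B) tl)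
      (cond (comp hd tl) (comp (pair (comp hd hd) tl) (simulate R P))
        (comp (pair (comp hd hd) tl) (simulate R Q)))
  | loop B P => comp (comp (pair (simulate R B) tl) (loop (comp hd tl)
      (simulateBody (simulate R P)))) (pair (comp hd hd) tl)
  | coin => pair hd coin
  | query => R

end Prog

section simulate

variable {ans : Data → Data → Data} {flag : Data → Data → Bool} {R : Prog} {c : Data → ℕ}

/-- Each construct of `simulate` carries the pair of environment and log next to the data and
restores this shape at the end. Hence the induction hypotheses apply with the log left by the
preceding part. -/
theorem exec_simulate
    (hR : ∀ e s x, R.run noOracle (.pair (.pair e s) x) = PMF.pure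
      (.pair (.pair e (if flag e x = true then .pair (.atom true) x else s)) (ans e x),
        c (.pair (.pair e s) x)))
    (e : Data) (P : Prog) : ∀ s x,
    (Prog.simulate R P).exec noOracle (.pair (.pair e s) x) =
      (lexec (ans e) (flag e) P (s, x)).map fun u => .pair (.pair e u.1) u.2 := by
  induction P with
  | id => intro s x; simp [Prog.simulate, Prog.exec_id, lexec, PMF.pure_map]
  | atom b =>
    intro s x
    simp [Prog.simulate, Prog.exec_pair, Prog.exec_hd, Prog.exec_atom, lexec, PMF.pure_map, PMF.pure_bind]
  | hd | tl | isPair =>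
    intro s x
    simp [Prog.simulate, Prog.exec_pair, Prog.exec_comp, Prog.exec_hd, Prog.exec_tl,
      Prog.exec_isPair, lexec, PMF.pure_map, PMF.pure_bind]
  | coin =>
    intro s x
    simp only [Prog.simulate, Prog.exec_pair, Prog.exec_hd, Prog.exec_coin, lexec, PMF.pure_bind,
      PMF.map_comp]
    rfl
  | query => intro s x; simp [Prog.simulate, Prog.exec, hR, lexec, PMF.pure_map]
  | pair P Q hP hQ =>
    intro s x
    simp only [Prog.simulate, Prog.exec_pair, Prog.exec_comp, Prog.exec_hd, Prog.exec_tl, lexec,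
      PMF.pure_bind, PMF.pure_map, hP, hQ, PMF.bind_map, PMF.map_bind, PMF.bind_bind,
      Function.comp_def, Data.hd_pair, Data.tl_pair, PMF.map_comp]
    rfl
  | comp P Q hP hQ =>
    intro s x
    simp only [Prog.simulate, Prog.exec_comp, lexec, hP, hQ, PMF.bind_map, PMF.map_bind,
      Function.comp_def]
  | cond B P Q hB hP hQ =>
    intro s x
    simp only [Prog.simulate, Prog.exec_pair, Prog.exec_comp, Prog.exec_cond, Prog.exec_hd,
      Prog.exec_tl, lexec, PMF.pure_bind, PMF.pure_map, hB, hP, hQ, PMF.bind_map, PMF.map_bind,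
      PMF.bind_bind, Function.comp_def, Data.hd_pair, Data.tl_pair]
    congr 1
    funext v
    split_ifs <;> rfl
  | loop B P hB hP =>
    intro s x
    have hbody : ∀ m s x b, kleisliIter (Prog.exec noOracle (Prog.simulateBody (Prog.simulate R P))) m
          (.pair (.pair (.pair e s) b) x) =
        (kleisliIter (lexec (ans e) (flag e) P) m (s, x)).map fun u =>
          .pair (.pair (.pair e u.1) b) u.2 := by
      intro m
      induction m with
      | zero => intro s x b; simp [kleisliIter, PMF.pure_map]
      | succ m ih =>
        intro s x b
        simp only [kleisliIter, Prog.simulateBody, Prog.exec_pair, Prog.exec_comp, Prog.exec_hd, Prog.exec_tl,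
          PMF.pure_bind, PMF.pure_map, hP, PMF.bind_map, PMF.map_bind,
          PMF.bind_bind, Function.comp_def, Data.hd_pair, Data.tl_pair]
        congr 1
        funext v
        exact ih _ _ _
    simp only [Prog.simulate, Prog.exec_pair, Prog.exec_comp, Prog.exec_hd, Prog.exec_tl,
      Prog.exec_loop, hbody, lexec, PMF.pure_bind, PMF.pure_map, hB, PMF.bind_map, PMF.map_bind,
      PMF.bind_bind, Function.comp_def, Data.hd_pair, Data.tl_pair]
    rfl

/-- The arithmetic common to the composite cases of `cost_simulate`: the term `30 * G` pays for
moving environment, log and data around, charged to the extra time unit of the composed instruction.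
-/
theorem le_cost {K₁ K₂ t₁ t₂ t a b d G : ℕ} (ha : a ≤ K₁ * t₁ * G) (hb : b ≤ K₂ * t₂ * G)
    (ht : t₁ + t₂ + 1 ≤ t) (hd : d ≤ a + b + 30 * G) : d ≤ (K₁ + K₂ + 30) * t * G := by
  have h₁ : K₁ * t₁ * G ≤ K₁ * t * G := by gcongr; omega
  have h₂ : K₂ * t₂ * G ≤ K₂ * t * G := by gcongr; omega
  have h₃ : 30 * 1 * G ≤ 30 * t * G := by gcongr; omega
  rw [Nat.add_mul, Nat.add_mul, Nat.add_mul, Nat.add_mul]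
  omega

/-- Each run of the simulation shadows a run `v` of the original program with the true oracle. If
`v` takes time at most `M`, every object written during it is shorter than `M`, and the log, one
flagged query with a marker bit, stays below `M + 1`. So each original step costs at most a constant
times `G`, where `G` dominates one call of `R` and the copying of the state. The constant `K`
depends on the program alone; the condition `v.2 ≤ M` is discharged later from the time bound of the
adversary. -/
theorem cost_simulate
    (hR : ∀ e s x, R.run noOracle (.pair (.pair e s) x) = PMF.pure
      (.pair (.pair e (if flag e x = true then .pair (.atom true) x else s)) (ans e x),
        c (.pair (.pair e s) x)))
    (P : Prog) : ∃ K, ∀ e M G, e.size + 2 * M + 10 ≤ G →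
    (∀ s x, s.size ≤ M + 1 → x.size ≤ M → c (.pair (.pair e s) x) ≤ G) →
    ∀ s x, ∀ w ∈ ((Prog.simulate R P).run noOracle (.pair (.pair e s) x)).support,
      ∃ s', ∃ v ∈ (P.run (ans e) x).support, w.1 = .pair (.pair e s') v.1 ∧
        (s.size ≤ M + 1 → x.size ≤ M → v.2 ≤ M → s'.size ≤ M + 1 ∧ w.2 ≤ K * v.2 * G) := by
  induction P with
  | id | atom | hd | tl | isPair =>
    refine ⟨10, fun e M G hG _ s x w hw => ?_⟩
    simp only [Prog.simulate, Prog.run, PMF.pure_bind, PMF.pure_map, PMF.mem_support_pure_iff] at hw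
    subst hw
    refine ⟨s, _, (PMF.mem_support_pure_iff _ _).2 rfl, rfl, fun hs hx hv => ⟨hs, ?_⟩⟩
    have := Data.size_hd_le x
    have := Data.size_tl_le x
    refine le_trans ?_ (Nat.mul_le_mul_right _ (Nat.mul_le_mul_left 10 (Nat.succ_le_succ (Nat.zero_le _))))
    simp only [Data.size, Data.hd_pair, Data.tl_pair]
    omega
  | coin =>
    refine ⟨10, fun e M G hG _ s x w hw => ?_⟩
    simp only [Prog.simulate, Prog.run, PMF.pure_bind, PMF.map_comp, PMF.mem_support_map_iff] at hw
    obtain ⟨b, hb, rfl⟩ := hw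
    refine ⟨s, (.atom b, 1), (PMF.mem_support_map_iff _ _ _).2 ⟨b, hb, rfl⟩, rfl,
      fun hs hx hv => ⟨hs, ?_⟩⟩
    simp only [Function.comp_apply, Data.size, Data.hd_pair]
    omega
  | query =>
    refine ⟨1, fun e M G hG hc s x w hw => ?_⟩
    simp only [Prog.simulate, hR, PMF.mem_support_pure_iff] at hw
    subst hw
    refine ⟨_, _, (PMF.mem_support_pure_iff _ _).2 rfl, rfl, fun hs hx hv => ⟨?_, ?_⟩⟩
    · split_ifs
      · simp only [Data.size]; omega
      · exact hs
    · exact (hc s x hs hx).trans (Nat.le_mul_of_pos_left _ (by simp))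
  | pair P Q hP hQ =>
    obtain ⟨K₁, hP⟩ := hP
    obtain ⟨K₂, hQ⟩ := hQ
    refine ⟨K₁ + K₂ + 30, fun e M G hG hc s x w hw => ?_⟩
    simp only [Prog.simulate, Prog.run, PMF.pure_bind, PMF.pure_map, PMF.mem_support_bind_iff,
      PMF.mem_support_map_iff, PMF.mem_support_pure_iff, Data.tl_pair] at hw
    obtain ⟨_, ⟨_, ⟨⟨_, t₁⟩, hw₁, rfl⟩, _, ⟨_, ⟨⟨_, t₂⟩, hw₂, rfl⟩, rfl⟩, rfl⟩, rfl⟩ := hw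
    obtain ⟨s₁, v₁, hv₁, rfl, h₁⟩ := hP e M G hG hc s x _ hw₁
    obtain ⟨s₂, v₂, hv₂, rfl, h₂⟩ := hQ e M G hG hc s₁ x _ hw₂
    refine ⟨s₂, (.pair v₁.1 v₂.1, v₁.2 + v₂.2 + 1), ?_, rfl, fun hs hx hv => ?_⟩
    · simp only [Prog.run, PMF.mem_support_bind_iff, PMF.mem_support_map_iff]
      exact ⟨v₁, hv₁, v₂, hv₂, rfl⟩
    · have := P.size_lt_of_mem_support_run _ _ _ hv₁
      have := Q.size_lt_of_mem_support_run _ _ _ hv₂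
      simp only at hv h₁ h₂
      obtain ⟨h₃, h₄⟩ := h₁ hs hx (by omega)
      obtain ⟨h₅, h₆⟩ := h₂ h₃ (by omega) (by omega)
      refine ⟨h₅, le_cost h₄ h₆ le_rfl ?_⟩
      simp only [Data.size, Data.hd_pair, Data.tl_pair]
      omega
  | comp P Q hP hQ =>
    obtain ⟨K₁, hP⟩ := hP
    obtain ⟨K₂, hQ⟩ := hQ
    refine ⟨K₁ + K₂ + 30, fun e M G hG hc s x w hw => ?_⟩
    simp only [Prog.simulate, Prog.run, PMF.mem_support_bind_iff, PMF.mem_support_map_iff] at hw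
    obtain ⟨⟨_, t₁⟩, hw₁, ⟨_, t₂⟩, hw₂, rfl⟩ := hw
    obtain ⟨s₁, v₁, hv₁, rfl, h₁⟩ := hP e M G hG hc s x _ hw₁
    obtain ⟨s₂, v₂, hv₂, rfl, h₂⟩ := hQ e M G hG hc s₁ v₁.1 _ hw₂
    refine ⟨s₂, (v₂.1, v₁.2 + v₂.2 + 1), ?_, rfl, fun hs hx hv => ?_⟩
    · simp only [Prog.run, PMF.mem_support_bind_iff, PMF.mem_support_map_iff]
      exact ⟨v₁, hv₁, v₂, hv₂, rfl⟩
    · have := P.size_lt_of_mem_support_run _ _ _ hv₁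
      simp only at hv h₁ h₂ ⊢
      obtain ⟨h₃, h₄⟩ := h₁ hs hx (by omega)
      obtain ⟨h₅, h₆⟩ := h₂ h₃ (by omega) (by omega)
      exact ⟨h₅, le_cost h₄ h₆ le_rfl (by omega)⟩
  | cond B P Q hB hP hQ =>
    obtain ⟨K₁, hB⟩ := hB
    obtain ⟨K₂, hP⟩ := hP
    obtain ⟨K₃, hQ⟩ := hQ
    refine ⟨K₁ + (K₂ + K₃) + 30, fun e M G hG hc s x w hw => ?_⟩
    simp only [Prog.simulate, Prog.run, PMF.pure_bind, PMF.pure_map, PMF.mem_support_bind_iff,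
      PMF.mem_support_map_iff, PMF.mem_support_pure_iff, Data.tl_pair] at hw
    obtain ⟨_, ⟨⟨_, t₁⟩, hw₁, rfl⟩, _, ⟨⟨y₂, t₂⟩, hw₂, rfl⟩, rfl⟩ := hw
    obtain ⟨s₁, v₁, hv₁, rfl, h₁⟩ := hB e M G hG hc s x _ hw₁
    change _ ∈ (if v₁.1.isOne = true then _ else _ : PMF (Data × ℕ)).support at hw₂
    obtain ⟨s₂, v₂, hv₂, h₀, h₂⟩ : ∃ s₂, ∃ v₂ ∈ (if v₁.1.isOne = true then P.run (ans e) x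
        else Q.run (ans e) x).support, y₂ = .pair (.pair e s₂) v₂.1 ∧
        (v₁.1.size ≤ M → s₁.size ≤ M + 1 → x.size ≤ M → v₂.2 ≤ M → s₂.size ≤ M + 1 ∧
          t₂ ≤ (K₂ + K₃) * v₂.2 * G + 10 * G) := by
      by_cases hif : v₁.1.isOne = true
      · rw [if_pos hif] at hw₂
        obtain ⟨⟨_, t⟩, hw₂, heq⟩ := (PMF.mem_support_map_iff _ _ _).1 hw₂
        obtain ⟨s₂, v₂, hv₂, rfl, h₂⟩ := hP e M G hG hc s₁ x _ hw₂
        simp only [Prod.mk.injEq] at heq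
        obtain ⟨rfl, rfl⟩ := heq
        refine ⟨s₂, v₂, by rwa [if_pos hif], rfl, fun hv₁ hs hx hv => ?_⟩
        obtain ⟨h₃, h₄⟩ := h₂ hs hx hv
        refine ⟨h₃, ?_⟩
        simp only [Data.size, Nat.add_mul, Data.hd_pair, Data.tl_pair] at h₄ ⊢
        omega
      · rw [if_neg hif] at hw₂
        obtain ⟨⟨_, t⟩, hw₂, heq⟩ := (PMF.mem_support_map_iff _ _ _).1 hw₂
        obtain ⟨s₂, v₂, hv₂, rfl, h₂⟩ := hQ e M G hG hc s₁ x _ hw₂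
        simp only [Prod.mk.injEq] at heq
        obtain ⟨rfl, rfl⟩ := heq
        refine ⟨s₂, v₂, by rwa [if_neg hif], rfl, fun hv₁ hs hx hv => ?_⟩
        obtain ⟨h₃, h₄⟩ := h₂ hs hx hv
        refine ⟨h₃, ?_⟩
        simp only [Data.size, Nat.add_mul, Data.hd_pair, Data.tl_pair] at h₄ ⊢
        omega
    refine ⟨s₂, (v₂.1, v₁.2 + v₂.2 + 1), ?_, h₀, fun hs hx hv => ?_⟩
    · simp only [Prog.run, PMF.mem_support_bind_iff, PMF.mem_support_map_iff]
      exact ⟨v₁, hv₁, v₂, hv₂, rfl⟩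
    · have := B.size_lt_of_mem_support_run _ _ _ hv₁
      simp only at hv h₁ h₂
      obtain ⟨h₃, h₄⟩ := h₁ hs hx (by omega)
      obtain ⟨h₅, h₆⟩ := h₂ (by omega) h₃ hx (by omega)
      refine ⟨h₅, le_cost h₄ le_rfl le_rfl ?_⟩
      simp only [Data.size, Data.hd_pair, Data.tl_pair]
      omega
  | loop B P hB hP =>
    obtain ⟨K₁, hB⟩ := hB
    obtain ⟨K₂, hP⟩ := hP
    refine ⟨K₁ + (K₂ + 30) + 30, fun e M G hG hc s x w hw => ?_⟩
    have hbody : ∀ m s x b, ∀ w ∈ (iterate (Prog.run noOracle (Prog.simulateBody (Prog.simulate R P))) m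
          (.pair (.pair (.pair e s) b) x)).support, ∃ s', ∃ v ∈ (iterate (P.run (ans e)) m x).support,
          w.1 = .pair (.pair (.pair e s') b) v.1 ∧
          (s.size ≤ M + 1 → x.size ≤ M → b.size ≤ M → v.2 ≤ M →
            s'.size ≤ M + 1 ∧ w.2 ≤ (K₂ + 30) * v.2 * G) := by
      intro m
      induction m with
      | zero =>
        intro s x b w hw
        simp only [iterate, PMF.mem_support_pure_iff] at hw
        subst hw
        exact ⟨s, (x, 0), by simp [iterate], rfl, fun hs _ _ _ => ⟨hs, by simp⟩⟩
      | succ m ih =>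
        intro s x b w hw
        rw [iterate, PMF.mem_support_bind_iff] at hw
        obtain ⟨_, hw₁, hw⟩ := hw
        obtain ⟨⟨_, t₂⟩, hw₂, rfl⟩ := (PMF.mem_support_map_iff _ _ _).1 hw
        rw [Prog.simulateBody] at hw₁
        simp only [Prog.run, PMF.pure_bind, PMF.pure_map, PMF.mem_support_bind_iff,
          PMF.mem_support_map_iff, PMF.mem_support_pure_iff, Data.hd_pair, Data.tl_pair] at hw₁
        obtain ⟨_, ⟨_, ⟨⟨_, t₁⟩, hw₁, rfl⟩, rfl⟩, rfl⟩ := hw₁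
        obtain ⟨s₁, v₁, hv₁, rfl, h₁⟩ := hP e M G hG hc s x _ hw₁
        simp only [Data.hd_pair, Data.tl_pair] at hw₂
        obtain ⟨s₂, v₂, hv₂, rfl, h₂⟩ := ih s₁ v₁.1 b _ hw₂
        refine ⟨s₂, (v₂.1, v₁.2 + v₂.2), ?_, rfl, fun hs hx hb hv => ?_⟩
        · simp only [iterate, PMF.mem_support_bind_iff, PMF.mem_support_map_iff]
          exact ⟨v₁, hv₁, v₂, hv₂, rfl⟩
        · have := P.size_lt_of_mem_support_run _ _ _ hv₁
          simp only at hv h₁ h₂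
          obtain ⟨h₃, h₄⟩ := h₁ hs hx (by omega)
          obtain ⟨h₅, h₆⟩ := h₂ h₃ (by omega) hb (by omega)
          refine ⟨h₅, ?_⟩
          have h₇ : 30 * 1 * G ≤ 30 * v₁.2 * G := by gcongr; omega
          simp only [Data.size, Data.hd_pair, Data.tl_pair, Nat.add_mul, Nat.mul_add] at h₆ ⊢
          omega
    simp only [Prog.simulate, Prog.run, PMF.pure_bind, PMF.pure_map, PMF.mem_support_bind_iff,
      PMF.mem_support_map_iff, PMF.mem_support_pure_iff, Data.tl_pair] at hw
    obtain ⟨_, ⟨_, ⟨⟨_, t₁⟩, hw₁, rfl⟩, _, ⟨⟨_, t₂⟩, hw₂, rfl⟩, rfl⟩, rfl⟩ := hw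
    obtain ⟨s₁, v₁, hv₁, rfl, h₁⟩ := hB e M G hG hc s x _ hw₁
    simp only [Data.hd_pair, Data.tl_pair] at hw₂
    obtain ⟨s₂, v₂, hv₂, rfl, h₂⟩ := hbody _ _ _ _ _ hw₂
    refine ⟨s₂, (v₂.1, v₁.2 + (x.size + 1) + v₂.2), ?_, rfl, fun hs hx hv => ?_⟩
    · simp only [Prog.run, PMF.mem_support_bind_iff, PMF.mem_support_map_iff]
      exact ⟨v₁, hv₁, v₂, hv₂, rfl⟩
    · have := B.size_lt_of_mem_support_run _ _ _ hv₁
      have := iterate_size_lt (P.size_lt_of_mem_support_run _) _ _ _ hv₂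
      simp only at hv h₁ h₂
      obtain ⟨h₃, h₄⟩ := h₁ hs hx (by omega)
      obtain ⟨h₅, h₆⟩ := h₂ h₃ hx (by omega) (by omega)
      refine ⟨h₅, le_cost h₄ h₆ (by simp only; omega) ?_⟩
      simp only [Data.size, Data.hd_pair, Data.tl_pair]
      omega

end simulate

/-- An oracle adversary can be run with a log of its flagged queries if the oracle and the flag are
computed in polynomial time from the environment `w.hd.hd`. The log is `w.hd.tl`, the input `w.tl`. -/
theorem RP.lexec {ans : Data → Data → Data} {flag : Data → Data → Bool} {A : Prog}
    (hA : A.IsOraclePPT) (hans : FP fun v => ans v.hd v.tl) (hflag : FPB fun v => flag v.hd v.tl) :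
    RP fun w => (CorPKE.lexec (ans w.hd.hd) (flag w.hd.hd) A (w.hd.tl, w.tl)).map fun u =>
      .pair u.1 u.2 := by
  have hx := FP.id
  have henv : FP fun v => .pair v.hd.hd v.tl := hx.hd.hd.pair hx.tl
  have hR : FP fun v => .pair (.pair v.hd.hd (if flag v.hd.hd v.tl = true then
      .pair (.atom true) v.tl else v.hd.tl)) (ans v.hd.hd v.tl) :=
    (hx.hd.hd.pair (.ite (hflag.comp henv) ((FP.const _).pair hx.tl) hx.hd.tl)).pair
      (hans.comp henv)
  obtain ⟨R, c, ⟨pc, hc⟩, hR⟩ := hR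
  replace hR : ∀ e s x, R.run noOracle (.pair (.pair e s) x) = PMF.pure
    (.pair (.pair e (if flag e x = true then .pair (.atom true) x else s)) (ans e x),
      c (.pair (.pair e s) x)) := fun e s x => hR _ _
  obtain ⟨r, hr⟩ := hans.polyBounded
  -- The answer to `y` is computed from `(e, y)`, of length `|e| + |y| + 1`; so the length of the
  -- environment takes the role of the parameter `N`, and `X + 1` accounts for the pairing node.
  obtain ⟨p, hp⟩ := hA (r.comp (Polynomial.X + 1))
  obtain ⟨K, hK⟩ := cost_simulate hR A
  have hM : PolyBounded fun z => z.size + p.eval z.size := .add .size (.eval .size p)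
  set M : Data → ℕ := fun z => z.size + p.eval z.size with hMdef
  set G : Data → ℕ := fun z => z.size + 2 * M z + 10 + pc.eval (z.size + 2 * M z + 5) with hGdef
  have hG : PolyBounded G := ((PolyBounded.size.add ((PolyBounded.const 2).mul hM)).add
    (.const 10)).add (((PolyBounded.size.add ((PolyBounded.const 2).mul hM)).add (.const 5)).eval pc)
  -- The initial program rebuilds the input in the shape `((environment, log), input)`, since an
  -- arbitrary object need not have it.
  have hsim : RP (Prog.exec noOracle (.comp (.pair (.pair (.comp .hd .hd) (.comp .hd .tl)) .tl)
      (Prog.simulate R A))) := by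
    refine ⟨_, Prog.isPPT_iff.2 ⟨fun z => 20 * (z.size + 1) +
      K * M (.pair (.pair z.hd.hd z.hd.tl) z.tl) * G (.pair (.pair z.hd.hd z.hd.tl) z.tl), ?_, ?_⟩,
      fun _ => rfl⟩
    · have hnorm : FP fun z => .pair (.pair z.hd.hd z.hd.tl) z.tl :=
        (hx.hd.hd.pair hx.hd.tl).pair hx.tl
      exact ((PolyBounded.const 20).mul (PolyBounded.size.add (.const 1))).add
        (((PolyBounded.const K).mul (hM.comp hnorm.polyBounded)).mul (hG.comp hnorm.polyBounded))
    · intro z u hu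
      simp only [Prog.run, PMF.pure_bind, PMF.pure_map, PMF.mem_support_map_iff] at hu
      obtain ⟨w, hw, rfl⟩ := hu
      set Z : Data := .pair (.pair z.hd.hd z.hd.tl) z.tl with hZ
      have h₁ : z.hd.hd.size + z.hd.tl.size + z.tl.size + 2 = Z.size := by
        simp only [hZ, Data.size]; omega
      obtain ⟨s', v, hv, -, h⟩ := hK z.hd.hd (M Z) (G Z) (by simp only [hGdef]; omega)
        (fun s x hs hx => by
          refine (hc _).trans (le_trans (Polynomial.eval_nat_mono pc ?_) (Nat.le_add_left _ _))
          simp only [Data.size]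
          omega) _ _ w hw
      have hvM : v.2 ≤ M Z := by
        refine (hp z.hd.hd.size (ans z.hd.hd) (fun y => ?_) z.tl v hv).trans
          ((Polynomial.eval_nat_mono p ?_).trans (Nat.le_add_left _ _))
        · refine (hr (.pair z.hd.hd y)).trans (le_of_eq ?_)
          simp [Data.size]
        · omega
      have h₂ : Z.size ≤ M Z := Nat.le_add_right _ _
      obtain ⟨-, h₃⟩ := h (by omega) (by omega) hvM
      have h₄ : K * v.2 * G Z ≤ K * M Z * G Z := by gcongr
      have h₅ := Data.size_hd_le z
      have h₆ := Data.size_tl_le z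
      have h₇ := Data.size_hd_le z.hd
      have h₈ := Data.size_tl_le z.hd
      change _ ≤ 20 * (z.size + 1) + K * M Z * G Z
      simp only
      omega
  have := hsim.map (g := fun _ v => .pair v.hd.tl v.tl) (hx.tl.hd.tl.pair hx.tl.tl)
  convert this using 2 with w
  simp only [Prog.exec_comp, Prog.exec_pair, Prog.exec_hd, Prog.exec_tl, PMF.pure_bind,
    PMF.pure_map, exec_simulate hR, PMF.map_comp]
  rfl

/-! ## Properties of logged runs -/

theorem map_kleisliIter {α β : Type} {f : α → PMF α} {g : β → PMF β} {h : α → β}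
    (hfg : ∀ a, (f a).map h = g (h a)) (m : ℕ) (a : α) :
    (kleisliIter f m a).map h = kleisliIter g m (h a) := by
  induction m generalizing a with
  | zero => simp [kleisliIter, PMF.pure_map]
  | succ m ih => simp only [kleisliIter, PMF.map_bind, ih, ← hfg, PMF.bind_map]; rfl

/-- The log does not influence the output. -/
theorem map_snd_lexec (O : Data → Data) (F : Data → Bool) (P : Prog) :
    ∀ u, (lexec O F P u).map Prod.snd = P.exec O u.2 := by
  induction P with
  | id => intro u; simp [lexec, Prog.exec_id, PMF.pure_map]
  | atom | hd | tl | isPair | query =>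
    intro u
    simp [lexec, Prog.exec_atom, Prog.exec_hd, Prog.exec_tl, Prog.exec_isPair, Prog.exec_query,
      PMF.pure_map]
  | coin => intro u; simp only [lexec, Prog.exec_coin, PMF.map_comp]; rfl
  | pair P Q hP hQ =>
    intro u
    simp only [lexec, Prog.exec_pair, PMF.map_bind, PMF.map_comp, ← hP, PMF.bind_map]
    congr 1
    funext v
    have := congrArg (PMF.map fun b => Data.pair v.2 b) (hQ (v.1, u.2))
    rw [PMF.map_comp] at this
    exact this
  | comp P Q hP hQ =>
    intro u
    simp only [lexec, Prog.exec_comp, PMF.map_bind, ← hP, PMF.bind_map, hQ]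
    rfl
  | cond B P Q hB hP hQ =>
    intro u
    simp only [lexec, Prog.exec_cond, PMF.map_bind, ← hB, PMF.bind_map]
    congr 1
    funext v
    rw [Function.comp_apply, apply_ite (PMF.map Prod.snd), hP, hQ]
  | loop B P hB hP =>
    intro u
    simp only [lexec, Prog.exec_loop, PMF.map_bind, ← hB, PMF.bind_map, map_kleisliIter hP]
    rfl

theorem mem_support_kleisliIter {α : Type} {f : α → PMF α} {I : α → Prop}
    (hf : ∀ a, I a → ∀ b ∈ (f a).support, I b) (m : ℕ) :
    ∀ a, I a → ∀ b ∈ (kleisliIter f m a).support, I b := by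
  induction m with
  | zero => intro a ha b hb; simp only [kleisliIter, PMF.mem_support_pure_iff] at hb; rwa [hb]
  | succ m ih =>
    intro a ha b hb
    simp only [kleisliIter, PMF.mem_support_bind_iff] at hb
    obtain ⟨c, hc, hb⟩ := hb
    exact ih c (hf a ha c hc) b hb

/-- The log is overwritten with flagged queries only. -/
theorem log_of_mem_support_lexec {O : Data → Data} {F : Data → Bool} {I : Data → Prop}
    (hI : ∀ y, F y = true → I (.pair (.atom true) y)) (P : Prog) :
    ∀ u, I u.1 → ∀ v ∈ (lexec O F P u).support, I v.1 := by
  induction P with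
  | id | atom | hd | tl | isPair =>
    intro u hu v hv; simp only [lexec, PMF.mem_support_pure_iff] at hv; rwa [hv]
  | query =>
    intro u hu v hv
    simp only [lexec, PMF.mem_support_pure_iff] at hv
    rw [hv]
    simp only
    split_ifs with h
    exacts [hI _ h, hu]
  | coin =>
    intro u hu v hv
    simp only [lexec, PMF.mem_support_map_iff] at hv
    obtain ⟨b, -, rfl⟩ := hv
    exact hu
  | pair P Q hP hQ =>
    intro u hu v hv
    simp only [lexec, PMF.mem_support_bind_iff, PMF.mem_support_map_iff] at hv
    obtain ⟨a, ha, b, hb, rfl⟩ := hv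
    exact hQ (a.1, u.2) (hP u hu a ha) b hb
  | comp P Q hP hQ =>
    intro u hu v hv
    simp only [lexec, PMF.mem_support_bind_iff] at hv
    obtain ⟨a, ha, hv⟩ := hv
    exact hQ a (hP u hu a ha) v hv
  | cond B P Q hB hP hQ =>
    intro u hu v hv
    simp only [lexec, PMF.mem_support_bind_iff] at hv
    obtain ⟨a, ha, hv⟩ := hv
    split_ifs at hv
    exacts [hP (a.1, u.2) (hB u hu a ha) v hv, hQ (a.1, u.2) (hB u hu a ha) v hv]
  | loop B P hB hP =>
    intro u hu v hv
    simp only [lexec, PMF.mem_support_bind_iff] at hv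
    obtain ⟨a, ha, hv⟩ := hv
    exact mem_support_kleisliIter (I := fun w : Data × Data => I w.1) hP _ (a.1, u.2)
      (hB u hu a ha) v hv

/-- Two experiments that begin with the same draw are compared draw by draw. Only draws in the
support matter, which makes properties of generated keys and of logs available. -/
theorem PMF.bind_apply_le_bind_apply {α β γ : Type} {p : PMF α} {f : α → PMF β} {g : α → PMF γ}
    {y : β} {z : γ}
    (h : ∀ a ∈ p.support, f a y ≤ g a z) : p.bind f y ≤ p.bind g z := by
  rw [PMF.bind_apply, PMF.bind_apply]
  refine ENNReal.tsum_le_tsum fun a => ?_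
  by_cases ha : a ∈ p.support
  · exact mul_le_mul' le_rfl (h a ha)
  · rw [PMF.mem_support_iff, not_not] at ha
    simp [ha]

theorem PMF.bind_congr {α β : Type} {p : PMF α} {f g : α → PMF β}
    (h : ∀ a ∈ p.support, f a = g a) : p.bind f = p.bind g := by
  ext y
  exact le_antisymm (bind_apply_le_bind_apply fun a ha => (congrArg (· y) (h a ha)).le)
    (bind_apply_le_bind_apply fun a ha => (congrArg (· y) (h a ha)).ge)

/-- The part of `μ` with empty log is dominated by `ν`. -/
def UnflaggedLE {α : Type} (μ : PMF (Data × α)) (ν : PMF α) : Prop :=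
  ∀ y, μ (.atom false, y) ≤ ν y

namespace UnflaggedLE

variable {α β : Type}

theorem pure (s : Data) (a : α) : UnflaggedLE (PMF.pure (s, a)) (PMF.pure a) := by
  intro y
  simp only [PMF.pure_apply, Prod.mk.injEq]
  split_ifs <;> simp_all

/-- A nonempty log never becomes empty again, by `hf`. So outcomes with empty log arise only from
intermediate states with empty log, and on these both factors are dominated. -/
theorem bind {μ : PMF (Data × α)} {ν : PMF α} {f : Data × α → PMF (Data × β)} {g : α → PMF β}
    (h : UnflaggedLE μ ν) (hfg : ∀ a, UnflaggedLE (f (.atom false, a)) (g a))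
    (hf : ∀ u : Data × α, u.1 ≠ .atom false → ∀ v ∈ (f u).support, v.1 ≠ .atom false) :
    UnflaggedLE (μ.bind f) (ν.bind g) := by
  intro y
  rw [PMF.bind_apply, PMF.bind_apply]
  have hinj : Function.Injective fun a : α => ((.atom false, a) : Data × α) :=
    fun a b hab => (Prod.ext_iff.1 hab).2
  rw [← hinj.tsum_eq]
  · exact ENNReal.tsum_le_tsum fun a => mul_le_mul' (h a) (hfg a y)
  · intro u hu
    by_cases hu' : u.1 = .atom false
    · exact ⟨u.2, Prod.ext hu'.symm rfl⟩
    · refine absurd ?_ hu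
      have : f u (.atom false, y) = 0 := by
        by_contra h0
        exact hf u hu' _ ((PMF.mem_support_iff _ _).2 h0) rfl
      simp [this]

theorem same_bind {γ : Type} (p : PMF γ) {f : γ → PMF (Data × β)} {g : γ → PMF β}
    (hfg : ∀ a ∈ p.support, UnflaggedLE (f a) (g a)) : UnflaggedLE (p.bind f) (p.bind g) :=
  fun y => PMF.bind_apply_le_bind_apply fun a ha => hfg a ha y

theorem map {μ : PMF (Data × α)} {ν : PMF α} (h : UnflaggedLE μ ν) (f : α → β) :
    UnflaggedLE (μ.map fun u => (u.1, f u.2)) (ν.map f) := by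
  refine h.bind (fun a => pure _ _) fun u hu v hv => ?_
  simp only [Function.comp_apply, PMF.mem_support_pure_iff] at hv
  rwa [hv]

end UnflaggedLE

theorem log_ne_of_mem_support_lexec {O : Data → Data} {F : Data → Bool} {P : Prog}
    {u : Data × Data} (hu : u.1 ≠ .atom false) : ∀ v ∈ (lexec O F P u).support, v.1 ≠ .atom false :=
  log_of_mem_support_lexec (I := fun s => s ≠ .atom false) (fun _ _ => by simp) P u hu

/-- Oracles that agree on queries that are not flagged yield the same run as long as
no query is flagged. -/
theorem unflaggedLE_lexec {O O' : Data → Data} {F : Data → Bool}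
    (hO : ∀ y, F y = false → O y = O' y) (P : Prog) :
    ∀ x, UnflaggedLE (lexec O F P (.atom false, x)) (P.exec O' x) := by
  induction P with
  | id => intro x; rw [lexec, Prog.exec_id]; exact .pure _ _
  | atom b => intro x; rw [lexec, Prog.exec_atom]; exact .pure _ _
  | hd => intro x; rw [lexec, Prog.exec_hd]; exact .pure _ _
  | tl => intro x; rw [lexec, Prog.exec_tl]; exact .pure _ _
  | isPair => intro x; rw [lexec, Prog.exec_isPair]; exact .pure _ _
  | query =>
    intro x
    rw [lexec, Prog.exec_query]
    cases h : F x with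
    | false => rw [hO x h]; exact .pure _ _
    -- The log becomes a pair, so no mass is left on the empty log.
    | true =>
      intro y
      simp [PMF.pure_apply]
  | coin =>
    intro x
    rw [lexec, Prog.exec_coin]
    exact .same_bind _ fun b _ => .pure _ _
  | pair P Q hP hQ =>
    intro x
    rw [lexec, Prog.exec_pair]
    refine (hP x).bind (fun a => (hQ x).map _) fun u hu v hv => ?_
    obtain ⟨w, hw, rfl⟩ := (PMF.mem_support_map_iff _ _ _).1 hv
    exact log_ne_of_mem_support_lexec (u := (u.1, x)) hu w hw
  | comp P Q hP hQ =>
    intro x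
    rw [lexec, Prog.exec_comp]
    exact (hP x).bind hQ fun u hu => log_ne_of_mem_support_lexec hu
  | cond B P Q hB hP hQ =>
    intro x
    rw [lexec, Prog.exec_cond]
    refine (hB x).bind (fun a => ?_) fun u hu v hv => ?_
    · dsimp only
      split_ifs
      exacts [hP x, hQ x]
    · split_ifs at hv
      exacts [log_ne_of_mem_support_lexec (u := (u.1, x)) hu v hv,
        log_ne_of_mem_support_lexec (u := (u.1, x)) hu v hv]
  | loop B P hB hP =>
    intro x
    rw [lexec, Prog.exec_loop]
    have hkill : ∀ (m : ℕ) (u : Data × Data), u.1 ≠ .atom false →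
        ∀ v ∈ (kleisliIter (lexec O F P) m u).support, v.1 ≠ .atom false := fun m =>
      mem_support_kleisliIter (I := fun w : Data × Data => w.1 ≠ .atom false)
        (fun a ha => log_ne_of_mem_support_lexec ha) m
    refine (hB x).bind (fun a => ?_) fun u hu v hv => hkill _ (u.1, x) hu v hv
    dsimp only
    generalize a.size = m
    induction m generalizing x with
    | zero => exact .pure _ _
    | succ m ih => exact (hP x).bind ih (hkill m)

/-! ## Independent draws -/

theorem mem_support_indep {α : Type} : ∀ {m : ℕ} (p : Fin m → PMF α) (f : Fin m → α),
    f ∈ (indep p).support ↔ ∀ i, f i ∈ (p i).support := by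
  intro m
  induction m with
  | zero =>
    intro p f
    simp only [indep, PMF.mem_support_pure_iff]
    exact ⟨fun _ i => i.elim0, fun _ => funext fun i => i.elim0⟩
  | succ m ih =>
    intro p f
    simp only [indep, PMF.mem_support_bind_iff, PMF.mem_support_map_iff, Fin.forall_fin_succ, ih]
    constructor
    · rintro ⟨a, ha, g, hg, rfl⟩
      exact ⟨by simpa using ha, by simpa using hg⟩
    · rintro ⟨h₀, h⟩
      exact ⟨f 0, h₀, fun i => f i.succ, h, Fin.cons_self_tail f⟩

theorem indep_bind {α β : Type} : ∀ {m : ℕ} (p : Fin m → PMF α) (r : Fin m → α → PMF β),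
    (indep p).bind (fun f => indep fun i => r i (f i)) = indep fun i => (p i).bind (r i) := by
  intro m
  induction m with
  | zero => intro p r; simp [indep]
  | succ m ih =>
    intro p r
    simp only [indep, PMF.bind_bind, PMF.bind_map, Function.comp_def, Fin.cons_zero, Fin.cons_succ]
    congr 1
    funext a
    rw [PMF.bind_comm]
    congr 1
    funext b
    rw [← ih, PMF.map_bind]

theorem indep_pure {α : Type} : ∀ {m : ℕ} (f : Fin m → α),
    indep (fun i => PMF.pure (f i)) = PMF.pure f := by
  intro m
  induction m with
  | zero => intro f; simp only [indep]; congr 1; funext i; exact i.elim0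
  | succ m ih =>
    intro f
    simp only [indep, PMF.pure_bind, ih, PMF.pure_map]
    congr 1
    exact Fin.cons_self_tail f

theorem indep_map {α β : Type} {m : ℕ} (p : Fin m → PMF α) (r : Fin m → α → β) :
    (indep p).map (fun f i => r i (f i)) = indep fun i => (p i).map (r i) := by
  have := indep_bind p fun i a => PMF.pure (r i a)
  simp only [indep_pure] at this
  exact this

/-- This is what allows foreign keys to be planted in a key table: the overwritten coordinate is
independent of the others. -/
theorem indep_resample {α : Type} : ∀ {m : ℕ} (p : Fin m → PMF α) (j : Fin m),
    ((indep p).bind fun f => (p j).map fun x => Function.update f j x) = indep p := by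
  intro m
  induction m with
  | zero => intro p j; exact j.elim0
  | succ m ih =>
    intro p j
    induction j using Fin.cases with
    | zero =>
      simp only [indep, PMF.bind_bind, PMF.bind_map, Function.comp_def, Fin.update_cons_zero,
        PMF.bind_const]
      exact PMF.bind_comm (indep _) (p 0) fun f a =>
        PMF.pure (Fin.cons a f : Fin (m + 1) → α)
    | succ j =>
      simp only [indep, PMF.bind_bind, PMF.bind_map, Function.comp_def, ← Fin.cons_update]
      congr 1
      funext a
      conv_rhs => rw [← ih (fun i => p i.succ) j, PMF.map_bind]
      simp only [PMF.map_comp]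
      rfl

/-- Identically distributed draws may be made in any order. It is needed because `sampleList`
prepends, so that its first sample ends up last. -/
theorem indep_snoc {α : Type} (p : PMF α) (m : ℕ) :
    (p.bind fun a => (indep fun _ : Fin m => p).map fun f => (Fin.snoc f a : Fin (m + 1) → α)) =
      indep fun _ : Fin (m + 1) => p := by
  induction m with
  | zero =>
    simp only [indep, PMF.pure_map]
    congr 1
    funext a
    congr 1
    funext i
    rw [Fin.fin_one_eq_zero i]
    rfl
  | succ m ih =>
    conv_rhs => rw [indep, ← ih]
    conv_lhs => simp only [indep, PMF.map_bind, PMF.map_comp]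
    rw [PMF.bind_comm]
    simp only [PMF.map_bind, PMF.map_comp]
    congr 1
    funext a
    congr 1
    funext b
    congr 1
    funext f
    exact (Fin.cons_snoc_eq_snoc_cons a f b).symm

theorem sampleList_eq {α : Type} [Coded α] (p : PMF α) : ∀ (m : ℕ) (l : List α),
    sampleList (p.map code) m (codeList l) =
      (indep fun _ : Fin m => p).map fun f => codeList (List.ofFn f ++ l) := by
  intro m
  induction m with
  | zero => intro l; simp [sampleList, indep, PMF.pure_map]
  | succ m ih =>
    intro l
    rw [sampleList, PMF.bind_map, ← indep_snoc, PMF.map_bind]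
    congr 1
    funext a
    rw [PMF.map_comp, Function.comp_apply]
    refine (ih (a :: l)).trans ?_
    congr 1
    funext f
    rw [Function.comp_apply, List.ofFn_succ', List.concat_eq_append]
    simp

/-! ## Fair coins -/

/-- A guess that is independent of the coin is right with probability one half. -/
theorem fairCoin_map_eq (c : Bool) : (fairCoin.map fun b => decide (b = c)) = fairCoin := by
  ext b
  rw [PMF.map_apply]
  cases b <;> cases c <;> simp [fairCoin, tsum_fintype]

theorem fairCoin_apply (b : Bool) : (fairCoin b).toReal = 1 / 2 := by
  simp [fairCoin]

/-! ## Coding -/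

theorem code_injective {α : Type} [Coded α] : Function.Injective (code : α → Data) :=
  Coded.code_injective

theorem decode_code {α : Type} [Coded α] (a : α) : decode α (code a) = some a := by
  have h : ∃ b : α, code b = code a := ⟨a, rfl⟩
  rw [decode, dif_pos h, code_injective h.choose_spec]

theorem decode_eq_some_iff {α : Type} [Coded α] {x : Data} {a : α} :
    decode α x = some a ↔ x = code a := by
  constructor
  · intro h
    rw [decode] at h
    split_ifs at h with h'
    rw [← Option.some.inj h, h'.choose_spec]
  · rintro rfl
    exact decode_code a

theorem codeList_map {α : Type} [Coded α] (l : List α) : codeList l = codeList (l.map code) := by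
  induction l with
  | nil => rfl
  | cons a l ih => simp only [codeList, List.map_cons, ih]; rfl

theorem code_fun {m : ℕ} {α : Type} [Coded α] (f : Fin m → α) :
    code f = codeList (List.ofFn fun i => code (f i)) := by
  change codeList _ = _
  rw [codeList_map, List.map_ofFn]
  rfl

theorem nth_code {m : ℕ} {α : Type} [Coded α] (f : Fin m → α) (i : Fin m) :
    nth (code f) (unary i) = code (f i) := by
  rw [code_fun, nth, size_unary]
  have hdrop : ∀ (i : ℕ) (l : List Data) (h : i < l.length), (Data.tl^[i] (codeList l)).hd = l[i] := by
    intro i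
    induction i with
    | zero =>
      intro l h
      cases l with
      | nil => simp at h
      | cons a l => rfl
    | succ i ih =>
      intro l h
      cases l with
      | nil => simp at h
      | cons a l =>
        rw [Function.iterate_succ_apply]
        exact ih l (by simpa using h)
  rw [hdrop _ _ (by simp)]
  simp

theorem tabulate_eq_code {m : ℕ} {α : Type} [Coded α] {g : Data → Data} {f : Fin m → α}
    (h : ∀ i : Fin m, g (unary i) = code (f i)) : tabulate g (unary m) = code f := by
  rw [tabulate_unary, code_fun]
  simp only [h]

/-! ## Counting -/

/-- `Nat.count p i` is the rank of a hit `i`, so the first `t` hits are those of rank below `t`.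
Exactly `t` positions are wanted, because `verify` and `recover` are specified for sets of exact
size `τ`. -/
theorem card_filter_count_lt {m t : ℕ} (p : ℕ → Prop) [DecidablePred p]
    (h : t ≤ (Finset.univ.filter fun i : Fin m => p i).card) :
    (Finset.univ.filter fun i : Fin m => p i ∧ Nat.count p i < t).card = t := by
  rw [Finset.card_filter, Fin.sum_univ_eq_sum_range fun i => if p i then 1 else 0,
    ← Finset.card_filter, ← Nat.count_eq_card_filter_range] at h
  rw [Finset.card_filter, Fin.sum_univ_eq_sum_range fun i => if p i ∧ Nat.count p i < t then 1 else 0]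
  suffices h' : ∀ m, ∑ i ∈ Finset.range m, (if p i ∧ Nat.count p i < t then 1 else 0) =
      min t (Nat.count p m) by rw [h', min_eq_left h]
  intro m
  induction m with
  | zero => simp
  | succ m ih =>
    rw [Finset.sum_range_succ, ih, Nat.count_succ]
    by_cases hp : p m <;> simp only [hp, true_and, false_and, if_true, if_false] <;>
      (try split_ifs) <;> omega

/-! ## Answering decryption queries without the keys of the challenge -/

/-- Functions on objects that realize the deterministic algorithms of the construction, and the
properties of these algorithms. -/
structure Realization {k l q : ℕ → ℕ} (τ : ℕ → ℕ) {P : BasePKE} (C : CorrelatedEncoding P k)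
    (ecc : ∀ n, (Fin (l n) → Fin (q n)) → (Fin (k n) → Fin (q n)))
    (SS : SigScheme (fun n => Fin (l n) → Fin (q n)) (fun n => Fin (k n) → Data))
    (verify : ∀ n, (Fin (k n) → Data) → (Fin (k n) → Data) → (Fin (k n) → Option Data) → Bool)
    (recover : ∀ n, (Fin (k n) → Option Data) → (Fin (k n) → Data)) where
  (kF lF qF τF eccF verF decF verifyF recoverF decodeF : Data → Data)
  fp_k : FP kF
  fp_l : FP lF
  fp_q : FP qF
  fp_τ : FP τF
  fp_ecc : FP eccF
  fp_ver : FP verF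
  fp_dec : FP decF
  fp_verify : FP verifyF
  fp_recover : FP recoverF
  fp_decode : FP decodeF
  k_eq : ∀ n, kF (unary n) = unary (k n)
  l_eq : ∀ n, lF (unary n) = unary (l n)
  q_eq : ∀ n, qF (unary n) = unary (q n)
  τ_eq : ∀ n, τF (unary n) = unary (τ n)
  ecc_eq : ∀ n v, eccF (.pair (unary n) (code v)) = code (ecc n v)
  ver_eq : ∀ n v c s, verF (.pair (unary n) (.pair (code v) (.pair (code c) s))) =
    .atom (SS.ver n v c s)
  dec_eq : ∀ n s c, decF (.pair (unary n) (.pair s c)) = code (P.dec n s c)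
  verify_eq : ∀ n c pk r, verifyF (.pair (unary n) (.pair (code c) (.pair (code pk) (code r)))) =
    .atom (verify n c pk r)
  recover_eq : ∀ n r, recoverF (.pair (unary n) (code r)) = code (recover n r)
  decode_eq : ∀ n t, decodeF (.pair (unary n) (code t)) = C.D n t
  le_hammingDist : ∀ n, ∀ v w : Fin (l n) → Fin (q n), v ≠ w → τ n ≤ hammingDist (ecc n v) (ecc n w)
  recover_restrict : ∀ n, ∀ t ∈ C.Cor n, ∀ T : Finset (Fin (k n)), T.card = τ n →
    recover n (restrict T t) = t
  verify_iff : ∀ n, ∀ key ∈ ((corPKE P C).gen n).support, ∀ c : Fin (k n) → Data,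
    ∀ T : Finset (Fin (k n)), T.card = τ n →
      (verify n c key.1 (restrict T key.2) = true ↔ ((corPKE P C).dec n key.2 c).isSome)

/-- The environment of a simulation: the challenge ciphertext, if any, the security parameter,
the verification key of the challenge, and the tables of public and secret keys. -/
def environment {κ K V : Type} [Coded V] [Coded K] [Coded κ]
    (chal : Data) (n : ℕ) (v : V) (pk : K) (sk : κ) : Data :=
  .pair chal (.pair (unary n) (.pair (code v) (.pair (code pk) (code sk))))

namespace Realization

variable {k l q τ : ℕ → ℕ} {P : BasePKE} {C : CorrelatedEncoding P k}
  {ecc : ∀ n, (Fin (l n) → Fin (q n)) → (Fin (k n) → Fin (q n))}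
  {SS : SigScheme (fun n => Fin (l n) → Fin (q n)) (fun n => Fin (k n) → Data)}
  {verify : ∀ n, (Fin (k n) → Data) → (Fin (k n) → Data) → (Fin (k n) → Option Data) → Bool}
  {recover : ∀ n, (Fin (k n) → Option Data) → (Fin (k n) → Data)}
  (R : Realization τ C ecc SS verify recover)

/-- Whether `y` is a ciphertext, for security parameter `N`. -/
def isCiphertext (N y : Data) : Bool :=
  y.eqb (.pair (tabulate (fun i => nth y.hd i) (R.kF N))
    (.pair (tabulate (fun i => nth y.tl.hd i) (R.lF N)) y.tl.tl)) &&
  !anyBelow (fun i => !anyBelow (fun j => (nth y.tl.hd i).eqb j) (R.qF N).size) (R.lF N).size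

theorem fpb_isCiphertext : FPB fun v => R.isCiphertext v.hd v.tl := by
  have hx := FP.id
  refine .and (.eqb hx.tl (.pair (.tabulate (g := fun v i => nth v.tl.hd i)
    (hx.hd.tl.hd.nth hx.tl) (R.fp_k.comp hx.hd)) (.pair (.tabulate (g := fun v i => nth v.tl.tl.hd i)
    (hx.hd.tl.tl.hd.nth hx.tl) (R.fp_l.comp hx.hd)) hx.tl.tl.tl)))
    (.not (.anyBelow (p := fun v i => !anyBelow (fun j => (nth v.tl.tl.hd i).eqb j)
      (R.qF v.hd).size) (.not ?_) (R.fp_l.comp hx.hd)))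
  exact .anyBelow (p := fun w j => (nth w.hd.tl.tl.hd w.tl).eqb j)
    (.eqb (hx.hd.hd.tl.tl.hd.nth hx.hd.tl) hx.tl) (R.fp_q.comp hx.hd.hd)

/-- An object codes a tuple of the right length precisely if it equals the table of its own entries.
Only the entries of the verification key are restricted further, to numerals below `q n`; entries of
the inner ciphertext and the signature are arbitrary objects. -/
theorem isCiphertext_iff (n : ℕ) (y : Data) : R.isCiphertext (unary n) y = true ↔
    ∃ c : (Fin (k n) → Data) × ((Fin (l n) → Fin (q n)) × Data), y = code c := by
  rw [isCiphertext, Bool.and_eq_true, Data.eqb_iff, Bool.not_eq_true', Bool.eq_false_iff, Ne,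
    anyBelow_iff, R.k_eq, R.l_eq, R.q_eq, size_unary, size_unary]
  have hk : tabulate (fun i => nth y.hd i) (unary (k n)) =
    code fun i : Fin (k n) => nth y.hd (unary i) := tabulate_eq_code fun i => rfl
  constructor
  · rintro ⟨hy, h⟩
    have h' : ∀ i : Fin (l n), ∃ j : Fin (q n), nth y.tl.hd (unary i) = code j := by
      intro i
      by_contra! hc
      refine h ⟨i, i.2, ?_⟩
      rw [Bool.not_eq_true', Bool.eq_false_iff, Ne, anyBelow_iff]
      rintro ⟨j, hj, hij⟩
      exact hc ⟨j, hj⟩ ((Data.eqb_iff _ _).1 hij)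
    choose v hv using h'
    refine ⟨(fun i => nth y.hd (unary i), (v, y.tl.tl)), ?_⟩
    rw [hk, tabulate_eq_code hv] at hy
    exact hy
  · rintro ⟨⟨c, v, s⟩, rfl⟩
    have hc : code (c, (v, s)) = .pair (code c) (.pair (code v) s) := rfl
    rw [hc]
    simp only [Data.hd_pair, Data.tl_pair]
    refine ⟨?_, ?_⟩
    · rw [tabulate_eq_code (f := c) fun i => nth_code c i,
        tabulate_eq_code (f := v) fun i => nth_code v i]
    · rintro ⟨i, hi, h⟩
      rw [Bool.not_eq_true', Bool.eq_false_iff, Ne, anyBelow_iff] at h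
      exact h ⟨v ⟨i, hi⟩, (v ⟨i, hi⟩).2, (Data.eqb_iff _ _).2 (nth_code v ⟨i, hi⟩)⟩

/-- Whether the codewords of the verification keys in the query and in the environment differ at
position `i`. Here and below, `z` consists of an environment and a query. -/
def differs (z i : Data) : Bool :=
  !(nth (R.eccF (.pair z.hd.tl.hd z.tl.tl.hd)) i).eqb
    (nth (R.eccF (.pair z.hd.tl.hd z.hd.tl.tl.hd)) i)

/-- Whether `i` is among the first `τ` positions at which the codewords differ. -/
def selected (z i : Data) : Bool :=
  R.differs z i && (Data.tl^[(unary (Nat.count (fun j => R.differs z (unary j) = true) i.size)).size]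
    (R.τF z.hd.tl.hd)).isPair

/-- The entry for position `i` of the key table `T`, for the codeword of the query. -/
def entry (T z i : Data) : Data :=
  nth (nth T i) (nth (R.eccF (.pair z.hd.tl.hd z.tl.tl.hd)) i)

/-- The answer to a query. -/
def answer (z : Data) : Data :=
  bif (R.isCiphertext z.hd.tl.hd z.tl && (!z.tl.tl.hd.eqb z.hd.tl.tl.hd &&
    ((R.verF (.pair z.hd.tl.hd (.pair z.tl.tl.hd (.pair z.tl.hd z.tl.tl.tl)))).isOne &&
      (R.verifyF (.pair z.hd.tl.hd (.pair z.tl.hd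
        (.pair (tabulate (fun i => R.entry z.hd.tl.tl.tl.hd z i) (R.kF z.hd.tl.hd))
          (tabulate (fun i => bif R.selected z i then
            .pair (.atom true) (R.entry z.hd.tl.tl.tl.tl z i) else .atom false)
              (R.kF z.hd.tl.hd)))))).isOne))) then
    .pair (.atom true) (R.decodeF (.pair z.hd.tl.hd (R.recoverF (.pair z.hd.tl.hd
      (tabulate (fun i => bif R.selected z i then
        .pair (.atom true) (R.decF (.pair z.hd.tl.hd
          (.pair (R.entry z.hd.tl.tl.tl.tl z i) (nth z.tl.hd i)))).tl else .atom false)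
            (R.kF z.hd.tl.hd))))))
  else .atom false

/-- Whether a query contains a forgery. -/
def forges (z : Data) : Bool :=
  R.isCiphertext z.hd.tl.hd z.tl && (z.tl.tl.hd.eqb z.hd.tl.tl.hd &&
    ((R.verF (.pair z.hd.tl.hd (.pair z.tl.tl.hd (.pair z.tl.hd z.tl.tl.tl)))).isOne &&
      !z.tl.eqb z.hd.hd))

theorem fpb_differs : FPB fun w => R.differs w.hd w.tl := by
  have hx := FP.id
  have hz := hx.hd
  exact .not (.eqb ((R.fp_ecc.comp (hz.hd.tl.hd.pair hz.tl.tl.hd)).nth hx.tl)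
    ((R.fp_ecc.comp (hz.hd.tl.hd.pair hz.hd.tl.tl.hd)).nth hx.tl))

theorem fpb_selected : FPB fun w => R.selected w.hd w.tl := by
  have hx := FP.id
  have hz := hx.hd
  exact .and R.fpb_differs (.isPair ((R.fp_τ.comp hz.hd.tl.hd).drop
    (.count (p := fun w i => R.differs w.hd i) (R.fpb_differs.comp (hz.hd.pair hx.tl)) hx.tl)))

theorem fp_entry {T z i : Data → Data} (hT : FP T) (hz : FP z) (hi : FP i) :
    FP fun w => R.entry (T w) (z w) (i w) :=
  (hT.nth hi).nth ((R.fp_ecc.comp (hz.hd.tl.hd.pair hz.tl.tl.hd)).nth hi)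

theorem fp_answer : FP R.answer := by
  have hz := FP.id
  have hw := hz.hd
  have hN := hz.hd.tl.hd
  have hk := R.fp_k.comp hN
  have hct := R.fpb_isCiphertext.comp (hN.pair hz.tl)
  refine .cond (.and hct (.and (.not (.eqb hz.tl.tl.hd hz.hd.tl.tl.hd))
    (.and (.isOne (R.fp_ver.comp (hN.pair (hz.tl.tl.hd.pair (hz.tl.hd.pair hz.tl.tl.tl)))))
    (.isOne (R.fp_verify.comp (hN.pair (hz.tl.hd.pair (.pair
      (.tabulate (g := fun z i => R.entry z.hd.tl.tl.tl.hd z i)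
        (R.fp_entry hw.hd.tl.tl.tl.hd hw hz.tl) hk)
      (.tabulate (g := fun z i => bif R.selected z i then
        .pair (.atom true) (R.entry z.hd.tl.tl.tl.tl z i) else .atom false)
        (.cond R.fpb_selected ((FP.const _).pair (R.fp_entry hw.hd.tl.tl.tl.tl hw hz.tl))
          (FP.const _)) hk)))))))))
    ((FP.const _).pair (R.fp_decode.comp (hN.pair (R.fp_recover.comp (hN.pair
      (.tabulate (g := fun z i => bif R.selected z i then
        .pair (.atom true) (R.decF (.pair z.hd.tl.hd
          (.pair (R.entry z.hd.tl.tl.tl.tl z i) (nth z.tl.hd i)))).tl else .atom false)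
        (.cond R.fpb_selected ((FP.const _).pair (R.fp_dec.comp (hw.hd.tl.hd.pair
          ((R.fp_entry hw.hd.tl.tl.tl.tl hw hz.tl).pair (hw.tl.hd.nth hz.tl)))).tl)
          (FP.const _)) hk))))))
    (FP.const _)

theorem fpb_forges : FPB R.forges := by
  have hz := FP.id
  have hN := hz.hd.tl.hd
  exact .and (R.fpb_isCiphertext.comp (hN.pair hz.tl)) (.and (.eqb hz.tl.tl.hd hz.hd.tl.tl.hd)
    (.and (.isOne (R.fp_ver.comp (hN.pair (hz.tl.tl.hd.pair (hz.tl.hd.pair hz.tl.tl.tl)))))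
      (.not (.eqb hz.tl hz.hd.hd))))

/-- The decryption oracle that rejects all ciphertexts with verification key `v`. -/
noncomputable def rejectOracle (C : CorrelatedEncoding P k)
    (ecc : ∀ n, (Fin (l n) → Fin (q n)) → (Fin (k n) → Fin (q n)))
    (SS : SigScheme (fun n => Fin (l n) → Fin (q n)) (fun n => Fin (k n) → Data)) (n : ℕ)
    (sk : Fin (k n) → Fin (q n) → Data) (v : Fin (l n) → Fin (q n)) (y : Data) : Data :=
  code ((decode ((Fin (k n) → Data) × ((Fin (l n) → Fin (q n)) × Data)) y).bind fun c =>
    if c.2.1 = v then none else (ccaPKE P C ecc SS).dec n sk c)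

theorem forges_environment_iff {κ K : Type} [Coded κ] [Coded K] (chal : Data) (n : ℕ)
    (v : Fin (l n) → Fin (q n)) (pk : K) (sk : κ) (y : Data) :
    R.forges (.pair (environment chal n v pk sk) y) = true ↔
      ∃ c : Fin (k n) → Data, ∃ s : Data, y = code (c, (v, s)) ∧ SS.ver n v c s = true ∧ y ≠ chal := by
  simp only [forges, environment, Data.hd_pair, Data.tl_pair, Bool.and_eq_true,
    R.isCiphertext_iff, Data.eqb_iff, Bool.not_eq_true', Bool.eq_false_iff, Ne]
  constructor
  · rintro ⟨⟨⟨c, v', s⟩, rfl⟩, h₁, h₂, h₃⟩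
    have h₁ : code v' = code v := h₁
    obtain rfl := code_injective h₁
    exact ⟨c, s, rfl, by rwa [show code (c, (v', s)) = .pair (code c) (.pair (code v') s) from rfl,
      Data.tl_pair, Data.hd_pair, Data.hd_pair, Data.tl_pair, R.ver_eq] at h₂, h₃⟩
  · rintro ⟨c, s, rfl, h₁, h₂⟩
    refine ⟨⟨_, rfl⟩, rfl, ?_, h₂⟩
    rw [show code (c, (v, s)) = .pair (code c) (.pair (code v) s) from rfl,
      Data.tl_pair, Data.hd_pair, Data.hd_pair, Data.tl_pair, R.ver_eq]
    exact h₁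

/-- The heart of the reduction. The table `sk'` may be wrong at the positions of the codeword of
`v`, but a query with key `w ≠ v` is answered using only positions where the codewords of `w` and
`v` differ, and there the selected keys are correct. Queries with key `v` are rejected outright. -/
theorem answer_environment (chal : Data) (n : ℕ) (v : Fin (l n) → Fin (q n))
    (pk sk sk' : Fin (k n) → Fin (q n) → Data)
    (hkeys : ∀ i a, (pk i a, sk i a) ∈ (P.gen n).support)
    (hsk : ∀ i a, a ≠ ecc n v i → sk' i a = sk i a) (y : Data) :
    R.answer (.pair (environment chal n v pk sk') y) = rejectOracle C ecc SS n sk v y := by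
  rw [answer, rejectOracle]
  simp only [environment, Data.hd_pair, Data.tl_pair]
  by_cases hy : ∃ c : (Fin (k n) → Data) × ((Fin (l n) → Fin (q n)) × Data), y = code c
  swap
  · have h₁ : R.isCiphertext (unary n) y = false :=
      Bool.eq_false_iff.2 fun h => hy ((R.isCiphertext_iff n y).1 h)
    have h₂ : decode ((Fin (k n) → Data) × ((Fin (l n) → Fin (q n)) × Data)) y = none := by
      by_contra h
      obtain ⟨c, hc⟩ := Option.ne_none_iff_exists'.1 h
      exact hy ⟨c, decode_eq_some_iff.1 hc⟩
    rw [h₁, h₂]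
    rfl
  have hct := (R.isCiphertext_iff n y).2 hy
  obtain ⟨⟨c, w, s⟩, rfl⟩ := hy
  rw [decode_code, Option.bind_some, hct]
  have hcode : code (c, (w, s)) = .pair (code c) (.pair (code w) s) := rfl
  simp only [hcode, Data.hd_pair, Data.tl_pair, R.ver_eq, Data.isOne_atom, Bool.true_and]
  by_cases hvw : w = v
  · rw [if_pos hvw, hvw, (Data.eqb_iff _ _).2 rfl]
    rfl
  rw [if_neg hvw, Bool.eq_false_iff.2 fun h => hvw (code_injective ((Data.eqb_iff _ _).1 h)),
    ccaPKE]
  simp only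
  cases hs : SS.ver n w c s with
  | false => rfl
  | true =>
  simp only [Bool.not_false, Bool.true_and, if_true]
  set z : Data := .pair (environment chal n v pk sk') (code (c, (w, s))) with hz
  have hz' : .pair (.pair chal (.pair (unary n) (.pair (code v) (.pair (code pk) (code sk')))))
      (.pair (code c) (.pair (code w) s)) = z := rfl
  rw [hz']
  have hdiffers : ∀ i : Fin (k n), R.differs z (unary i) = true ↔ ecc n w i ≠ ecc n v i := by
    intro i
    simp only [differs, hz, environment, hcode, Data.hd_pair, Data.tl_pair, R.ecc_eq, nth_code,
      Bool.not_eq_true', Bool.eq_false_iff, Ne, Data.eqb_iff, code_injective.eq_iff]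
  set T : Finset (Fin (k n)) := Finset.univ.filter fun i =>
    R.differs z (unary i) = true ∧ Nat.count (fun j => R.differs z (unary j) = true) i < τ n with hT
  -- The minimum distance of the code provides at least `τ n` differing positions, of which the
  -- first `τ n` are taken.
  have hTcard : T.card = τ n := by
    refine card_filter_count_lt (fun i => R.differs z (unary i) = true) ?_
    refine (R.le_hammingDist n w v hvw).trans (le_of_eq ?_)
    rw [hammingDist]
    congr 1
    ext i
    simp [hdiffers]
  have hsel : ∀ i : Fin (k n), R.selected z (unary i) = true ↔ i ∈ T := by
    intro i
    -- The program compares two unary numbers by dropping `a` cells from the code of `b` and testing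
    -- whether anything remains.
    have hlt : ∀ a b : ℕ, (Data.tl^[a] (unary b)).isPair = true ↔ a < b := by
      intro a b
      rw [iterate_tl_unary]
      rcases h : b - a with _ | c
      · simp [unary]; omega
      · simp [unary]; omega
    rw [selected, Bool.and_eq_true, size_unary, size_unary]
    simp only [hT, Finset.mem_filter_univ]
    refine and_congr_right fun _ => ?_
    rw [← hlt, ← R.τ_eq]
    rfl
  have hentry : ∀ (t : Fin (k n) → Fin (q n) → Data) (i : Fin (k n)),
      R.entry (code t) z (unary i) = select t (ecc n w) i := by
    intro t i
    simp only [entry, hz, environment, hcode, Data.hd_pair, Data.tl_pair, R.ecc_eq, nth_code, select]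
    exact nth_code (t i) (ecc n w i)
  have hsk' : ∀ i ∈ T, select sk' (ecc n w) i = select sk (ecc n w) i := by
    intro i hi
    exact hsk i _ ((hdiffers i).1 (Finset.mem_filter_univ _ |>.1 hi).1)
  have htab : ∀ (f : Data → Data) (t : Fin (k n) → Data),
      (∀ i ∈ T, f (unary i) = t i) → tabulate (fun i => bif R.selected z i then
        .pair (.atom true) (f i) else .atom false) (R.kF (unary n)) = code (restrict T t) := by
    intro f t hf
    rw [R.k_eq]
    refine tabulate_eq_code fun i => ?_
    by_cases hi : i ∈ T
    · rw [(hsel i).2 hi, restrict, if_pos hi, hf i hi]; rfl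
    · rw [Bool.eq_false_iff.2 fun h => hi ((hsel i).1 h), restrict, if_neg hi]; rfl
  have hpk : tabulate (fun i => R.entry (code pk) z i) (R.kF (unary n)) =
      code (select pk (ecc n w)) := by
    rw [R.k_eq]
    exact tabulate_eq_code fun i => hentry pk i
  -- A failed decryption of an entry is coded by an atom, whose tail is `.atom false`; this matches
  -- the default of `getD`. The value is immaterial, as the recovered tuple is used only if `verify`
  -- accepts.
  rw [hpk, htab _ (select sk (ecc n w)) fun i hi => (hentry sk' i).trans (hsk' i hi), R.verify_eq,
    htab _ (fun i => (P.dec n (select sk (ecc n w) i) (c i)).getD (.atom false)) fun i hi => by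
      rw [hentry, hsk' i hi, nth_code]
      refine (congrArg Data.tl (R.dec_eq n _ (c i))).trans ?_
      cases P.dec n (select sk (ecc n w) i) (c i) <;> rfl,
    R.recover_eq, R.decode_eq]
  -- Verifiability is only promised for generated key tuples; the true keys selected by `w` form
  -- one.
  have hkey : (select pk (ecc n w), select sk (ecc n w)) ∈ ((corPKE P C).gen n).support := by
    rw [corPKE, PMF.mem_support_map_iff]
    exact ⟨fun i => (pk i (ecc n w i), sk i (ecc n w i)),
      (mem_support_indep _ _).2 fun i => hkeys i _, rfl⟩
  have hv := R.verify_iff n _ hkey c T hTcard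
  simp only [Data.isOne_atom] at hv ⊢
  -- If the ciphertext is valid, the decrypted entries on `T` belong to a tuple of `C.Cor n`, and
  -- `recover` restores the entries for which keys may be missing. Otherwise `verify` rejects.
  by_cases hdec : ∃ t ∈ C.Cor n, ∀ i, P.dec n (select sk (ecc n w) i) (c i) = some (t i)
  · have hd : (corPKE P C).dec n (select sk (ecc n w)) c = some (C.D n fun i =>
        (P.dec n (select sk (ecc n w) i) (c i)).getD (.atom false)) := if_pos hdec
    rw [hd] at hv ⊢
    rw [hv.2 rfl]
    obtain ⟨t, ht, htd⟩ := hdec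
    simp only [htd, Option.getD_some]
    rw [R.recover_restrict n t ht T hTcard]
    rfl
  · have hd : (corPKE P C).dec n (select sk (ecc n w)) c = none := if_neg hdec
    rw [hd] at hv ⊢
    rw [show verify n c (select pk (ecc n w)) (restrict T (select sk (ecc n w))) = false from
      Bool.eq_false_iff.2 fun h => by simpa using hv.1 h]
    rfl

end Realization

/-! ## The two reductions as programs -/

section Adversaries

variable {k l q τ : ℕ → ℕ} {P : BasePKE} {C : CorrelatedEncoding P k}
  {ecc : ∀ n, (Fin (l n) → Fin (q n)) → (Fin (k n) → Fin (q n))}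
  {SS : SigScheme (fun n => Fin (l n) → Fin (q n)) (fun n => Fin (k n) → Data)}
  {verify : ∀ n, (Fin (k n) → Data) → (Fin (k n) → Data) → (Fin (k n) → Option Data) → Bool}
  {recover : ∀ n, (Fin (k n) → Option Data) → (Fin (k n) → Data)}

/-- Independent key pairs for all positions and letters. -/
noncomputable def keyTable (P : BasePKE) (k q n : ℕ) : PMF (Fin k → Fin q → Data × Data) :=
  indep fun _ => indep fun _ => P.gen n

/-- The table with the key pairs at the positions of the codeword `d` replaced. -/
def replace {k q : ℕ} {α : Type} (key : Fin k → Fin q → α) (d : Fin k → Fin q) (g : Fin k → α) :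
    Fin k → Fin q → α :=
  fun i => Function.update (key i) (d i) (g i)

/-- The logged run of an adversary with simulated decryption oracle. -/
noncomputable def Realization.simRun (R : Realization τ C ecc SS verify recover) (A : Prog)
    (e s x : Data) : PMF (Data × Data) :=
  lexec (fun y => R.answer (.pair e y)) (fun y => R.forges (.pair e y)) A (s, x)

theorem Realization.rp_simRun (R : Realization τ C ecc SS verify recover) {A : Prog}
    (hA : A.IsOraclePPT) {e s x : Data → Data} (he : FP e) (hs : FP s) (hx : FP x) :
    RP fun z => (R.simRun A (e z) (s z) (x z)).map fun u => .pair u.1 u.2 := by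
  have hz := FP.id
  have hans : FP fun v => R.answer (.pair v.hd v.tl) := R.fp_answer.comp (hz.hd.pair hz.tl)
  have hflag : FPB fun v => R.forges (.pair v.hd v.tl) := R.fpb_forges.comp (hz.hd.pair hz.tl)
  have h := RP.lexec (ans := fun e y => R.answer (.pair e y))
    (flag := fun e y => R.forges (.pair e y)) hA hans hflag
  have h' := h.comp ((he.pair hs).pair hx)
  simp only [Data.hd_pair, Data.tl_pair] at h'
  exact h'

theorem exists_rp_keyTable (R : Realization τ C ecc SS verify recover)
    (hgen : PolyTime (α := fun _ => Unit) (fun n _ => P.gen n)) :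
    ∃ F, RP F ∧ ∀ n, F (unary n) = (keyTable P (k n) (q n) n).map code := by
  obtain ⟨G, hG, hGP⟩ := hgen.exists_rp
  have hx := FP.id
  refine ⟨fun N => sampleList (sampleList (G (.pair N (.atom false))) (R.qF N).size (.atom false))
    (R.kF N).size (.atom false), ((hG.comp (hx.pair (FP.const _))).sampleList R.fp_q).sampleList
      R.fp_k, fun n => ?_⟩
  have h : G (.pair (unary n) (.atom false)) = (P.gen n).map code := hGP n ()
  have h₁ := sampleList_eq (P.gen n) (q n) []
  have h₂ := sampleList_eq (indep fun _ : Fin (q n) => P.gen n) (k n) []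
  simp only [List.append_nil] at h₁ h₂
  simp only [h, R.q_eq, R.k_eq, size_unary]
  exact (congrArg (fun D => sampleList D (k n) (.atom false)) h₁).trans h₂

/-- The reduction to the security of the correlated scheme: the keys received are placed at the
positions of the codeword of a fresh verification key. -/
theorem exists_cpa_adversary (R : Realization τ C ecc SS verify recover)
    (hgen : PolyTime (α := fun _ => Unit) (fun n _ => P.gen n)) (hSS : SS.Efficient)
    {A₁ A₂ : Prog} (hA₁ : A₁.IsOraclePPT) (hA₂ : A₂.IsOraclePPT) :
    ∃ (B₁ B₂ : Prog) (state : ∀ n, (Fin (l n) → Fin (q n)) → Data →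
        (Fin (k n) → Fin (q n) → Data) → (Fin (k n) → Fin (q n) → Data) → Data → Data),
      B₁.IsPPT ∧ B₂.IsPPT ∧
      (∀ n (g : Fin (k n) → Data × Data), B₁.exec noOracle (code (n, fun i => (g i).1)) =
        (SS.gen n).bind fun s => (keyTable P (k n) (q n) n).bind fun key =>
          (R.simRun A₁ (environment (.atom false) n s.1
            (fun i a => (replace key (ecc n s.1) g i a).1) fun i a => (key i a).2) (.atom false)
              (code (n, fun i a => (replace key (ecc n s.1) g i a).1))).map fun w =>
            .pair w.2.hd (.pair w.2.tl.hd (state n s.1 s.2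
              (fun i a => (replace key (ecc n s.1) g i a).1) (fun i a => (key i a).2) w.2.tl.tl))) ∧
      ∀ n (v : Fin (l n) → Fin (q n)) (dsk : Data) (pk sk : Fin (k n) → Fin (q n) → Data) (st : Data)
        (c : Fin (k n) → Data), B₂.exec noOracle (code (n, (c, state n v dsk pk sk st))) =
        (SS.sign n dsk c).bind fun σ =>
          (R.simRun A₂ (environment (code (c, (v, σ))) n v pk sk) (.atom false)
            (code (n, ((c, (v, σ)), st)))).map Prod.snd := by
  obtain ⟨T, hT, hTeq⟩ := exists_rp_keyTable R hgen
  obtain ⟨G, hG, hGeq⟩ := hSS.1.exists_rp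
  obtain ⟨S, hS, hSeq⟩ := hSS.2.1.exists_rp
  have hx := FP.id
  have hN := hx.hd
  -- The argument is `((x, s), t)`: `x` the security parameter with the received public keys, `s`
  -- the fresh signature key pair, `t` a self-generated key table. A received key is used at letter
  -- `j` exactly if `j` is the letter of the codeword.
  let pkF : Data → Data := fun z => tabulate (fun i => tabulate (fun j =>
    bif (nth (R.eccF (.pair z.hd.hd.hd z.hd.tl.hd)) i).eqb j then nth z.hd.hd.tl i
      else (nth (nth z.tl i) j).hd) (R.qF z.hd.hd.hd)) (R.kF z.hd.hd.hd)
  -- All secret keys come from the self-generated table. At the codeword positions they do not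
  -- belong to the planted public keys, which `answer_environment` tolerates.
  let skF : Data → Data := fun z => tabulate (fun i => tabulate (fun j =>
    (nth (nth z.tl i) j).tl) (R.qF z.hd.hd.hd)) (R.kF z.hd.hd.hd)
  have hpkF : FP pkF := by
    refine .tabulate (g := fun z i => tabulate (fun j =>
      bif (nth (R.eccF (.pair z.hd.hd.hd z.hd.tl.hd)) i).eqb j then nth z.hd.hd.tl i
        else (nth (nth z.tl i) j).hd) (R.qF z.hd.hd.hd)) ?_ (R.fp_k.comp hx.hd.hd.hd)
    have hz := hx.hd.hd
    exact .tabulate (g := fun w j =>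
      bif (nth (R.eccF (.pair w.hd.hd.hd.hd w.hd.hd.tl.hd)) w.tl).eqb j then nth w.hd.hd.hd.tl w.tl
        else (nth (nth w.hd.tl w.tl) j).hd)
      (.cond (.eqb ((R.fp_ecc.comp (hz.hd.hd.hd.pair hz.hd.tl.hd)).nth hx.hd.tl) hx.tl)
        (hz.hd.hd.tl.nth hx.hd.tl) ((hz.tl.nth hx.hd.tl).nth hx.tl).hd)
      (R.fp_q.comp hx.hd.hd.hd.hd)
  have hskF : FP skF := by
    refine .tabulate (g := fun z i => tabulate (fun j =>
      (nth (nth z.tl i) j).tl) (R.qF z.hd.hd.hd)) ?_ (R.fp_k.comp hx.hd.hd.hd)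
    exact .tabulate (g := fun w j => (nth (nth w.hd.tl w.tl) j).tl)
      ((hx.hd.hd.tl.nth hx.hd.tl).nth hx.tl).tl (R.fp_q.comp hx.hd.hd.hd.hd)
  have hsetup : RP fun x => (G (.pair x.hd (.atom false))).bind fun s => (T x.hd).map fun t =>
      .pair s.tl (.pair x.hd (.pair s.hd (.pair (pkF (.pair (.pair x s) t))
        (skF (.pair (.pair x s) t))))) :=
    (hG.comp (hx.hd.pair (FP.const _))).bind
      (g := fun x s => (T x.hd).map fun t => .pair s.tl (.pair x.hd (.pair s.hd
        (.pair (pkF (.pair (.pair x s) t)) (skF (.pair (.pair x s) t))))))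
      ((hT.comp hx.hd.hd).map (g := fun z t => .pair z.tl.tl (.pair z.hd.hd (.pair z.tl.hd
        (.pair (pkF (.pair (.pair z.hd z.tl) t)) (skF (.pair (.pair z.hd z.tl) t))))))
        (hx.hd.tl.tl.pair (hx.hd.hd.hd.pair (hx.hd.tl.hd.pair
          ((hpkF.comp ((hx.hd.hd.pair hx.hd.tl).pair hx.tl)).pair
            (hskF.comp ((hx.hd.hd.pair hx.hd.tl).pair hx.tl)))))))
  -- Here `b` consists of the signing key followed by the environment without its challenge
  -- component. It is kept in the state, and the second stage completes it with the signed
  -- challenge.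
  obtain ⟨B₁, hB₁, hB₁eq⟩ := hsetup.bind
    (g := fun x b => ((R.simRun A₁ (.pair (.atom false) b.tl) (.atom false)
      (.pair x.hd b.tl.tl.tl.hd)).map fun u => .pair u.1 u.2).map fun w : Data =>
        Data.pair w.tl.hd (.pair w.tl.tl.hd (.pair b w.tl.tl.tl)))
    ((R.rp_simRun hA₁ ((FP.const _).pair hx.tl.tl) (FP.const _) (hx.hd.hd.pair hx.tl.tl.tl.tl.hd)).map
      (g := fun z w => .pair w.tl.hd (.pair w.tl.tl.hd (.pair z.tl w.tl.tl.tl)))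
      (hx.tl.tl.hd.pair (hx.tl.tl.tl.hd.pair (hx.hd.tl.pair hx.tl.tl.tl.tl))))
  obtain ⟨B₂, hB₂, hB₂eq⟩ := (hS.comp (f := fun x => .pair x.hd (.pair x.tl.tl.hd.hd x.tl.hd))
      (hx.hd.pair (hx.tl.tl.hd.hd.pair hx.tl.hd))).bind
    (g := fun x σ => ((R.simRun A₂ (.pair (.pair x.tl.hd (.pair x.tl.tl.hd.tl.tl.hd σ)) x.tl.tl.hd.tl)
      (.atom false) (.pair x.hd (.pair (.pair x.tl.hd (.pair x.tl.tl.hd.tl.tl.hd σ)) x.tl.tl.tl))).map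
        fun u => .pair u.1 u.2).map Data.tl)
    ((R.rp_simRun hA₂
      ((hx.hd.tl.hd.pair (hx.hd.tl.tl.hd.tl.tl.hd.pair hx.tl)).pair hx.hd.tl.tl.hd.tl) (FP.const _)
      (hx.hd.hd.pair ((hx.hd.tl.hd.pair (hx.hd.tl.tl.hd.tl.tl.hd.pair hx.tl)).pair
        hx.hd.tl.tl.tl))).map (g := fun _ w => w.tl) hx.tl.tl)
  refine ⟨B₁, B₂, fun n v dsk pk sk st => .pair (.pair dsk (.pair (unary n) (.pair (code v)
    (.pair (code pk) (code sk))))) st, hB₁, hB₂, fun n g => ?_, fun n v dsk pk sk st c => ?_⟩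
  · rw [hB₁eq]
    have hc : code (n, fun i => (g i).1) = .pair (unary n) (code fun i => (g i).1) := rfl
    have hG' : G (.pair (unary n) (.atom false)) = (SS.gen n).map code := hGeq n ()
    simp only [hc, Data.hd_pair, hG', hTeq, PMF.bind_map, PMF.bind_bind, PMF.map_comp]
    congr 1
    funext s
    simp only [Function.comp_apply, PMF.bind_map]
    congr 1
    funext key
    have hs : code s = .pair (code s.1) s.2 := rfl
    have hpk : pkF (.pair (.pair (.pair (unary n) (code fun i => (g i).1)) (code s)) (code key)) =
        code fun i a => (replace key (ecc n s.1) g i a).1 := by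
      simp only [pkF, hs, Data.hd_pair, Data.tl_pair, R.ecc_eq, R.k_eq, R.q_eq]
      refine tabulate_eq_code fun i => tabulate_eq_code fun j => ?_
      simp only [nth_code]
      rw [replace, Function.update_apply]
      by_cases hij : j = ecc n s.1 i
      · rw [if_pos hij, (Data.eqb_iff _ _).2 (by rw [hij]; rfl)]
        rfl
      · rw [if_neg hij, show (code (ecc n s.1 i)).eqb (unary j) = false from
          Bool.eq_false_iff.2 fun h => hij (code_injective ((Data.eqb_iff _ _).1 h)).symm]
        simp only [cond_false]
        rfl
    have hsk : skF (.pair (.pair (.pair (unary n) (code fun i => (g i).1)) (code s)) (code key)) =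
        code fun i a => (key i a).2 := by
      simp only [skF, Data.hd_pair, Data.tl_pair, R.k_eq, R.q_eq]
      refine tabulate_eq_code fun i => tabulate_eq_code fun j => ?_
      simp only [nth_code]
      rfl
    simp only [Function.comp_apply, hpk, hsk]
    simp only [hs, Data.hd_pair, Data.tl_pair]
    rfl
  · rw [hB₂eq]
    have hc : code (n, (c, Data.pair (.pair dsk (.pair (unary n) (.pair (code v)
      (.pair (code pk) (code sk))))) st)) = .pair (unary n) (.pair (code c) (.pair (.pair dsk
        (.pair (unary n) (.pair (code v) (.pair (code pk) (code sk))))) st)) := rfl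
    have hS' : S (.pair (unary n) (.pair dsk (code c))) = (SS.sign n dsk c).map code := hSeq n (dsk, c)
    simp only [hc, Data.hd_pair, Data.tl_pair, hS', PMF.bind_map, PMF.map_comp]
    rfl

end Adversaries

section Forger

variable {k l q τ : ℕ → ℕ} {P : BasePKE} {C : CorrelatedEncoding P k}
  {ecc : ∀ n, (Fin (l n) → Fin (q n)) → (Fin (k n) → Fin (q n))}
  {SS : SigScheme (fun n => Fin (l n) → Fin (q n)) (fun n => Fin (k n) → Data)}
  {verify : ∀ n, (Fin (k n) → Data) → (Fin (k n) → Data) → (Fin (k n) → Option Data) → Bool}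
  {recover : ∀ n, (Fin (k n) → Option Data) → (Fin (k n) → Data)}

/-- Whether the log of a run contains a flagged query. -/
def flagged (s : Data) : Bool :=
  !s.eqb (.atom false)

/-- A tuple that differs from `c`, unless both are empty. -/
def alter {m : ℕ} (c : Fin m → Data) : Fin m → Data :=
  fun i => .pair (c i) (.atom false)

/-- The reduction to the unforgeability of the signature scheme: the reduction simulates the
attack with a given verification key and outputs the flagged query. If a query was flagged in the
first stage already, it asks for the signature of another ciphertext than that in the query. -/
theorem exists_forger (R : Realization τ C ecc SS verify recover)
    (hgen : PolyTime (α := fun _ => Unit) (fun n _ => P.gen n))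
    (henc : PolyTime (α := fun n => (Fin (k n) → Data) × Data)
      (fun n u => (corPKE P C).enc n u.1 u.2))
    {A₁ A₂ : Prog} (hA₁ : A₁.IsOraclePPT) (hA₂ : A₂.IsOraclePPT) :
    ∃ (F₁ F₂ : Prog) (state : ∀ n, (Fin (l n) → Fin (q n)) →
        (Fin (k n) → Fin (q n) → Data) → (Fin (k n) → Fin (q n) → Data) → Data → Data → Data)
      (other : ℕ → Data → Data),
      F₁.IsPPT ∧ F₂.IsPPT ∧
      (∀ n (c : Fin (k n) → Data) (y : Data),
        other n (.pair (.atom true) (.pair (code c) y)) = code (alter c)) ∧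
      (∀ n (v : Fin (l n) → Fin (q n)), F₁.exec noOracle (code (n, v)) =
        (keyTable P (k n) (q n) n).bind fun key =>
          (R.simRun A₁ (environment (.atom false) n v (fun i a => (key i a).1)
            fun i a => (key i a).2) (.atom false) (code (n, fun i a => (key i a).1))).bind fun w =>
          (if flagged w.1 = true then PMF.pure (other n w.1) else fairCoin.bind fun b =>
            ((corPKE P C).enc n (select (fun i a => (key i a).1) (ecc n v))
              (if b = true then w.2.tl.hd else w.2.hd)).map code).map fun m =>
            .pair m (state n v (fun i a => (key i a).1) (fun i a => (key i a).2) w.1 w.2.tl.tl)) ∧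
      ∀ n (v : Fin (l n) → Fin (q n)) (pk sk : Fin (k n) → Fin (q n) → Data) (s st : Data)
        (c : Fin (k n) → Data) (σ : Data),
        F₂.exec noOracle (code (n, (c, (σ, state n v pk sk s st)))) =
        (R.simRun A₂ (environment (code (c, (v, σ))) n v pk sk) s
          (code (n, ((c, (v, σ)), st)))).map fun u => .pair u.1.tl.hd u.1.tl.tl.tl := by
  obtain ⟨T, hT, hTeq⟩ := exists_rp_keyTable R hgen
  obtain ⟨E, hE, hEeq⟩ := henc.exists_rp
  have hx := FP.id
  let projF (g : Data → Data) : Data → Data := fun z => tabulate (fun i => tabulate (fun j =>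
    g (nth (nth z.tl i) j)) (R.qF z.hd)) (R.kF z.hd)
  have hprojF : ∀ {g}, FP g → FP (projF g) := by
    intro g hg
    refine .tabulate (g := fun z i => tabulate (fun j => g (nth (nth z.tl i) j)) (R.qF z.hd)) ?_
      (R.fp_k.comp hx.hd)
    exact .tabulate (g := fun w j => g (nth (nth w.hd.tl w.tl) j))
      (hg.comp ((hx.hd.hd.tl.nth hx.hd.tl).nth hx.tl)) (R.fp_q.comp hx.hd.hd)
  let selF : Data → Data := fun z => tabulate (fun i => nth (nth z.tl.tl.hd i)
    (nth (R.eccF (.pair z.hd z.tl.hd)) i)) (R.kF z.hd)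
  have hselF : FP selF := .tabulate (g := fun z i => nth (nth z.tl.tl.hd i)
    (nth (R.eccF (.pair z.hd z.tl.hd)) i)) ((hx.hd.tl.tl.hd.nth hx.tl).nth
      ((R.fp_ecc.comp (hx.hd.hd.pair hx.hd.tl.hd)).nth hx.tl)) (R.fp_k.comp hx.hd)
  -- The argument is `(1^n, log)` with log `(1, (c, (v, σ)))`, so `z.tl.tl.hd` is the inner
  -- ciphertext `c` of the flagged query.
  let otherF : Data → Data := fun z => tabulate (fun i => .pair (nth z.tl.tl.hd i) (.atom false))
    (R.kF z.hd)
  have hotherF : FP otherF := .tabulate (g := fun z i => .pair (nth z.tl.tl.hd i) (.atom false))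
    ((hx.hd.tl.tl.hd.nth hx.tl).pair (FP.const _)) (R.fp_k.comp hx.hd)
  have hsetup : RP fun x => (T x.hd).map fun t => .pair x.hd (.pair x.tl
      (.pair (projF Data.hd (.pair x.hd t)) (projF Data.tl (.pair x.hd t)))) :=
    (hT.comp hx.hd).map (g := fun x t => .pair x.hd (.pair x.tl
      (.pair (projF Data.hd (.pair x.hd t)) (projF Data.tl (.pair x.hd t)))))
      (hx.hd.hd.pair (hx.hd.tl.pair (.pair ((hprojF hx.hd).comp (hx.hd.hd.pair hx.tl))
        ((hprojF hx.tl).comp (hx.hd.hd.pair hx.tl)))))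
  have hmsg : RP fun z => if flagged z.tl.hd = true then PMF.pure (otherF (.pair z.hd.hd z.tl.hd))
      else (fairCoin.map Data.atom).bind fun b => E (.pair z.hd.hd (.pair (selF z.hd)
        (if b.isOne = true then z.tl.tl.tl.hd else z.tl.tl.hd))) :=
    .ite (.not (.eqb hx.tl.hd (FP.const _))) (.pure (hotherF.comp (hx.hd.hd.pair hx.tl.hd)))
      (.bind (g := fun z b => E (.pair z.hd.hd (.pair (selF z.hd)
        (if b.isOne = true then z.tl.tl.tl.hd else z.tl.tl.hd)))) .coin
        (hE.comp (hx.hd.hd.hd.pair ((hselF.comp hx.hd.hd).pair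
          (.ite (.isOne hx.tl) hx.hd.tl.tl.tl.hd hx.hd.tl.tl.hd)))))
  obtain ⟨F₁, hF₁, hF₁eq⟩ := hsetup.bind
    (g := fun x b => ((R.simRun A₁ (.pair (.atom false) b) (.atom false)
      (.pair x.hd b.tl.tl.hd)).map fun u => .pair u.1 u.2).bind fun w : Data =>
        (if flagged w.hd = true then PMF.pure (otherF (.pair b.hd w.hd))
          else (fairCoin.map Data.atom).bind fun c => E (.pair b.hd (.pair (selF b)
            (if c.isOne = true then w.tl.tl.hd else w.tl.hd)))).map fun m =>
        Data.pair m (.pair b (.pair w.hd w.tl.tl.tl)))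
    ((R.rp_simRun hA₁ ((FP.const _).pair hx.tl) (FP.const _) (hx.hd.hd.pair hx.tl.tl.tl.hd)).bind
      (g := fun z w => (if flagged w.hd = true then PMF.pure (otherF (.pair z.tl.hd w.hd))
          else (fairCoin.map Data.atom).bind fun c => E (.pair z.tl.hd (.pair (selF z.tl)
            (if c.isOne = true then w.tl.tl.hd else w.tl.hd)))).map fun m =>
        Data.pair m (.pair z.tl (.pair w.hd w.tl.tl.tl)))
      ((hmsg.comp (hx.hd.tl.pair hx.tl)).map
        (g := fun y m => Data.pair m (.pair y.hd.tl (.pair y.tl.hd y.tl.tl.tl.tl)))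
        (hx.tl.pair (hx.hd.hd.tl.pair (hx.hd.tl.hd.pair hx.hd.tl.tl.tl.tl)))))
  -- The run resumes with the log of the first stage, kept in the state. The output reads the pair
  -- `(c, σ)` off a log `(1, (c, (v, σ)))`.
  obtain ⟨F₂, hF₂, hF₂eq⟩ := (R.rp_simRun hA₂
      (e := fun x => .pair (.pair x.tl.hd (.pair x.tl.tl.tl.hd.tl.hd x.tl.tl.hd)) x.tl.tl.tl.hd)
      (s := fun x => x.tl.tl.tl.tl.hd)
      (x := fun x => .pair x.hd (.pair (.pair x.tl.hd (.pair x.tl.tl.tl.hd.tl.hd x.tl.tl.hd))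
        x.tl.tl.tl.tl.tl))
      ((hx.tl.hd.pair (hx.tl.tl.tl.hd.tl.hd.pair hx.tl.tl.hd)).pair hx.tl.tl.tl.hd)
      hx.tl.tl.tl.tl.hd
      (hx.hd.pair ((hx.tl.hd.pair (hx.tl.tl.tl.hd.tl.hd.pair hx.tl.tl.hd)).pair
        hx.tl.tl.tl.tl.tl))).map (g := fun _ w => .pair w.hd.tl.hd w.hd.tl.tl.tl)
      (hx.tl.hd.tl.hd.pair hx.tl.hd.tl.tl.tl)
  refine ⟨F₁, F₂, fun n v pk sk s st => .pair (.pair (unary n) (.pair (code v)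
    (.pair (code pk) (code sk)))) (.pair s st), fun n s => otherF (.pair (unary n) s),
    hF₁, hF₂, fun n c y => ?_, fun n v => ?_, fun n v pk sk s st c σ => ?_⟩
  · simp only [otherF, Data.hd_pair, Data.tl_pair, R.k_eq]
    refine tabulate_eq_code fun i => ?_
    rw [nth_code]
    rfl
  · rw [hF₁eq]
    have hc : code (n, v) = .pair (unary n) (code v) := rfl
    simp only [hc, Data.hd_pair, Data.tl_pair, hTeq, PMF.bind_map, PMF.map_comp]
    congr 1
    funext key
    have hproj : ∀ g : Data → Data, projF g (.pair (unary n) (code key)) =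
        tabulate (fun i => tabulate (fun j => g (nth (nth (code key) i) j)) (unary (q n)))
          (unary (k n)) := fun g => by
      simp only [projF, Data.hd_pair, Data.tl_pair, R.k_eq, R.q_eq]
    have hpk : projF Data.hd (.pair (unary n) (code key)) = code fun i a => (key i a).1 := by
      rw [hproj]
      refine tabulate_eq_code fun i => tabulate_eq_code fun j => ?_
      simp only [nth_code]
      rfl
    have hsk : projF Data.tl (.pair (unary n) (code key)) = code fun i a => (key i a).2 := by
      rw [hproj]
      refine tabulate_eq_code fun i => tabulate_eq_code fun j => ?_
      simp only [nth_code]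
      rfl
    simp only [Function.comp_apply, hpk, hsk, Data.hd_pair, Data.tl_pair]
    have hsel : selF (.pair (unary n) (.pair (code v) (.pair (code fun i a => (key i a).1)
        (code fun i a => (key i a).2)))) = code (select (fun i a => (key i a).1) (ecc n v)) := by
      simp only [selF, Data.hd_pair, Data.tl_pair, R.k_eq, R.ecc_eq]
      refine tabulate_eq_code fun i => ?_
      simp only [nth_code]
      exact nth_code (fun a => (key i a).1) _
    rw [hsel]
    congr 1
    funext w
    simp only [Function.comp_apply, Data.hd_pair, Data.tl_pair]
    congr 2
    congr 1
    funext b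
    exact hEeq n (_, _)
  · exact (hF₂eq _).trans (PMF.map_comp _ _ _)

end Forger

/-! ## The attack with rejection of all ciphertexts with the verification key of the challenge -/

section Hybrid

variable {k l q τ : ℕ → ℕ} {P : BasePKE} {C : CorrelatedEncoding P k}
  {ecc : ∀ n, (Fin (l n) → Fin (q n)) → (Fin (k n) → Fin (q n))}
  {SS : SigScheme (fun n => Fin (l n) → Fin (q n)) (fun n => Fin (k n) → Data)}
  {verify : ∀ n, (Fin (k n) → Data) → (Fin (k n) → Data) → (Fin (k n) → Option Data) → Bool}
  {recover : ∀ n, (Fin (k n) → Option Data) → (Fin (k n) → Data)}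

theorem Realization.simRun_environment (R : Realization τ C ecc SS verify recover) (A : Prog)
    (chal : Data) (n : ℕ) (v : Fin (l n) → Fin (q n))
    (pk sk sk' : Fin (k n) → Fin (q n) → Data)
    (hkeys : ∀ i a, (pk i a, sk i a) ∈ (P.gen n).support)
    (hsk : ∀ i a, a ≠ ecc n v i → sk' i a = sk i a) (s x : Data) :
    R.simRun A (environment chal n v pk sk') s x =
      lexec (Realization.rejectOracle C ecc SS n sk v)
        (fun y => R.forges (.pair (environment chal n v pk sk) y)) A (s, x) := by
  rw [simRun]
  congr 1
  exact funext fun y => R.answer_environment chal n v pk sk sk' hkeys hsk y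

open Classical in
/-- The attack, for given keys, with simulated decryption oracle; together with the result, the
log of the simulation is returned. -/
noncomputable def Realization.hybridRun (R : Realization τ C ecc SS verify recover) (A₁ A₂ : Prog)
    (n : ℕ) (s : (Fin (l n) → Fin (q n)) × Data) (pk sk : Fin (k n) → Fin (q n) → Data) :
    PMF (Data × Bool) :=
  (R.simRun A₁ (environment (.atom false) n s.1 pk sk) (.atom false) (code (n, pk))).bind fun w =>
  if w.2.hd ∈ C.Msg n ∧ w.2.tl.hd ∈ C.Msg n ∧ w.2.hd.size = w.2.tl.hd.size then
    fairCoin.bind fun b =>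
    ((corPKE P C).enc n (select pk (ecc n s.1)) (if b = true then w.2.tl.hd else w.2.hd)).bind
      fun c => (SS.sign n s.2 c).bind fun σ =>
    (R.simRun A₂ (environment (code (c, (s.1, σ))) n s.1 pk sk) w.1
      (code (n, ((c, (s.1, σ)), w.2.tl.tl)))).map fun u => (u.1, decide (b = u.2.isOne))
  else fairCoin.map fun b => (w.1, b)

/-- The attack with simulated decryption oracle. -/
noncomputable def Realization.hybrid (R : Realization τ C ecc SS verify recover) (A₁ A₂ : Prog)
    (n : ℕ) : PMF (Data × Bool) :=
  (SS.gen n).bind fun s => (keyTable P (k n) (q n) n).bind fun key =>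
    R.hybridRun A₁ A₂ n s (fun i a => (key i a).1) fun i a => (key i a).2

theorem mem_support_keyTable {k q n : ℕ} {key : Fin k → Fin q → Data × Data} :
    key ∈ (keyTable P k q n).support ↔ ∀ i a, key i a ∈ (P.gen n).support := by
  simp only [keyTable, mem_support_indep]

/-- Drawing the entries at the positions of a codeword again does not change the distribution of
the table. -/
theorem keyTable_replace {k q n : ℕ} (d : Fin k → Fin q) :
    ((indep fun _ : Fin k => P.gen n).bind fun g =>
      (keyTable P k q n).map fun key => replace key d g) = keyTable P k q n := by
  have h : ∀ key : Fin k → Fin q → Data × Data,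
      ((indep fun _ : Fin k => P.gen n).map fun g => replace key d g) =
        indep fun i => (P.gen n).map fun x => Function.update (key i) (d i) x := fun key =>
    indep_map _ fun i x => Function.update (key i) (d i) x
  calc _ = (keyTable P k q n).bind fun key =>
        (indep fun _ : Fin k => P.gen n).map fun g => replace key d g :=
      PMF.bind_comm _ _ fun g key => PMF.pure (replace key d g)
    _ = _ := by
      simp only [h]
      refine (indep_bind _ fun i (f : Fin q → Data × Data) =>
        (P.gen n).map fun x => Function.update f (d i) x).trans ?_
      rw [keyTable]
      congr 1
      funext i
      exact indep_resample (fun _ : Fin q => P.gen n) (d i)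

/-- No answer depends on the secret keys at the codeword positions, so unrelated ones may stand
there, as they do in the reduction to the correlated scheme. -/
theorem map_snd_hybridRun (R : Realization τ C ecc SS verify recover) (A₁ A₂ : Prog)
    (n : ℕ) (s : (Fin (l n) → Fin (q n)) × Data) (pk sk sk' : Fin (k n) → Fin (q n) → Data)
    (hkeys : ∀ i a, (pk i a, sk i a) ∈ (P.gen n).support)
    (hsk : ∀ i a, a ≠ ecc n s.1 i → sk' i a = sk i a) :
    (R.hybridRun A₁ A₂ n s pk sk).map Prod.snd = (R.hybridRun A₁ A₂ n s pk sk').map Prod.snd := by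
  have h : ∀ A chal t x, R.simRun A (environment chal n s.1 pk sk') t x =
      R.simRun A (environment chal n s.1 pk sk) t x := fun A chal t x =>
    (R.simRun_environment A chal n s.1 pk sk sk' hkeys hsk t x).trans
      (R.simRun_environment A chal n s.1 pk sk sk hkeys (fun _ _ _ => rfl) t x).symm
  simp only [Realization.hybridRun, h]

open Classical in
-- The simulated attack is literally a chosen-plaintext attack on the correlated scheme: the
-- challenge keys sit at the codeword positions, and the reduction signs the challenge ciphertext
-- itself. No loss occurs.
theorem map_snd_hybrid (R : Realization τ C ecc SS verify recover)
    (hgen : PolyTime (α := fun _ => Unit) (fun n _ => P.gen n)) (hSS : SS.Efficient)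
    {A₁ A₂ : Prog} (hA₁ : A₁.IsOraclePPT) (hA₂ : A₂.IsOraclePPT) :
    ∃ B₁ B₂ : Prog, B₁.IsPPT ∧ B₂.IsPPT ∧ ∀ n,
      (R.hybrid A₁ A₂ n).map Prod.snd = (corPKE P C).cpaExp B₁ B₂ n := by
  obtain ⟨B₁, B₂, state, hB₁, hB₂, hB₁eq, hB₂eq⟩ := exists_cpa_adversary R hgen hSS hA₁ hA₂
  refine ⟨B₁, B₂, hB₁, hB₂, fun n => ?_⟩
  have hgenC : (corPKE P C).gen n = (indep fun _ : Fin (k n) => P.gen n).map fun key =>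
    (fun i => (key i).1, fun i => (key i).2) := rfl
  rw [PKE.cpaExp, PKE.indExp, hgenC, PMF.bind_map]
  simp only [Function.comp_def, hB₁eq, PMF.bind_bind, PMF.bind_map, Data.hd_pair, Data.tl_pair,
    hB₂eq, PMF.map_bind, PMF.map_comp]
  rw [PMF.bind_comm, Realization.hybrid, PMF.map_bind]
  congr 1
  funext s
  -- The key table of the attack is viewed as an own table into which the keys of the CPA experiment
  -- have been planted.
  conv_lhs => rw [← keyTable_replace (ecc n s.1)]
  simp only [PMF.map_bind, PMF.bind_bind, PMF.bind_map]
  refine PMF.bind_congr fun g hg => PMF.bind_congr fun key hkey => ?_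
  rw [mem_support_keyTable] at hkey
  rw [mem_support_indep] at hg
  rw [Function.comp_apply, map_snd_hybridRun R A₁ A₂ n s _ _ (fun i a => (key i a).2)]
  · simp only [Realization.hybridRun, PMF.map_bind]
    congr 1
    funext w
    have hMsg : (corPKE P C).Msg n (fun i => (g i).1) = C.Msg n := rfl
    have hsel : select (fun i a => (replace key (ecc n s.1) g i a).1) (ecc n s.1) =
        fun i => (g i).1 := by
      funext i
      simp [select, replace]
    rw [hMsg, apply_ite (PMF.map Prod.snd)]
    congr 1
    · simp only [PMF.map_bind, PMF.map_comp, hsel]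
      congr 1; funext b
      congr 1; funext c
      congr 1; funext σ
      -- The CPA adversary restarts its second stage with an empty log, whereas `hybridRun`
      -- continues the old one. The output is the same in distribution, since it does not depend on
      -- the log.
      have h₁ := map_snd_lexec
        (fun y => R.answer (.pair (environment (code (c, (s.1, σ))) n s.1
          (fun i a => (replace key (ecc n s.1) g i a).1) fun i a => (key i a).2) y))
        (fun y => R.forges (.pair (environment (code (c, (s.1, σ))) n s.1
          (fun i a => (replace key (ecc n s.1) g i a).1) fun i a => (key i a).2) y)) A₂
      have h₂ := (h₁ (w.1, code (n, ((c, (s.1, σ)), w.2.tl.tl)))).trans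
        (h₁ (.atom false, code (n, ((c, (s.1, σ)), w.2.tl.tl)))).symm
      have h₃ := congrArg (PMF.map fun y => decide (b = y.isOne)) h₂
      simp only [PMF.map_comp] at h₃
      exact h₃
    · rw [PMF.map_comp]
      exact PMF.map_id _
  · intro i a
    by_cases ha : a = ecc n s.1 i
    · subst ha; simpa [replace] using hg i
    · simpa [replace, ha] using hkey i a
  · intro i a ha
    simp [replace, ha]

theorem unflaggedLE_simRun (R : Realization τ C ecc SS verify recover) (A : Prog)
    (chal : Data) (n : ℕ) (v : Fin (l n) → Fin (q n)) (pk sk : Fin (k n) → Fin (q n) → Data)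
    (hkeys : ∀ i a, (pk i a, sk i a) ∈ (P.gen n).support) {O : Data → Data}
    (hO : ∀ y, R.forges (.pair (environment chal n v pk sk) y) = false →
      Realization.rejectOracle C ecc SS n sk v y = O y) (x : Data) :
    UnflaggedLE (R.simRun A (environment chal n v pk sk) (.atom false) x) (A.exec O x) := by
  rw [R.simRun_environment A chal n v pk sk sk hkeys (fun _ _ _ => rfl)]
  exact unflaggedLE_lexec hO A x

/-- An unflagged ciphertext under `v` other than the challenge has an invalid signature, so the true
oracle rejects it too. With any other verification key the two oracles agree by definition. -/
theorem rejectOracle_eq_decOracle (R : Realization τ C ecc SS verify recover) {chal : Data} {n : ℕ}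
    {v : Fin (l n) → Fin (q n)} {pk sk : Fin (k n) → Fin (q n) → Data} {y : Data}
    (hy : R.forges (.pair (environment chal n v pk sk) y) = false)
    (hchal : ∀ c : (Fin (k n) → Data) × ((Fin (l n) → Fin (q n)) × Data), y = code c → y ≠ chal) :
    Realization.rejectOracle C ecc SS n sk v y = (ccaPKE P C ecc SS).decOracle n sk y := by
  rw [Bool.eq_false_iff, Ne, R.forges_environment_iff] at hy
  rw [Realization.rejectOracle, PKE.decOracle]
  cases h : decode ((Fin (k n) → Data) × ((Fin (l n) → Fin (q n)) × Data)) y with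
  | none => rfl
  | some c =>
  rw [decode_eq_some_iff] at h
  simp only [Option.bind_some]
  split_ifs with hc
  · have : (ccaPKE P C ecc SS).dec n sk c = none := by
      refine if_neg fun hver => hy ⟨c.1, c.2.2, ?_, ?_, hchal c h⟩
      · rw [h, ← hc]
      · rw [← hc]; exact hver
    rw [this]
  · rfl

open Classical in
-- Real and simulated attack are identical until a query is flagged.
theorem unflaggedLE_hybrid (R : Realization τ C ecc SS verify recover) (A₁ A₂ : Prog) (n : ℕ) :
    UnflaggedLE (R.hybrid A₁ A₂ n) ((ccaPKE P C ecc SS).cca2Exp A₁ A₂ n) := by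
  -- The signature keys of the challenge are drawn independently of the keys and of the first stage,
  -- so the draw can be moved to the front.
  have hcca : (ccaPKE P C ecc SS).cca2Exp A₁ A₂ n =
      (SS.gen n).bind fun s => (keyTable P (k n) (q n) n).bind fun key =>
        (A₁.exec ((ccaPKE P C ecc SS).decOracle n fun i a => (key i a).2)
          (code (n, fun i a => (key i a).1))).bind fun x =>
        if x.hd ∈ C.Msg n ∧ x.tl.hd ∈ C.Msg n ∧ x.hd.size = x.tl.hd.size then
          fairCoin.bind fun b => ((corPKE P C).enc n (select (fun i a => (key i a).1) (ecc n s.1))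
            (if b = true then x.tl.hd else x.hd)).bind fun c => (SS.sign n s.2 c).bind fun σ =>
          (A₂.exec ((ccaPKE P C ecc SS).decOracleExcept n (fun i a => (key i a).2) (c, (s.1, σ)))
            (code (n, ((c, (s.1, σ)), x.tl.tl)))).map fun y => decide (b = y.isOne)
        else fairCoin := by
    have hgenC : (ccaPKE P C ecc SS).gen n = (keyTable P (k n) (q n) n).map fun key =>
      (fun i a => (key i a).1, fun i a => (key i a).2) := rfl
    rw [PKE.cca2Exp, PKE.indExp, hgenC, PMF.bind_map, PMF.bind_comm (SS.gen n)]
    congr 1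
    funext key
    rw [Function.comp_apply, PMF.bind_comm (SS.gen n)]
    congr 1
    funext x
    have hMsg : ∀ pk, (ccaPKE P C ecc SS).Msg n pk = C.Msg n := fun _ => rfl
    simp only [hMsg]
    by_cases hx : x.hd ∈ C.Msg n ∧ x.tl.hd ∈ C.Msg n ∧ x.hd.size = x.tl.hd.size
    · simp only [if_pos hx]
      rw [PMF.bind_comm (SS.gen n)]
      simp only [ccaPKE, PMF.bind_bind, PMF.bind_map]
      rfl
    · simp only [if_neg hx, PMF.bind_const]
  rw [hcca]
  refine .same_bind _ fun s _ => .same_bind _ fun key hkey => ?_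
  rw [mem_support_keyTable] at hkey
  refine (unflaggedLE_simRun R A₁ _ n s.1 _ _ hkey (fun y hy => ?_) _).bind (fun x => ?_)
    fun w hw u hu => ?_
  -- In the first stage the challenge component is an atom, which no ciphertext equals; so every
  -- correctly signed ciphertext under the challenge verification key is flagged.
  · refine rejectOracle_eq_decOracle R hy fun c hc => ?_
    rw [hc]
    exact Data.noConfusion
  · dsimp only
    split_ifs
    · refine .same_bind _ fun b _ => .same_bind _ fun c _ => .same_bind _ fun σ _ => ?_
      refine (unflaggedLE_simRun R A₂ _ n s.1 _ _ hkey (fun y hy => ?_) _).map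
        fun y => decide (b = y.isOne)
      rw [PKE.decOracleExcept]
      split_ifs with h
      -- The challenge itself is not flagged, but both oracles refuse it: one by the rule of the
      -- experiment, the other because of its verification key.
      · rw [h, Realization.rejectOracle, decode_code, Option.bind_some, if_pos rfl]
      · exact rejectOracle_eq_decOracle R hy fun _ _ => h
    · have := UnflaggedLE.same_bind fairCoin fun b _ => UnflaggedLE.pure (.atom false) b
      rwa [PMF.bind_pure] at this
  · split_ifs at hu
    · simp only [PMF.mem_support_bind_iff, PMF.mem_support_map_iff] at hu
      obtain ⟨b, -, c, -, σ, -, u, hu, rfl⟩ := hu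
      exact log_ne_of_mem_support_lexec (u := (w.1, code (n, ((c, (s.1, σ)), w.2.tl.tl)))) hw u hu
    · obtain ⟨b, -, rfl⟩ := (PMF.mem_support_map_iff _ _ _).1 hu
      exact hw

end Hybrid

/-! ### Flagged queries are forgeries -/

section Forgery

variable {k l q τ : ℕ → ℕ} {P : BasePKE} {C : CorrelatedEncoding P k}
  {ecc : ∀ n, (Fin (l n) → Fin (q n)) → (Fin (k n) → Fin (q n))}
  {SS : SigScheme (fun n => Fin (l n) → Fin (q n)) (fun n => Fin (k n) → Data)}
  {verify : ∀ n, (Fin (k n) → Data) → (Fin (k n) → Data) → (Fin (k n) → Option Data) → Bool}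
  {recover : ∀ n, (Fin (k n) → Option Data) → (Fin (k n) → Data)}

theorem PMF.apply_eq_one_of_forall_mem {α : Type} {p : PMF α} {a : α}
    (h : ∀ x ∈ p.support, x = a) : p a = 1 := by
  rw [PMF.apply_eq_one_iff]
  refine Set.eq_singleton_iff_unique_mem.2 ⟨?_, h⟩
  obtain ⟨x, hx⟩ := p.support_nonempty
  rwa [← h x hx]

theorem flagged_eq_false_iff {s : Data} : flagged s = false ↔ s = .atom false := by
  rw [flagged, Bool.not_eq_false', Data.eqb_iff]

theorem log_of_mem_support_simRun (R : Realization τ C ecc SS verify recover) {A : Prog}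
    {chal : Data} {n : ℕ} {v : Fin (l n) → Fin (q n)} {pk sk : Fin (k n) → Fin (q n) → Data}
    {I : Data → Prop} (hI : ∀ (c : Fin (k n) → Data) (σ : Data), SS.ver n v c σ = true →
      code (c, (v, σ)) ≠ chal → I (.pair (.atom true) (code (c, (v, σ)))))
    {s x : Data} (hs : I s) : ∀ u ∈ (R.simRun A (environment chal n v pk sk) s x).support, I u.1 := by
  refine log_of_mem_support_lexec (fun y hy => ?_) A (s, x) hs
  obtain ⟨c, σ, rfl, h₁, h₂⟩ := (R.forges_environment_iff chal n v pk sk y).1 hy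
  exact hI c σ h₁ h₂

/-- Each altered entry is longer by one node; at least one entry is needed. -/
theorem alter_ne {m : ℕ} (hm : 0 < m) (c : Fin m → Data) : c ≠ alter c := by
  intro h
  have := congrArg Data.size (congrFun h ⟨0, hm⟩)
  simp only [alter, Data.size] at this
  omega

open Classical in
-- The forger follows the simulated attack draw by draw up to the end of its first stage. From there
-- it either wins with certainty or continues the same attack, and a nonempty log at the end is a
-- winning output.
theorem flagged_hybrid_le (R : Realization τ C ecc SS verify recover)
    (hgen : PolyTime (α := fun _ => Unit) (fun n _ => P.gen n))
    (henc : PolyTime (α := fun n => (Fin (k n) → Data) × Data)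
      (fun n u => (corPKE P C).enc n u.1 u.2))
    {A₁ A₂ : Prog} (hA₁ : A₁.IsOraclePPT) (hA₂ : A₂.IsOraclePPT) :
    ∃ F₁ F₂ : Prog, F₁.IsPPT ∧ F₂.IsPPT ∧ ∀ n, 0 < k n →
      ((R.hybrid A₁ A₂ n).map fun u => flagged u.1) true ≤ SS.otsuExp F₁ F₂ n true := by
  obtain ⟨F₁, F₂, state, other, hF₁, hF₂, hother, hF₁eq, hF₂eq⟩ := exists_forger R hgen henc hA₁ hA₂
  refine ⟨F₁, F₂, hF₁, hF₂, fun n hn => ?_⟩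
  rw [SigScheme.otsuExp, Realization.hybrid, PMF.map_bind]
  refine PMF.bind_apply_le_bind_apply fun s _ => ?_
  rw [hF₁eq]
  simp only [PMF.map_bind, PMF.bind_bind, PMF.bind_map, Realization.hybridRun]
  refine PMF.bind_apply_le_bind_apply fun key _ => PMF.bind_apply_le_bind_apply fun w hw => ?_
  simp only [Function.comp_def, Data.hd_pair, Data.tl_pair]
  let Forged (m : Fin (k n) → Data) (σ t : Data) : Prop := ∃ c σ', t = .pair (.atom true)
    (code (c, (s.1, σ'))) ∧ SS.ver n s.1 c σ' = true ∧ (c, σ') ≠ (m, σ)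
  have hcode : ∀ (c : Fin (k n) → Data) (σ : Data), code (c, (s.1, σ)) =
    .pair (code c) (.pair (code s.1) σ) := fun _ _ => rfl
  have hforged : ∀ (m c : Fin (k n) → Data) (σ σ' : Data), SS.ver n s.1 c σ' = true →
      code (c, (s.1, σ')) ≠ code (m, (s.1, σ)) →
        Forged m σ (.pair (.atom true) (code (c, (s.1, σ')))) := fun m c σ σ' hver hne =>
    ⟨c, σ', rfl, hver, fun h => hne (by rw [Prod.mk.injEq] at h; rw [h.1, h.2])⟩
  cases hflag : flagged w.1 with
  | true =>
    have hlog := log_of_mem_support_simRun R (I := fun t => t = .atom false ∨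
      ∃ c σ, t = .pair (.atom true) (code (c, (s.1, σ))) ∧ SS.ver n s.1 c σ = true)
      (fun c σ h _ => .inr ⟨c, σ, rfl, h⟩) (.inl rfl) w hw
    obtain ⟨c, σ', hlog, hver⟩ := hlog.resolve_left fun h => by
      rw [flagged_eq_false_iff.2 h] at hflag
      cases hflag
    -- A query flagged in the first stage makes the forger win with certainty: the signature it
    -- obtains is on the altered tuple, so the logged pair is new. Should the log be overwritten
    -- later, the new entry differs from the signed pair as well.
    refine (PMF.coe_le_one _ _).trans (le_of_eq (Eq.symm ?_))
    simp only [if_true, PMF.pure_bind, hlog, hcode, hother, decode_code]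
    refine PMF.apply_eq_one_of_forall_mem fun y hy => ?_
    simp only [PMF.mem_support_bind_iff, hF₂eq, PMF.mem_support_map_iff] at hy
    obtain ⟨σ, -, _, ⟨u, hu, rfl⟩, rfl⟩ := hy
    obtain ⟨c', σ', h, hver', hne⟩ := log_of_mem_support_simRun R (I := Forged (alter c) σ)
      (fun c σ' => hforged _ c σ σ')
      ⟨c, σ', rfl, hver, fun h => alter_ne hn c (congrArg Prod.fst h)⟩ u hu
    simp only [h, hcode, Data.hd_pair, Data.tl_pair, decode_code, hver', Bool.true_and]
    exact decide_eq_true hne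
  | false =>
    simp only [Bool.false_eq_true, if_false]
    rw [flagged_eq_false_iff] at hflag
    split_ifs with hvalid
    · rw [PMF.map_bind, PMF.bind_bind]
      refine PMF.bind_apply_le_bind_apply fun b _ => ?_
      rw [PMF.map_bind, PMF.bind_map]
      refine PMF.bind_apply_le_bind_apply fun c _ => ?_
      simp only [Function.comp_apply, decode_code, hF₂eq]
      rw [PMF.map_bind]
      refine PMF.bind_apply_le_bind_apply fun σ _ => ?_
      rw [PMF.map_comp, PMF.map_comp, hflag]
      refine PMF.bind_apply_le_bind_apply fun u hu => ?_
      have hlog := log_of_mem_support_simRun R (I := fun t => t = .atom false ∨ Forged c σ t)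
        (fun c' σ' h h' => .inr (hforged c c' σ σ' h h')) (.inl rfl) u hu
      rcases hlog with h | ⟨c', σ', h, hver, hne⟩
      · simp [flagged_eq_false_iff.2 h]
      · refine (PMF.coe_le_one _ _).trans (le_of_eq ?_)
        simp only [Function.comp_apply, h, hcode, Data.hd_pair, Data.tl_pair, decode_code, hver,
          Bool.true_and]
        rw [PMF.pure_apply, if_pos (decide_eq_true hne).symm]
    -- For invalid messages the attack ends with an empty log, so the left side is zero. Hence the
    -- forger need not decide membership in the message space, which is not assumed to be efficient.
    · rw [PMF.map_comp, PMF.map_apply]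
      simp [flagged_eq_false_iff.2 hflag]

end Forgery

/-! ### From domination to advantages, and the degenerate case -/

theorem UnflaggedLE.map_snd_apply_le {α : Type} {μ : PMF (Data × α)} {ν : PMF α}
    (h : UnflaggedLE μ ν) (y : α) :
    (μ.map Prod.snd) y ≤ ν y + (μ.map fun u => flagged u.1) true := by
  classical
  refine le_trans ?_ (add_le_add_left (h y) _)
  rw [PMF.map_apply, PMF.map_apply, ← tsum_ite_eq ((.atom false, y) : Data × α) μ,
    ← ENNReal.tsum_add]
  refine ENNReal.tsum_le_tsum fun u => ?_
  rcases u with ⟨s, a⟩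
  cases hs : flagged s with
  | true => simp only [if_true]; refine le_trans ?_ le_add_self; split_ifs <;> simp
  | false =>
    rw [flagged_eq_false_iff] at hs
    subst hs
    by_cases ha : y = a <;> simp [ha]

theorem toReal_true_add_toReal_false (p : PMF Bool) : (p true).toReal + (p false).toReal = 1 := by
  have h := p.tsum_coe
  rw [tsum_bool, add_comm] at h
  rw [← ENNReal.toReal_add (p.apply_ne_top _) (p.apply_ne_top _), h, ENNReal.toReal_one]

/-- Domination gives a bound in one direction only, but for both bits; as the two probabilities add
up to one, the bound for `false` is the missing direction for `true`. -/
theorem UnflaggedLE.abs_sub_le {μ : PMF (Data × Bool)} {ν : PMF Bool} (h : UnflaggedLE μ ν) :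
    |(ν true).toReal - ((μ.map Prod.snd) true).toReal| ≤
      ((μ.map fun u => flagged u.1) true).toReal := by
  have h' : ∀ b, ((μ.map Prod.snd) b).toReal ≤
      (ν b).toReal + ((μ.map fun u => flagged u.1) true).toReal := fun b => by
    rw [← ENNReal.toReal_add (PMF.apply_ne_top _ _) (PMF.apply_ne_top _ _)]
    exact ENNReal.toReal_mono (ENNReal.add_ne_top.2 ⟨PMF.apply_ne_top _ _, PMF.apply_ne_top _ _⟩)
      (h.map_snd_apply_le b)
  have h₁ := toReal_true_add_toReal_false ν
  have h₂ := toReal_true_add_toReal_false (μ.map Prod.snd)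
  have h₃ := h' true
  have h₄ := h' false
  rw [abs_le]
  constructor <;> linarith

open Classical in
/-- Nothing can be distinguished if there is at most one message. -/
theorem PKE.indExp_of_subsingleton {PK SK Ctx : ℕ → Type} [∀ n, Coded (PK n)] [∀ n, Coded (SK n)]
    [∀ n, Coded (Ctx n)] (S : PKE PK SK Ctx) (A₁ A₂ : Prog) {n : ℕ} (O₁ : SK n → Data → Data)
    (O₂ : SK n → Ctx n → Data → Data) (h : ∀ pk, (S.Msg n pk).Subsingleton) :
    S.indExp A₁ A₂ n O₁ O₂ = fairCoin := by
  rw [indExp]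
  have hx : ∀ (key : PK n × SK n) (x : Data), (if x.hd ∈ S.Msg n key.1 ∧ x.tl.hd ∈ S.Msg n key.1 ∧
      x.hd.size = x.tl.hd.size then fairCoin.bind fun b =>
        (S.enc n key.1 (if b then x.tl.hd else x.hd)).bind fun c =>
        (A₂.exec (O₂ key.2 c) (code (n, (c, x.tl.tl)))).map fun y => decide (b = y.isOne)
      else fairCoin) = fairCoin := by
    intro key x
    split_ifs with hv
    · have he : ∀ b : Bool, (if b = true then x.tl.hd else x.hd) = x.hd := fun b => by
        rw [h _ hv.1 hv.2.1, ite_self]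
      simp only [he]
      rw [PMF.bind_comm]
      have hc : ∀ c, (fairCoin.bind fun b => (A₂.exec (O₂ key.2 c)
          (code (n, (c, x.tl.tl)))).map fun y => decide (b = y.isOne)) = fairCoin := fun c => by
        have := PMF.bind_comm fairCoin (A₂.exec (O₂ key.2 c) (code (n, (c, x.tl.tl))))
          fun b y => PMF.pure (decide (b = y.isOne))
        refine this.trans ?_
        have hy : ∀ y : Data, (fairCoin.bind fun b => PMF.pure (decide (b = y.isOne))) = fairCoin :=
          fun y => fairCoin_map_eq y.isOne
        simp only [hy, PMF.bind_const]
      simp only [hc, PMF.bind_const]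
    · rfl
  simp only [hx, PMF.bind_const]

/-- There is only one empty tuple, and each message is recovered from its encoding by `C.D`. -/
theorem CorrelatedEncoding.subsingleton_msg {P : BasePKE} {k : ℕ → ℕ} (C : CorrelatedEncoding P k)
    {n : ℕ} (hn : k n = 0) : (C.Msg n).Subsingleton := by
  intro m hm m' hm'
  obtain ⟨t, ht⟩ := (C.E n m).support_nonempty
  obtain ⟨t', ht'⟩ := (C.E n m').support_nonempty
  rw [← C.D_E n m hm t ht, ← C.D_E n m' hm' t' ht']
  congr 1
  funext i
  exact (hn ▸ i).elim0

theorem exists_realization {k l q τ : ℕ → ℕ}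
    (hk : EfficientParam k) (hl : EfficientParam l) (hq : EfficientParam q)
    (hτ : EfficientParam τ) {P : BasePKE}
    (hP : DetPolyTime (α := fun _ => Data × Data) (fun n u => P.dec n u.1 u.2))
    (C : CorrelatedEncoding P k)
    (hD : DetPolyTime (α := fun n => Fin (k n) → Data) (β := fun _ => Data) C.D)
    (hC : C.TauCorrelated τ) (hVer : TauVerifiable P C τ)
    {ecc : ∀ n, (Fin (l n) → Fin (q n)) → (Fin (k n) → Fin (q n))}
    (hecc : DetPolyTime (α := fun n => Fin (l n) → Fin (q n))
      (β := fun n => Fin (k n) → Fin (q n)) ecc)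
    (hdist : ∀ n, ∀ v w : Fin (l n) → Fin (q n), v ≠ w → τ n ≤ hammingDist (ecc n v) (ecc n w))
    {SS : SigScheme (fun n => Fin (l n) → Fin (q n)) (fun n => Fin (k n) → Data)}
    (hSS : SS.Efficient) : ∃ verify recover, Nonempty (Realization τ C ecc SS verify recover) := by
  obtain ⟨recover, hrecover, hrec⟩ := hC
  obtain ⟨verify, hverify, hver⟩ := hVer
  obtain ⟨kF, hkF, hk⟩ := hk.exists_fp
  obtain ⟨lF, hlF, hl⟩ := hl.exists_fp
  obtain ⟨qF, hqF, hq⟩ := hq.exists_fp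
  obtain ⟨τF, hτF, hτ⟩ := hτ.exists_fp
  obtain ⟨eccF, heccF, hecc⟩ := hecc.exists_fp
  obtain ⟨verF, hverF, hsver⟩ := hSS.2.2.exists_fp
  obtain ⟨decF, hdecF, hdec⟩ := hP.exists_fp
  obtain ⟨verifyF, hverifyF, hverify⟩ := hverify.exists_fp
  obtain ⟨recoverF, hrecoverF, hrecover⟩ := hrecover.exists_fp
  obtain ⟨decodeF, hdecodeF, hdecode⟩ := hD.exists_fp
  have hparam : FP fun N => .pair N (.atom false) := FP.id.pair (FP.const _)
  exact ⟨verify, recover, ⟨{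
    kF := fun N => kF (.pair N (.atom false))
    lF := fun N => lF (.pair N (.atom false))
    qF := fun N => qF (.pair N (.atom false))
    τF := fun N => τF (.pair N (.atom false))
    eccF, verF, decF, verifyF, recoverF, decodeF
    fp_k := hkF.comp hparam
    fp_l := hlF.comp hparam
    fp_q := hqF.comp hparam
    fp_τ := hτF.comp hparam
    fp_ecc := heccF
    fp_ver := hverF
    fp_dec := hdecF
    fp_verify := hverifyF
    fp_recover := hrecoverF
    fp_decode := hdecodeF
    k_eq := fun n => hk n ()
    l_eq := fun n => hl n ()
    q_eq := fun n => hq n ()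
    τ_eq := fun n => hτ n ()
    ecc_eq := hecc
    ver_eq := fun n v c s => hsver n (v, (c, s))
    dec_eq := fun n s c => hdec n (s, c)
    verify_eq := fun n c pk r => hverify n (c, (pk, r))
    recover_eq := hrecover
    decode_eq := hdecode
    le_hammingDist := hdist
    recover_restrict := hrec
    verify_iff := hver }⟩⟩

end CorPKE

theorem theorem2 (k l q τ : ℕ → ℕ)
    (hk : EfficientParam k) (hl : EfficientParam l) (hq : EfficientParam q)
    (hτ : EfficientParam τ)
    (P : BasePKE) (hP : P.Efficient)
    (C : CorrelatedEncoding P k)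
    (hD : DetPolyTime (α := fun n => Fin (k n) → Data) (β := fun _ => Data) C.D)
    (hC : C.TauCorrelated τ)
    (hCor : (corPKE P C).Efficient)
    (hCPA : (corPKE P C).INDCPA)
    (hVer : TauVerifiable P C τ)
    (ecc : ∀ n, (Fin (l n) → Fin (q n)) → (Fin (k n) → Fin (q n)))
    (hecc : DetPolyTime (α := fun n => Fin (l n) → Fin (q n))
      (β := fun n => Fin (k n) → Fin (q n)) ecc)
    (hdist : ∀ n, ∀ v w : Fin (l n) → Fin (q n), v ≠ w → τ n ≤ hammingDist (ecc n v) (ecc n w))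
    (SS : SigScheme (fun n => Fin (l n) → Fin (q n)) (fun n => Fin (k n) → Data))
    (hSS : SS.Efficient)
    (hOT : SS.OTSU) :
    (ccaPKE P C ecc SS).INDCCA2 := by
  obtain ⟨verify, recover, ⟨R⟩⟩ := exists_realization hk hl hq hτ hP.2.2 C hD hC hVer hecc hdist hSS
  intro A₁ A₂ hA₁ hA₂
  obtain ⟨B₁, B₂, hB₁, hB₂, hB⟩ := map_snd_hybrid R hP.1 hSS hA₁ hA₂
  obtain ⟨F₁, F₂, hF₁, hF₂, hF⟩ := flagged_hybrid_le R hP.1 hCor.2.1 hA₁ hA₂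
  refine ((hCPA B₁ B₂ hB₁ hB₂).add (hOT F₁ F₂ hF₁ hF₂)).trans_abs_le fun n => ?_
  rw [abs_abs]
  refine le_trans ?_ (le_abs_self _)
  rw [Pi.add_apply]
  -- For `k n = 0` the forger has no second ciphertext to get signed, but then the experiment is a
  -- fair coin and the advantage is zero.
  rcases Nat.eq_zero_or_pos (k n) with hn | hn
  · rw [PKE.cca2Exp, PKE.indExp_of_subsingleton _ _ _ _ _ fun _ => C.subsingleton_msg hn,
      fairCoin_apply, sub_self, abs_zero]
    positivity
  · have h := (unflaggedLE_hybrid R A₁ A₂ n).abs_sub_le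
    rw [hB] at h
    have h' := ENNReal.toReal_mono (PMF.apply_ne_top _ _) (hF n hn)
    -- Triangle inequality through the simulated attack: the first distance is at most the
    -- probability of a forgery, the second is the CPA advantage.
    exact (abs_sub_le _ ((corPKE P C).cpaExp B₁ B₂ n true).toReal _).trans
      (by rw [add_comm]; exact add_le_add le_rfl (h.trans h'))
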